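/- Let $s,v>0$. For every $n\ge 1$ let $h_n$ be a Hermitian $n\times n$ matrix with an orthonormal basis of eigenvectors $\psi^{(n)}_j$, $h_n\psi^{(n)}_j=E^{(n)}_j\psi^{(n)}_j$, $j=1,\dots,n$, and assume that the normalized counting measures $\nu^{(n)}_0=n^{-1}\sum_{j=1}^n\delta_{E^{(n)}_j}$ converge weakly to a probability measure $\nu_0$ on $\mathbb R$. Let $w_n$ be a GUE matrix (Hermitian, with independent centred Gaussian entries, $\langle w_{jj}^2\rangle=1$, $\langle(\Re w_{jk})^2\rangle=\langle(\Im w_{jk})^2\rangle=\tfrac12$ for $j\ne k$), and $$H^{(n)}=s\,\sigma^z\otimes \mathbf 1_n+\mathbf 1_2\otimes h_n+v\,\sigma^x\otimes w_n/\sqrt n,\qquad \sigma^x=\begin{pmatrix}0&1\\1&0\end{pmatrix},\ \sigma^z=\begin{pmatrix}1&0\\0&-1\end{pmatrix},$$ the basis of $\mathbb C^2$ being indexed by $\alpha=\pm$. Let $\rho(0)$ be a positive semidefinite $2\times2$ matrix of trace $1$, let $P_k$ be the orthogonal projection on $\psi^{(n)}_k$, and let $$\rho^{(n)}_{\alpha,\delta}(E^{(n)}_k,t)=\sum_{j=1}^n\Big\langle\big(e^{-itH^{(n)}}(\rho(0)\otimes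 P_k)e^{itH^{(n)}}\big)_{\alpha j,\delta j}\Big\rangle$$ be the mean reduced density matrix, where $\langle\cdot\rangle$ is the expectation over $w_n$. Choose indices $k_n$ such that $E^{(n)}_{k_n}\to E\in\mathbb R$. There are probability measures $\nu_\pm$ on $\mathbb R$ whose Stieltjes transforms $f_\alpha(z)=\int\nu_\alpha(d\lambda)(\lambda-z)^{-1}$ form the unique pair of functions analytic for $\Im z\neq0$ with $\Im f_\alpha(z)\,\Im z>0$ and $$f_\alpha(z)=\int\nu_0(dE')\,f_\alpha(E',z),\qquad f_\alpha(E',z)=\frac1{E'+\alpha s-z-v^2f_{-\alpha}(z)},\qquad \alpha=\pm .$$ Put $f_{\beta,\gamma}(z_1,z_2)=\int\nu_0(dE')f_\beta(E',z_1)f_\gamma(E',z_2)$. Then $1-v^4f_{\alpha,\delta}(z_1,z_2)f_{-\alpha,-\delta}(z_1,z_2)\ne0$ whenever $\Im z_1>0>\Im z_2$, and for all $\alpha,\delta=\pm$ the limit $$\rho_{\alpha,\delta}(E,t)=\lim_{n\to\infty}\rho^{(n)}_{\alpha,\delta}(E^{(n)}_{k_n},t)$$ exists uniformly in $t\in[0,T]$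 for every $T>0$, and for every $t>0$ and all $\eta_1,\eta_2>0$ $$\rho_{\alpha,\delta}(E,t)=\frac1{(2\pi)^2}\int_{L_2}dz_2\int_{L_1}dz_1\,e^{it(z_2-z_1)}\,\frac{f_\alpha(E,z_1)f_\delta(E,z_2)\rho_{\alpha,\delta}(0)+v^2f_{-\alpha}(E,z_1)f_{-\delta}(E,z_2)f_{\alpha,\delta}(z_1,z_2)\rho_{-\alpha,-\delta}(0)}{1-v^4f_{\alpha,\delta}(z_1,z_2)f_{-\alpha,-\delta}(z_1,z_2)},$$ where $L_1=\mathbb R+i\eta_1$, $L_2=\mathbb R-i\eta_2$, and the iterated integral is understood as an iterated limit, as $N\to\infty$, of integrals over the segments $[-N+i\eta_1,N+i\eta_1]$ and $[-N-i\eta_2,N-i\eta_2]$ (these limits exist). -/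

import Mathlib

open MeasureTheory ProbabilityTheory Filter Topology Matrix
open scoped BoundedContinuousFunction Kronecker ComplexOrder

noncomputable section

namespace QRelax

/-! The two levels of the small system are labelled by `ℤˣ = {1, -1}`. -/

/-- The label `α = ±1` as a complex number. -/
def sgn (α : ℤˣ) : ℂ := ((α : ℤ) : ℂ)

/-- The Pauli matrix `σ^z`. -/
def sigmaZ : Matrix ℤˣ ℤˣ ℂ := Matrix.diagonal sgn

/-- The Pauli matrix `σ^x`. -/
def sigmaX : Matrix ℤˣ ℤˣ ℂ := Matrix.of fun α β => if β = -α then 1 else 0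

/-- A Hermitian matrix assembled from `n²` real numbers: `w_jj = x_jj`, and
`w_jk = (x_jk + i x_kj) / √2`, `w_kj = (x_jk - i x_kj) / √2` for `j < k`. -/
def gueMatrix {n : ℕ} (x : Fin n → Fin n → ℝ) : Matrix (Fin n) (Fin n) ℂ :=
  Matrix.of fun j k =>
    if j = k then (x j j : ℂ)
    else if j < k then ((x j k : ℂ) + Complex.I * (x k j : ℂ)) / (Real.sqrt 2 : ℂ)
    else ((x k j : ℂ) - Complex.I * (x j k : ℂ)) / (Real.sqrt 2 : ℂ)

/-- The law of `n²` independent standard real Gaussian variables. Under this law `gueMatrix` is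
a GUE matrix: `w_jj` has variance `1`, `Re w_jk` and `Im w_jk` (`j < k`) have variance `1 / 2`,
all independent and centred. -/
def gaussians (n : ℕ) : Measure (Fin n → Fin n → ℝ) :=
  Measure.pi fun _ => Measure.pi fun _ => gaussianReal 0 1

/-- The Hamiltonian `s σ^z ⊗ 1 + 1 ⊗ h + v σ^x ⊗ w / √n`. -/
def hamiltonian {n : ℕ} (s v : ℝ) (h w : Matrix (Fin n) (Fin n) ℂ) :
    Matrix (ℤˣ × Fin n) (ℤˣ × Fin n) ℂ :=
  (s : ℂ) • (sigmaZ ⊗ₖ (1 : Matrix (Fin n) (Fin n) ℂ))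
    + (1 : Matrix ℤˣ ℤˣ ℂ) ⊗ₖ h
    + (v : ℂ) • (sigmaX ⊗ₖ (((Real.sqrt (n : ℝ) : ℝ) : ℂ)⁻¹ • w))

/-- The evolution `e^{itH}`. -/
def evolution {ι : Type*} [Fintype ι] [DecidableEq ι] (H : Matrix ι ι ℂ) (t : ℝ) :
    Matrix ι ι ℂ :=
  NormedSpace.exp ((Complex.I * (t : ℂ)) • H)

/-- The rank-one matrix `ψ ψ*`, the orthogonal projection on `ψ` if `ψ` is a unit vector. -/
def proj {n : ℕ} (ψ : EuclideanSpace ℂ (Fin n)) : Matrix (Fin n) (Fin n) ℂ :=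
  Matrix.of fun i j => ψ i * star (ψ j)

/-- The density matrix `e^{-itH} (ρ(0) ⊗ P_ψ) e^{itH}` of the composite system at time `t`. -/
def density {n : ℕ} (s v : ℝ) (h w : Matrix (Fin n) (Fin n) ℂ) (rho0 : Matrix ℤˣ ℤˣ ℂ)
    (ψ : EuclideanSpace ℂ (Fin n)) (t : ℝ) : Matrix (ℤˣ × Fin n) (ℤˣ × Fin n) ℂ :=
  evolution (hamiltonian s v h w) (-t) * (rho0 ⊗ₖ proj ψ) * evolution (hamiltonian s v h w) t

/-- The reduced density matrix: the partial trace over the reservoir. -/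
def reducedDensity {n : ℕ} (s v : ℝ) (h w : Matrix (Fin n) (Fin n) ℂ) (rho0 : Matrix ℤˣ ℤˣ ℂ)
    (ψ : EuclideanSpace ℂ (Fin n)) (t : ℝ) : Matrix ℤˣ ℤˣ ℂ :=
  Matrix.of fun α δ => ∑ j : Fin n, density s v h w rho0 ψ t (α, j) (δ, j)

/-- The mean reduced density matrix: expectation over the GUE matrix. -/
def meanReducedDensity {n : ℕ} (s v : ℝ) (h : Matrix (Fin n) (Fin n) ℂ)
    (rho0 : Matrix ℤˣ ℤˣ ℂ) (ψ : EuclideanSpace ℂ (Fin n)) (t : ℝ) : Matrix ℤˣ ℤˣ ℂ :=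
  Matrix.of fun α δ => ∫ x, reducedDensity s v h (gueMatrix x) rho0 ψ t α δ ∂(gaussians n)

/-- The normalized counting measure of the numbers `e_1, …, e_n`. -/
def countingMeasure {n : ℕ} (e : Fin n → ℝ) : Measure ℝ :=
  (n : ENNReal)⁻¹ • ∑ j : Fin n, Measure.dirac (e j)

/-- The Stieltjes transform of a measure on the line. -/
def stieltjes (m : Measure ℝ) (z : ℂ) : ℂ := ∫ x : ℝ, ((x : ℂ) - z)⁻¹ ∂m

/-- `f_α(E, z) = (E + α s - z - v² f_{-α}(z))⁻¹`. -/
def fE (s v : ℝ) (f : ℤˣ → ℂ → ℂ) (α : ℤˣ) (E : ℝ) (z : ℂ) : ℂ :=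
  ((E : ℂ) + sgn α * (s : ℂ) - z - (v : ℂ) ^ 2 * f (-α) z)⁻¹

/-- The pair `f_±` is analytic off the real axis, satisfies `Im f_α(z) · Im z > 0` there, and
solves `f_α(z) = ∫ ν₀(dE) (E + α s - z - v² f_{-α}(z))⁻¹`. -/
structure IsSolution (nu0 : Measure ℝ) (s v : ℝ) (f : ℤˣ → ℂ → ℂ) : Prop where
  analytic : ∀ α, DifferentiableOn ℂ (f α) {z : ℂ | z.im ≠ 0}
  im_pos : ∀ α (z : ℂ), z.im ≠ 0 → 0 < (f α z).im * z.im
  eqn : ∀ α (z : ℂ), z.im ≠ 0 → f α z = ∫ E : ℝ, fE s v f α E z ∂nu0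

/-- `f_{βγ}(z₁, z₂) = ∫ ν₀(dE) f_β(E, z₁) f_γ(E, z₂)`. -/
def twoPoint (nu0 : Measure ℝ) (s v : ℝ) (f : ℤˣ → ℂ → ℂ) (β γ : ℤˣ) (z₁ z₂ : ℂ) : ℂ :=
  ∫ E : ℝ, fE s v f β E z₁ * fE s v f γ E z₂ ∂nu0

/-- The denominator `1 - v⁴ f_{αδ}(z₁, z₂) f_{-α,-δ}(z₁, z₂)`. -/
def denom (nu0 : Measure ℝ) (s v : ℝ) (f : ℤˣ → ℂ → ℂ) (α δ : ℤˣ) (z₁ z₂ : ℂ) : ℂ :=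
  1 - (v : ℂ) ^ 4 * twoPoint nu0 s v f α δ z₁ z₂ * twoPoint nu0 s v f (-α) (-δ) z₁ z₂

/-- The integrand of the limiting formula at time `t`. -/
def integrand (nu0 : Measure ℝ) (s v : ℝ) (f : ℤˣ → ℂ → ℂ) (rho0 : Matrix ℤˣ ℤˣ ℂ) (E t : ℝ)
    (α δ : ℤˣ) (z₁ z₂ : ℂ) : ℂ :=
  Complex.exp (Complex.I * (t : ℂ) * (z₂ - z₁)) *
    ((fE s v f α E z₁ * fE s v f δ E z₂ * rho0 α δ
      + (v : ℂ) ^ 2 * fE s v f (-α) E z₁ * fE s v f (-δ) E z₂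
        * twoPoint nu0 s v f α δ z₁ z₂ * rho0 (-α) (-δ))
      / denom nu0 s v f α δ z₁ z₂)

/-- The integral of `g` over the line `Im z = η`, oriented to the right, exists as the limit of
the integrals over `[-N + iη, N + iη]` and equals `a`. -/
def HasLineIntegral (g : ℂ → ℂ) (η : ℝ) (a : ℂ) : Prop :=
  (∀ N : ℝ, IntervalIntegrable (fun x : ℝ => g ((x : ℂ) + (η : ℂ) * Complex.I)) volume (-N) N) ∧
  Tendsto (fun N : ℝ => ∫ x in (-N)..N, g ((x : ℂ) + (η : ℂ) * Complex.I)) atTop (𝓝 a)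

/-- The iterated integral `∫_{Im z₂ = -η₂} dz₂ ∫_{Im z₁ = η₁} dz₁ F(z₁, z₂)` exists and
equals `a`. -/
def HasIteratedLineIntegral (F : ℂ → ℂ → ℂ) (η₁ η₂ : ℝ) (a : ℂ) : Prop :=
  ∃ G : ℂ → ℂ, (∀ z₂ : ℂ, z₂.im = -η₂ → HasLineIntegral (fun z₁ => F z₁ z₂) η₁ (G z₂)) ∧
    HasLineIntegral G (-η₂) a

end QRelax

end

/-! In the eigenbasis of the reservoir the mean reduced density matrix is a combination of means of
entries of `e^{it₂H} J e^{-it₁H}` at `t₁ = t₂ = t`, with `J` a fixed matrix implementing the partial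
trace (`meanReducedDensity_eq`). A Laplace transform in each of the two times, kept independent,
replaces the evolutions by resolvents `G(z₁)`, `G(z₂)` of the Hamiltonian. The theorem thus splits
into a limit for the mean of a product of two resolvents and a return to the time domain.

Means of resolvents are handled by Gaussian integration by parts, `⟨w_ab F⟩ = ⟨∂F/∂w_ba⟩`
(`gue_integration_by_parts`, `schwinger_dyson`). The result contains normalized partial traces of
`G`. As functions of `n²` independent Gaussians these are Lipschitz in each variable, with squared
constants summing to `O(1/n)`, so they have variance `O(1/n)` (`variance_lipschitz_stdGN`,
`ptr_concentration`) and may be replaced by their means. The partial traces between different levels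
have mean zero, because `w ↦ -w` is implemented by conjugation with `σ^z ⊗ 1` (`integral_GX_off`).
What remains are closed equations with vanishing errors: `gbar_equation` for one resolvent, and
`two_point_equation` for two, which relates the level pairs `(α, δ)` and `(-α, -δ)` linearly.

Both are stable for one reason. Imaginary parts of the self-consistent equation give `v⁴
∫|f_α(E,z)|² ∫|f_{-α}(E,z)|² < 1` (`sqMean_mul_lt_one`), and Cauchy–Schwarz turns this into `|v⁴ T
T'| < 1` for the cross integrals `T`, `T'` of two solutions at two nonreal points (`cross_lt_one`).
With two solutions at one point this is uniqueness (`solvesAt_unique`); with one solution at two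
points it is the nonvanishing of the denominator. Compactness and uniqueness give convergence of the
mean partial traces (`exists_limit`). Their limits are Stieltjes transforms of probability measures
by tightness, read off from the behaviour at `i∞` (`exists_measures`). Eliminating between the two
coupled equations gives the two-resolvent limit (`tendsto_twoGreen`).

For the return to time, the mean evolutions are bounded and Lipschitz in each time uniformly in `n`:
only the norm of one column of the Hamiltonian enters, and its second moment is bounded. For such
families, convergence of Laplace transforms on a line forces convergence of the functions
(`tendsto_of_laplace_tendsto`), and symmetric line integrals invert the transform
(`fourier_inversion_lipschitz`). Doing this in the first time with `z₂` fixed, then in the second,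
gives the iterated integral in the stated order (`evolved_limit`); equicontinuity makes the
convergence uniform on `[0, T]`. -/

namespace QRelax

/-! ### Fourier inversion at a point under a Lipschitz condition -/

section Laplace

/-- `e^{ixτ}` integrated over a symmetric interval. -/
lemma integral_exp_symm (N y : ℝ) (hy : y ≠ 0) :
    ∫ x in (-N)..N, Complex.exp (Complex.I * x * y)
      = (Complex.exp (Complex.I * N * y) - Complex.exp (-(Complex.I * N * y)))
        * (Complex.I * y)⁻¹ := by
  have hc : Complex.I * (y : ℂ) ≠ 0 := mul_ne_zero Complex.I_ne_zero (by exact_mod_cast hy)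
  have := integral_exp_mul_complex (a := -N) (b := N) hc
  rw [div_eq_mul_inv] at this
  rw [show (fun x : ℝ => Complex.exp (Complex.I * x * y))
    = fun x : ℝ => Complex.exp (Complex.I * y * x) by ext x; congr 1; ring, this]
  congr 3
  · ring
  · push_cast; ring

lemma norm_exp_I_mul (a b : ℝ) : ‖Complex.exp (Complex.I * a * b)‖ = 1 := by
  rw [show Complex.I * (a : ℂ) * b = ((a * b : ℝ) : ℂ) * Complex.I by push_cast; ring]
  exact Complex.norm_exp_ofReal_mul_I _

/-- Moving the origin to `t` only multiplies the Fourier integral by a phase of modulus one. The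
factor `σ` is there because both exponentials of the Dirichlet kernel are needed. -/
lemma riemann_lebesgue (u : ℝ → ℂ) (t σ : ℝ) (hσ : σ ≠ 0) :
    Tendsto (fun N : ℝ => ∫ τ : ℝ, Complex.exp (Complex.I * (σ * N : ℝ) * ((τ - t : ℝ) : ℂ)) * u τ)
      atTop (𝓝 0) := by
  have h1 : Tendsto (fun N : ℝ => -(σ * N) / (2 * Real.pi)) atTop (cocompact ℝ) := by
    have : Tendsto (fun N : ℝ => (-σ / (2 * Real.pi)) * N) (cocompact ℝ) (cocompact ℝ) :=
      tendsto_cocompact_mul_left₀ (div_ne_zero (neg_ne_zero.2 hσ) (by positivity))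
    refine (this.comp atTop_le_cocompact).congr fun N => ?_
    simp only [Function.comp]; ring
  have h2 := (Real.tendsto_integral_exp_smul_cocompact u).comp h1
  rw [tendsto_zero_iff_norm_tendsto_zero] at h2 ⊢
  refine h2.congr fun N => ?_
  simp only [Function.comp]
  have : ∀ τ : ℝ, Complex.exp (Complex.I * (σ * N : ℝ) * ((τ - t : ℝ) : ℂ)) * u τ
      = Complex.exp (Complex.I * (σ * N : ℝ) * ((-t : ℝ) : ℂ)) *
        ((Real.fourierChar (-(τ * (-(σ * N) / (2 * Real.pi))))) • u τ) := by
    intro τ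
    rw [Circle.smul_def, Real.fourierChar_apply, smul_eq_mul, ← mul_assoc, ← Complex.exp_add]
    congr 2
    have : (Real.pi : ℂ) ≠ 0 := by exact_mod_cast Real.pi_ne_zero
    push_cast
    field_simp
    ring
  simp_rw [this]
  rw [integral_const_mul, norm_mul, norm_exp_I_mul, one_mul]

/-- Fubini on a bounded interval times the line. The inner integral that appears is the Dirichlet
kernel, evaluated in `integral_exp_symm`. -/
lemma swap_symm_integral (h : ℝ → ℂ) (hh : Integrable h) (t N : ℝ) :
    ∫ x in (-N)..N, Complex.exp (-(Complex.I * x * t)) * ∫ τ : ℝ, Complex.exp (Complex.I * x * τ) * h τ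
      = ∫ τ, h τ * ∫ x in (-N)..N, Complex.exp (Complex.I * x * ((τ - t : ℝ) : ℂ)) := by
  have h1 : ∀ x : ℝ, Complex.exp (-(Complex.I * x * t)) *
      ∫ τ : ℝ, Complex.exp (Complex.I * x * τ) * h τ
      = ∫ τ, h τ * Complex.exp (Complex.I * x * ((τ - t : ℝ) : ℂ)) := by
    intro x
    rw [← integral_const_mul]
    refine integral_congr_ae (.of_forall fun τ => ?_)
    simp only
    rw [← mul_assoc, ← Complex.exp_add, mul_comm]
    congr 2
    push_cast; ring
  simp_rw [h1, ← intervalIntegral.integral_const_mul]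
  have : IsFiniteMeasure (volume.restrict (Set.uIoc (-N) N)) := ⟨by simp [Set.uIoc]⟩
  rw [intervalIntegral_integral_swap]
  have : Integrable (fun p : ℝ × ℝ => h p.2)
      ((volume.restrict (Set.uIoc (-N) N)).prod (volume : Measure ℝ)) := hh.comp_snd _
  refine this.mono (this.aestronglyMeasurable.mul ?_) (.of_forall fun p => ?_)
  · exact Continuous.aestronglyMeasurable (by fun_prop)
  · simp only [Function.uncurry]
    rw [norm_mul, norm_exp_I_mul, mul_one]

/-- The Dini criterion for the inversion of the Fourier transform. -/
lemma fourier_inversion_lipschitz (g : ℝ → ℂ) (hg : Integrable g) (t r L : ℝ) (hr : 0 < r)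
    (hL : ∀ τ, |τ - t| < r → ‖g τ - g t‖ ≤ L * |τ - t|) :
    Tendsto (fun N : ℝ => ∫ x in (-N)..N, Complex.exp (-(Complex.I * x * t)) *
      ∫ τ : ℝ, Complex.exp (Complex.I * x * τ) * g τ) atTop (𝓝 (2 * Real.pi * g t)) := by
  -- A Gaussian bump with the same value as `g` at `t`. Its inversion is an explicit computation,
  -- and the difference `h` vanishes linearly at `t`, so the Dirichlet integral itself is never
  -- evaluated.
  set φ : ℝ → ℂ := fun τ => g t * Complex.exp (-1 * ((τ - t : ℝ) : ℂ) ^ 2) with hφ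
  have hφi : Integrable φ :=
    ((integrable_cexp_neg_mul_sq (b := 1) (by simp)).comp_sub_right t).const_mul _
  set h : ℝ → ℂ := fun τ => g τ - φ τ with hhdef
  have hh : Integrable h := hg.sub hφi
  have hexp : ∀ y : ℝ, ‖(1 : ℂ) - Complex.exp (-1 * (y : ℂ) ^ 2)‖ ≤ y ^ 2 := by
    intro y
    rw [show (1 : ℂ) - Complex.exp (-1 * (y : ℂ) ^ 2) = ((1 - Real.exp (-y ^ 2) : ℝ) : ℂ) by
      push_cast; congr 2; ring, Complex.norm_real, Real.norm_eq_abs, abs_of_nonneg]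
    · have := Real.add_one_le_exp (-y ^ 2); linarith
    · have : Real.exp (-y ^ 2) ≤ 1 := Real.exp_le_one_iff.2 (by nlinarith)
      linarith
  have hloc : ∀ τ, |τ - t| < r → ‖h τ‖ ≤ (L + ‖g t‖ * r) * |τ - t| := by
    intro τ hτ
    have : h τ = (g τ - g t) + g t * (1 - Complex.exp (-1 * ((τ - t : ℝ) : ℂ) ^ 2)) := by
      simp only [hhdef, hφ]; ring
    rw [this]
    refine (norm_add_le _ _).trans ?_
    rw [norm_mul, add_mul]
    refine add_le_add (hL τ hτ) ?_
    rw [mul_assoc]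
    gcongr
    refine (hexp _).trans ?_
    rw [← sq_abs, sq]
    gcongr
  -- The singular denominator of the Dirichlet kernel is absorbed into `u`, which is integrable:
  -- bounded near `t` by `hloc`, and at most `‖h τ‖ / r` elsewhere.
  set u : ℝ → ℂ := fun τ => h τ * (Complex.I * ((τ - t : ℝ) : ℂ))⁻¹ with hu
  have hum : AEStronglyMeasurable u :=
    hh.aestronglyMeasurable.mul (by fun_prop : Measurable fun τ : ℝ =>
      (Complex.I * ((τ - t : ℝ) : ℂ))⁻¹).aestronglyMeasurable
  have hui : Integrable u := by
    have hdom : Integrable (fun τ => (Set.Ioo (t - r) (t + r)).indicator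
        (fun _ => |L + ‖g t‖ * r|) τ + ‖h τ‖ * r⁻¹) := by
      refine Integrable.add ?_ (hh.norm.mul_const _)
      rw [integrable_indicator_iff measurableSet_Ioo]
      exact integrableOn_const (by simp)
    refine hdom.mono' hum (.of_forall fun τ => ?_)
    simp only [hu]
    rw [norm_mul, norm_inv, norm_mul, Complex.norm_I, one_mul, Complex.norm_real, Real.norm_eq_abs]
    by_cases hτ : |τ - t| < r
    · rw [Set.indicator_of_mem (by rw [abs_lt] at hτ; constructor <;> linarith)]
      have h1 := hloc τ hτ
      by_cases h0 : |τ - t| = 0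
      · rw [h0, _root_.inv_zero, mul_zero]; positivity
      · have hpos : 0 < |τ - t| := lt_of_le_of_ne (abs_nonneg _) (Ne.symm h0)
        have : ‖h τ‖ * |τ - t|⁻¹ ≤ L + ‖g t‖ * r := by
          rw [← div_eq_mul_inv, div_le_iff₀ hpos]; exact h1
        have h3 : 0 ≤ ‖h τ‖ * r⁻¹ := by positivity
        linarith [le_abs_self (L + ‖g t‖ * r)]
    · rw [Set.indicator_of_notMem, zero_add]
      · gcongr; exact not_lt.1 hτ
      · intro hmem; apply hτ; rw [abs_lt]; constructor <;> linarith [hmem.1, hmem.2]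
  have hfirst : Tendsto (fun N : ℝ => ∫ x in (-N)..N, Complex.exp (-(Complex.I * x * t)) *
      ∫ τ : ℝ, Complex.exp (Complex.I * x * τ) * h τ) atTop (𝓝 0) := by
    have e1 := (riemann_lebesgue u t 1 one_ne_zero).sub
      (riemann_lebesgue u t (-1) (by norm_num))
    rw [sub_zero] at e1
    refine e1.congr fun N => ?_
    rw [swap_symm_integral h hh, ← integral_sub]
    · have hne : ∀ᵐ τ : ℝ, τ ≠ t := by simp [ae_iff]
      refine integral_congr_ae (hne.mono fun τ hτ => ?_)
      simp only [hu]
      rw [integral_exp_symm N (τ - t) (sub_ne_zero.2 hτ)]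
      rw [show Complex.I * ((-1 * N : ℝ) : ℂ) * ((τ - t : ℝ) : ℂ)
        = -(Complex.I * N * ((τ - t : ℝ) : ℂ)) by push_cast; ring, one_mul]
      ring
    all_goals
      refine hui.mono ((Continuous.aestronglyMeasurable (by fun_prop)).mul hum)
        (.of_forall fun τ => ?_)
      rw [norm_mul, norm_exp_I_mul, one_mul]
  have hsecond : Tendsto (fun N : ℝ => ∫ x in (-N)..N, Complex.exp (-(Complex.I * x * t)) *
      ∫ τ : ℝ, Complex.exp (Complex.I * x * τ) * φ τ) atTop (𝓝 (2 * Real.pi * g t)) := by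
    -- The phase cancels and leaves `√π g(t) e^{-x²/4}`, whose integral over the line is `√π · 2√π ·
    -- g(t)`.
    have hval : ∀ x : ℝ, Complex.exp (-(Complex.I * x * t)) *
        ∫ τ : ℝ, Complex.exp (Complex.I * x * τ) * φ τ
        = (g t * (Real.sqrt Real.pi : ℝ)) * ((Real.exp (-(1 / 4) * x ^ 2) : ℝ) : ℂ) := by
      intro x
      have h1 : ∫ τ : ℝ, Complex.exp (Complex.I * x * τ) * φ τ
          = ∫ τ : ℝ, (Complex.exp (Complex.I * x * t) * g t) *
            (Complex.exp (Complex.I * x * τ) * Complex.exp (-1 * (τ : ℂ) ^ 2)) := by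
        rw [← integral_add_right_eq_self _ t]
        refine integral_congr_ae (.of_forall fun τ => ?_)
        simp only [hφ, add_sub_cancel_right]
        push_cast
        rw [mul_add, Complex.exp_add]; ring
      rw [h1, integral_const_mul, fourierIntegral_gaussian (by simp : 0 < (1 : ℂ).re)]
      have h2 : Complex.exp (-(Complex.I * x * t)) * Complex.exp (Complex.I * x * t) = 1 := by
        rw [← Complex.exp_add]; simp
      have h3 : ((Real.pi : ℂ) / 1) ^ (1 / 2 : ℂ) = (Real.sqrt Real.pi : ℝ) := by
        rw [div_one, Real.sqrt_eq_rpow, Complex.ofReal_cpow Real.pi_pos.le]; norm_num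
      have h4 : Complex.exp (-(x : ℂ) ^ 2 / (4 * 1)) = ((Real.exp (-(1 / 4) * x ^ 2) : ℝ) : ℂ) := by
        push_cast; congr 1; ring
      rw [h3, h4]
      linear_combination (g t * (Real.sqrt Real.pi : ℝ) *
        ((Real.exp (-(1 / 4) * x ^ 2) : ℝ) : ℂ)) * h2
    simp_rw [hval]
    have hint : Integrable (fun x : ℝ => (g t * (Real.sqrt Real.pi : ℝ)) *
        ((Real.exp (-(1 / 4) * x ^ 2) : ℝ) : ℂ)) :=
      ((integrable_exp_neg_mul_sq (by norm_num : (0 : ℝ) < 1 / 4)).ofReal).const_mul _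
    have := intervalIntegral_tendsto_integral hint tendsto_neg_atTop_atBot tendsto_id
    convert! this using 2
    rw [integral_const_mul, integral_complex_ofReal, integral_gaussian]
    have : Real.sqrt (Real.pi / (1 / 4)) = 2 * Real.sqrt Real.pi := by
      rw [show Real.pi / (1 / 4) = 2 ^ 2 * Real.pi by ring, Real.sqrt_mul (by norm_num),
        Real.sqrt_sq (by norm_num)]
    rw [this]
    have h5 : ((Real.sqrt Real.pi : ℝ) : ℂ) * (Real.sqrt Real.pi : ℝ) = Real.pi := by
      rw [← Complex.ofReal_mul, Real.mul_self_sqrt Real.pi_pos.le]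
    push_cast
    linear_combination (-2 * g t) * h5
  have hsum := hfirst.add hsecond
  rw [zero_add] at hsum
  refine hsum.congr fun N => ?_
  have hcont : ∀ f : ℝ → ℂ, Integrable f → Continuous (fun x : ℝ =>
      Complex.exp (-(Complex.I * x * t)) * ∫ τ : ℝ, Complex.exp (Complex.I * x * τ) * f τ) := by
    intro f hf
    refine Continuous.mul (by fun_prop) ?_
    refine continuous_of_dominated (bound := fun τ => ‖f τ‖) (fun x => ?_) (fun x => ?_)
      hf.norm (.of_forall fun τ => by fun_prop)
    · exact (Continuous.aestronglyMeasurable (by fun_prop)).mul hf.aestronglyMeasurable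
    · refine .of_forall fun τ => ?_
      rw [norm_mul, norm_exp_I_mul, one_mul]
  rw [← intervalIntegral.integral_add ((hcont h hh).intervalIntegrable _ _)
    ((hcont φ hφi).intervalIntegrable _ _)]
  refine intervalIntegral.integral_congr fun x _ => ?_
  have hexpi : ∀ f : ℝ → ℂ, Integrable f → Integrable fun τ : ℝ =>
      Complex.exp (Complex.I * x * τ) * f τ := fun f hf =>
    hf.mono ((Continuous.aestronglyMeasurable (by fun_prop)).mul hf.aestronglyMeasurable)
      (.of_forall fun τ => by rw [norm_mul, norm_exp_I_mul, one_mul])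
  rw [← mul_add, ← integral_add (hexpi h hh) (hexpi φ hφi)]
  congr 2
  ext τ
  simp only [hhdef]; ring

end Laplace

/-! ### Inversion and continuity theorem for the Laplace transform on the half-line -/

section Laplace

/-- The Laplace transform `∫₀^∞ e^{izτ} k(τ) dτ`. -/
noncomputable def laplace (k : ℝ → ℂ) (z : ℂ) : ℂ :=
  ∫ τ in Set.Ioi (0 : ℝ), Complex.exp (Complex.I * z * τ) * k τ

lemma norm_exp_I_mul_complex (z : ℂ) (τ : ℝ) :
    ‖Complex.exp (Complex.I * z * τ)‖ = Real.exp (-(z.im * τ)) := by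
  rw [Complex.norm_exp]; congr 1; simp

variable {E : Type*} [NormedAddCommGroup E] [NormedSpace ℂ E]

lemma integrable_exp_smul {f : ℝ → E} (hf : Integrable f) (x : ℝ) :
    Integrable fun τ : ℝ => Complex.exp (Complex.I * x * τ) • f τ := by
  have hc : Continuous fun τ : ℝ => Complex.exp (Complex.I * x * τ) := by fun_prop
  exact hf.mono (hc.aestronglyMeasurable.smul hf.aestronglyMeasurable)
    (.of_forall fun τ => by rw [norm_smul, norm_exp_I_mul, one_mul])

/-- The function `e^{-ητ} k(τ)` on the half-line, extended by zero. -/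
noncomputable def damp (k : ℝ → E) (η : ℝ) : ℝ → E :=
  (Set.Ioi (0 : ℝ)).indicator fun τ => Complex.exp (Complex.I * (η * Complex.I) * τ) • k τ

lemma damp_integrable (k : ℝ → E) (C η : ℝ) (hη : 0 < η)
    (hk : ContinuousOn k (Set.Ioi 0)) (hC : ∀ t, 0 ≤ t → ‖k t‖ ≤ C) : Integrable (damp k η) := by
  unfold damp
  rw [integrable_indicator_iff measurableSet_Ioi]
  have h1 : IntegrableOn (fun τ : ℝ => Real.exp (-η * τ) * C) (Set.Ioi 0) :=
    (integrableOn_exp_mul_Ioi (by linarith) 0).mul_const C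
  refine h1.mono' ?_ ?_
  · exact (ContinuousOn.smul (by fun_prop) hk).aestronglyMeasurable measurableSet_Ioi
  · refine (ae_restrict_mem measurableSet_Ioi).mono fun τ hτ => ?_
    rw [norm_smul, norm_exp_I_mul_complex]
    have : ((η : ℂ) * Complex.I).im = η := by simp
    rw [this, neg_mul]
    gcongr
    exact hC τ (le_of_lt hτ)

lemma laplace_eq_damp (k : ℝ → ℂ) (x η : ℝ) :
    laplace k (x + η * Complex.I) = ∫ τ : ℝ, Complex.exp (Complex.I * x * τ) * damp k η τ := by
  unfold laplace damp
  rw [← integral_indicator measurableSet_Ioi]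
  congr 1
  ext τ
  by_cases hτ : τ ∈ Set.Ioi (0 : ℝ)
  · simp only [Set.indicator_of_mem hτ, smul_eq_mul]
    rw [← mul_assoc, ← Complex.exp_add]; congr 2; ring
  · simp only [Set.indicator_of_notMem hτ, mul_zero]

omit [NormedSpace ℂ E] in
lemma continuousOn_of_lipschitz_half {k : ℝ → E} {L : ℝ}
    (hL : ∀ s t, 0 ≤ s → 0 ≤ t → ‖k s - k t‖ ≤ L * |s - t|) : ContinuousOn k (Set.Ioi 0) := by
  have : LipschitzOnWith (Real.toNNReal L) k (Set.Ici 0) := by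
    refine LipschitzOnWith.of_dist_le_mul fun s hs t ht => ?_
    rw [dist_eq_norm, Real.dist_eq]
    exact (hL s t hs ht).trans (by gcongr; exact Real.le_coe_toNNReal L)
  exact this.continuousOn.mono Set.Ioi_subset_Ici_self

/-- Inversion of the Laplace transform of a bounded Lipschitz function along `Im z = η > 0`. -/
lemma laplace_inversion_upper (k : ℝ → ℂ) (C L : ℝ) (hC : ∀ t, 0 ≤ t → ‖k t‖ ≤ C)
    (hL : ∀ s t, 0 ≤ s → 0 ≤ t → ‖k s - k t‖ ≤ L * |s - t|) (η : ℝ) (hη : 0 < η)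
    (t : ℝ) (ht : 0 < t) :
    Tendsto (fun N : ℝ => ∫ x in (-N)..N, Complex.exp (-(Complex.I * t * (x + η * Complex.I))) *
      laplace k (x + η * Complex.I)) atTop (𝓝 (2 * Real.pi * k t)) := by
  have hcont := continuousOn_of_lipschitz_half hL
  have hC0 : 0 ≤ C := (norm_nonneg _).trans (hC 0 le_rfl)
  have hL0 : 0 ≤ L := by
    have := hL 0 1 le_rfl zero_le_one
    norm_num at this
    exact (norm_nonneg _).trans this
  have hexp : ∀ a b : ℝ, 0 ≤ a → 0 ≤ b →
      ‖Complex.exp (Complex.I * (η * Complex.I) * a) - Complex.exp (Complex.I * (η * Complex.I) * b)‖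
        ≤ η * |a - b| := by
    intro a b ha hb
    have : ∀ a b : ℝ, 0 ≤ a → a ≤ b → |Real.exp (-η * a) - Real.exp (-η * b)| ≤ η * |a - b| := by
      intro a b ha hab
      rw [abs_sub_comm a b, abs_of_nonneg (sub_nonneg.2 hab), abs_of_nonneg]
      · have h1 := Real.add_one_le_exp (-η * (b - a))
        have h2 : Real.exp (-η * b) = Real.exp (-η * a) * Real.exp (-η * (b - a)) := by
          rw [← Real.exp_add]; congr 1; ring
        have h3 : Real.exp (-η * a) ≤ 1 := Real.exp_le_one_iff.2 (by nlinarith)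
        have h4 : 0 ≤ Real.exp (-η * a) := (Real.exp_pos _).le
        have h5 : 0 ≤ η * (b - a) := mul_nonneg hη.le (sub_nonneg.2 hab)
        rw [h2]
        nlinarith
      · rw [sub_nonneg, Real.exp_le_exp]; nlinarith
    have h0 : ∀ a : ℝ, Complex.exp (Complex.I * (η * Complex.I) * a)
        = ((Real.exp (-η * a) : ℝ) : ℂ) := by
      intro a; push_cast; congr 1; linear_combination (η * a : ℂ) * Complex.I_sq
    rw [h0, h0, ← Complex.ofReal_sub, Complex.norm_real, Real.norm_eq_abs]
    rcases le_total a b with hab | hab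
    · exact this a b ha hab
    · rw [abs_sub_comm, abs_sub_comm a b]; exact this b a hb hab
  -- The radius `t` keeps the neighbourhood of `t` in the open half-line, away from the jump of
  -- `damp` at `0`. The constant `η * C + L` is the product rule: the exponential is `η`-Lipschitz
  -- and at most `1` there.
  have key := fourier_inversion_lipschitz (damp k η) (damp_integrable k C η hη hcont hC) t t
    (η * C + L) ht (by
      intro τ hτ
      have hτ0 : 0 < τ := by rw [abs_lt] at hτ; linarith [hτ.1]
      unfold damp
      rw [Set.indicator_of_mem (Set.mem_Ioi.2 hτ0), Set.indicator_of_mem (Set.mem_Ioi.2 ht)]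
      rw [smul_eq_mul, smul_eq_mul, show ∀ a b c d : ℂ, a * b - c * d = (a - c) * b + c * (b - d) by
        intros; ring]
      refine (norm_add_le _ _).trans ?_
      rw [norm_mul, norm_mul, norm_exp_I_mul_complex, add_mul]
      have h1 : Real.exp (-(((η : ℂ) * Complex.I).im * t)) ≤ 1 := by
        rw [Real.exp_le_one_iff]; simp; positivity
      refine add_le_add ?_ ?_
      · rw [show η * C * |τ - t| = η * |τ - t| * C by ring]
        exact mul_le_mul (hexp _ _ hτ0.le ht.le) (hC τ hτ0.le) (norm_nonneg _) (by positivity)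
      · calc _ ≤ 1 * ‖k τ - k t‖ := by gcongr
          _ ≤ _ := by rw [one_mul]; exact hL _ _ hτ0.le ht.le)
  -- Fourier inversion recovers the damped value; the factor `e^{ηt}` removes the damping.
  have e : Complex.exp (-(Complex.I * t * (η * Complex.I))) * damp k η t = k t := by
    unfold damp
    rw [Set.indicator_of_mem (Set.mem_Ioi.2 ht), smul_eq_mul, ← mul_assoc, ← Complex.exp_add]
    rw [show -(Complex.I * t * (η * Complex.I)) + Complex.I * (η * Complex.I) * t = 0 by ring]
    simp
  have key2 := key.const_mul (Complex.exp (-(Complex.I * t * (η * Complex.I))))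
  rw [show Complex.exp (-(Complex.I * t * (η * Complex.I))) * (2 * Real.pi * damp k η t)
    = 2 * Real.pi * k t by rw [← e]; ring] at key2
  refine key2.congr fun N => ?_
  rw [← intervalIntegral.integral_const_mul]
  refine intervalIntegral.integral_congr fun x _ => ?_
  rw [laplace_eq_damp, ← mul_assoc, ← Complex.exp_add]
  congr 2
  ring

lemma laplace_continuous (k : ℝ → ℂ) (C L : ℝ) (hC : ∀ t, 0 ≤ t → ‖k t‖ ≤ C)
    (hL : ∀ s t, 0 ≤ s → 0 ≤ t → ‖k s - k t‖ ≤ L * |s - t|) (η : ℝ) (hη : 0 < η) :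
    Continuous fun x : ℝ => laplace k (x + η * Complex.I) := by
  have hi := damp_integrable k C η hη (continuousOn_of_lipschitz_half hL) hC
  simp_rw [laplace_eq_damp]
  refine continuous_of_dominated (bound := fun τ => ‖damp k η τ‖) (fun x => ?_) (fun x => ?_)
    hi.norm (.of_forall fun τ => by fun_prop)
  · exact (Continuous.aestronglyMeasurable (by fun_prop)).mul hi.aestronglyMeasurable
  · refine .of_forall fun τ => ?_
    rw [norm_mul, norm_exp_I_mul, one_mul]

/-- Inversion of the Laplace transform along `Im z = -η < 0`. -/
lemma laplace_inversion_lower (k : ℝ → ℂ) (C L : ℝ) (hC : ∀ t, 0 ≤ t → ‖k t‖ ≤ C)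
    (hL : ∀ s t, 0 ≤ s → 0 ≤ t → ‖k s - k t‖ ≤ L * |s - t|) (η : ℝ) (hη : 0 < η)
    (t : ℝ) (ht : 0 < t) :
    Tendsto (fun N : ℝ => ∫ x in (-N)..N,
      Complex.exp (Complex.I * t * (x + (-η : ℝ) * Complex.I)) *
      laplace k (-(x + (-η : ℝ) * Complex.I))) atTop (𝓝 (2 * Real.pi * k t)) := by
  refine (laplace_inversion_upper k C L hC hL η hη t ht).congr fun N => ?_
  have := intervalIntegral.integral_comp_neg (a := -N) (b := N) (fun x : ℝ =>
    Complex.exp (-(Complex.I * t * (x + η * Complex.I))) * laplace k (x + η * Complex.I))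
  rw [neg_neg] at this
  rw [← this]
  refine intervalIntegral.integral_congr fun x _ => ?_
  push_cast
  congr 2 <;> ring

/-- The subspace of convergent sequences in the space of bounded sequences. -/
def convergentSeq : Submodule ℂ (ℕ+ →ᵇ ℂ) where
  carrier := {f | ∃ l, Tendsto (fun n => f n) atTop (𝓝 l)}
  add_mem' := fun ⟨a, ha⟩ ⟨b, hb⟩ => ⟨a + b, ha.add hb⟩
  zero_mem' := ⟨0, tendsto_const_nhds⟩
  smul_mem' := fun c _ ⟨a, ha⟩ => ⟨c * a, ha.const_mul c⟩

/-- Closedness makes the quotient of the bounded sequences by the convergent ones a genuine normed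
space, in which a vanishing class means convergence. -/
instance isClosed_convergentSeq : IsClosed (convergentSeq : Set (ℕ+ →ᵇ ℂ)) := by
  refine isClosed_of_closure_subset fun f hf => ?_
  refine cauchySeq_tendsto_of_complete (Metric.cauchySeq_iff.2 fun ε hε => ?_)
  obtain ⟨g, ⟨l, hl⟩, hg⟩ := Metric.mem_closure_iff.1 hf (ε / 3) (by positivity)
  obtain ⟨N, hN⟩ := Metric.cauchySeq_iff.1 hl.cauchySeq (ε / 3) (by positivity)
  refine ⟨N, fun m hm n hn => ?_⟩
  have h1 := (BoundedContinuousFunction.dist_coe_le_dist (f := f) (g := g) m).trans_lt hg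
  have h2 := (BoundedContinuousFunction.dist_coe_le_dist (f := f) (g := g) n).trans_lt hg
  have h3 := hN m hm n hn
  have h4 := dist_triangle4 (f m) (g m) (g n) (f n)
  rw [dist_comm (g n)] at h4
  linarith

/-- If the Laplace transforms of uniformly bounded, uniformly Lipschitz functions converge on a
line `Im z = η > 0`, then the functions converge at every positive time. -/
lemma tendsto_of_laplace_tendsto (k : ℕ+ → ℝ → ℂ) (C L : ℝ)
    (hC : ∀ n t, 0 ≤ t → ‖k n t‖ ≤ C)
    (hL : ∀ n s t, 0 ≤ s → 0 ≤ t → ‖k n s - k n t‖ ≤ L * |s - t|) (η : ℝ) (hη : 0 < η)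
    (hlim : ∀ x : ℝ, ∃ l, Tendsto (fun n => laplace (k n) (x + η * Complex.I)) atTop (𝓝 l))
    (t : ℝ) (ht : 0 < t) : ∃ l, Tendsto (fun n => k n t) atTop (𝓝 l) := by
  -- The whole family becomes a single Lipschitz function with values in the bounded sequences. The
  -- `max` only gives a meaning to negative times, which the damping discards.
  set K : ℝ → (ℕ+ →ᵇ ℂ) := fun τ =>
    BoundedContinuousFunction.ofNormedAddCommGroupDiscrete (fun n => k n (max τ 0)) C
      (fun n => hC n _ (le_max_right _ _)) with hK
  have hC0 : 0 ≤ C := (norm_nonneg _).trans (hC 1 0 le_rfl)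
  have hL0 : 0 ≤ L := by
    have := hL 1 0 1 le_rfl zero_le_one
    norm_num at this
    exact (norm_nonneg _).trans this
  have hKC : ∀ τ, 0 ≤ τ → ‖K τ‖ ≤ C := fun τ _ =>
    (BoundedContinuousFunction.norm_le hC0).2 fun n => hC n _ (le_max_right _ _)
  have hKL : ∀ s t, 0 ≤ s → 0 ≤ t → ‖K s - K t‖ ≤ L * |s - t| := by
    intro s t hs ht
    refine (BoundedContinuousFunction.norm_le (by positivity)).2 fun n => ?_
    have := hL n s t hs ht
    simpa [hK, max_eq_left hs, max_eq_left ht] using this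
  have hKc := continuousOn_of_lipschitz_half hKL
  have hKi := damp_integrable K C η hη hKc hKC
  -- Modulo convergent sequences, the hypothesis says exactly that the Fourier transform of the
  -- damped function vanishes. Vector-valued Fourier inversion at the continuity point `t` then
  -- places its value there in `convergentSeq`.
  let π : (ℕ+ →ᵇ ℂ) →L[ℂ] ((ℕ+ →ᵇ ℂ) ⧸ convergentSeq) :=
    LinearMap.mkContinuous convergentSeq.mkQ 1 fun f => by
      rw [one_mul]; exact Submodule.Quotient.norm_mk_le _ f
  set f : ℝ → ((ℕ+ →ᵇ ℂ) ⧸ convergentSeq) := fun τ => π (damp K η τ) with hf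
  have hfi : Integrable f := π.integrable_comp hKi
  have hJ : ∀ x : ℝ, (∫ τ : ℝ, Complex.exp (Complex.I * x * τ) • damp K η τ) ∈ convergentSeq := by
    intro x
    obtain ⟨l, hl⟩ := hlim x
    refine ⟨l, hl.congr fun n => ?_⟩
    have hi := integrable_exp_smul hKi x
    have := (BoundedContinuousFunction.evalCLM ℂ n).integral_comp_comm hi
    rw [laplace_eq_damp]
    simp only [BoundedContinuousFunction.evalCLM_apply] at this
    rw [← this]
    refine integral_congr_ae (.of_forall fun τ => ?_)
    unfold damp
    by_cases hτ : τ ∈ Set.Ioi (0 : ℝ)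
    · simp [Set.indicator_of_mem hτ, hK, max_eq_left (le_of_lt (Set.mem_Ioi.1 hτ))]
    · simp [Set.indicator_of_notMem hτ]
  have hF : FourierTransform.fourier f = 0 := by
    ext ξ
    rw [Real.fourier_real_eq_integral_exp_smul]
    have h1 : ∀ τ : ℝ, Complex.exp (((-2 * Real.pi * τ * ξ : ℝ) : ℂ) * Complex.I) • f τ
        = π (Complex.exp (Complex.I * ((-2 * Real.pi * ξ : ℝ) : ℂ) * τ) • damp K η τ) := by
      intro τ
      rw [map_smul, hf]
      congr 2
      push_cast; ring
    simp_rw [h1]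
    rw [π.integral_comp_comm]
    · exact (Submodule.Quotient.mk_eq_zero _).2 (hJ _)
    · exact integrable_exp_smul hKi _
  have hcont : ContinuousAt f t := by
    refine π.continuous.continuousAt.comp ?_
    have : ContinuousOn (fun τ : ℝ => Complex.exp (Complex.I * (η * Complex.I) * τ) • K τ)
      (Set.Ioi 0) := by
      have hc : Continuous fun τ : ℝ => Complex.exp (Complex.I * (η * Complex.I) * τ) := by fun_prop
      exact hc.continuousOn.smul hKc
    refine (this.continuousAt (Ioi_mem_nhds ht)).congr ?_
    filter_upwards [Ioi_mem_nhds ht] with τ hτ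
    unfold damp
    rw [Set.indicator_of_mem hτ]
  have hinv := hfi.fourierInv_fourier_eq (by rw [hF]; exact integrable_zero _ _ _) hcont
  rw [hF, Real.fourierInv_eq] at hinv
  have h0 : π (damp K η t) = 0 := by
    rw [← show f t = π (damp K η t) from rfl, ← hinv]
    refine integral_eq_zero_of_ae (.of_forall fun v => ?_)
    exact smul_zero ((Real.fourierChar (inner ℝ v t) : Circle) : ℂ)
  obtain ⟨l, hl⟩ := (Submodule.Quotient.mk_eq_zero convergentSeq).1 h0
  refine ⟨(Complex.exp (Complex.I * (η * Complex.I) * t))⁻¹ * l, ?_⟩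
  refine (hl.const_mul (Complex.exp (Complex.I * (η * Complex.I) * t))⁻¹).congr fun n => ?_
  unfold damp
  rw [Set.indicator_of_mem (Set.mem_Ioi.2 ht)]
  simp [hK, max_eq_left ht.le, ← mul_assoc, Complex.exp_ne_zero]

end Laplace

/-! ### Gaussian integration by parts and a variance bound for Lipschitz functions -/

section Gaussian

/-- The standard Gaussian law on the line. -/
noncomputable abbrev stdG : Measure ℝ := gaussianReal 0 1

lemma integrable_stdG_iff (f : ℝ → ℂ) :
    Integrable f stdG ↔ Integrable fun a => (gaussianPDFReal 0 1 a : ℂ) * f a := by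
  rw [stdG, gaussianReal_of_var_ne_zero _ one_ne_zero,
    integrable_withDensity_iff_integrable_smul' (measurable_gaussianPDF 0 1)
      (.of_forall fun _ => gaussianPDF_lt_top)]
  refine integrable_congr (.of_forall fun a => ?_)
  simp only [toReal_gaussianPDF, Complex.real_smul]

lemma integrable_of_bound {X : Type*} [MeasurableSpace X] {μ : Measure X} [IsFiniteMeasure μ]
    {f : X → ℂ} (hm : AEStronglyMeasurable f μ) (C : ℝ) (hC : ∀ x, ‖f x‖ ≤ C) : Integrable f μ :=
  Integrable.of_bound hm C (.of_forall hC)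

lemma integrable_id_mul_stdG (f : ℝ → ℂ) (hf : Continuous f) (C : ℝ) (hC : ∀ a, ‖f a‖ ≤ C) :
    Integrable (fun a : ℝ => (a : ℂ) * f a) stdG := by
  have h1 : Integrable (fun a : ℝ => (a : ℂ)) stdG :=
    ((memLp_id_gaussianReal (μ := 0) (v := 1) 1).integrable (by norm_num)).ofReal
  exact h1.mul_bdd hf.aestronglyMeasurable (.of_forall hC)

/-- Gaussian integration by parts in one dimension. -/
lemma stein (f f' : ℝ → ℂ) (hf : ∀ a, HasDerivAt f (f' a) a) (hf' : Continuous f') (C : ℝ)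
    (hC : ∀ a, ‖f a‖ ≤ C) (hC' : ∀ a, ‖f' a‖ ≤ C) :
    ∫ a, (a : ℂ) * f a ∂stdG = ∫ a, f' a ∂stdG := by
  have hcf : Continuous f := continuous_iff_continuousAt.2 fun a => (hf a).continuousAt
  have hi1 := (integrable_stdG_iff _).1 (integrable_id_mul_stdG f hcf C hC)
  have hi2 := (integrable_stdG_iff _).1 (integrable_of_bound (μ := stdG) hf'.aestronglyMeasurable C hC')
  have hi3 := (integrable_stdG_iff _).1 (integrable_of_bound (μ := stdG) hcf.aestronglyMeasurable C hC)
  have hpdf : ∀ a : ℝ, HasDerivAt (fun a : ℝ => (gaussianPDFReal 0 1 a : ℂ))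
      (-((a : ℂ) * (gaussianPDFReal 0 1 a : ℂ))) a := by
    intro a
    have : HasDerivAt (gaussianPDFReal 0 1) (-(a * gaussianPDFReal 0 1 a)) a := by
      unfold gaussianPDFReal
      have h1 : HasDerivAt (fun x : ℝ => -(x - 0) ^ 2 / (2 * ((1 : NNReal) : ℝ))) (-a) a := by
        have := (((hasDerivAt_id a).sub_const 0).pow 2).neg.div_const (2 * ((1 : NNReal) : ℝ))
        convert! this using 1
        simp
        ring
      convert! (h1.exp.const_mul _) using 1
      simp; ring
    convert! this.ofReal_comp using 1
    push_cast; ring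
  simp only [integral_gaussianReal_eq_integral_smul (μ := 0) one_ne_zero, Complex.real_smul]
  have := integral_mul_deriv_eq_deriv_mul_of_integrable
    (u := fun a : ℝ => (gaussianPDFReal 0 1 a : ℂ)) (v := f) (v' := f')
    (u' := fun a : ℝ => -((a : ℂ) * (gaussianPDFReal 0 1 a : ℂ)))
    (fun a _ => hpdf a) (fun a _ => hf a) hi2 ?_ hi3
  · rw [this, ← integral_neg]
    congr 1; ext a; ring
  · refine hi1.neg.congr (.of_forall fun a => ?_)
    simp only [Pi.neg_apply, Pi.mul_apply]; ring

lemma integral_sq_stdG : ∫ a : ℝ, a ^ 2 ∂stdG = 1 := by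
  have h := variance_of_integral_eq_zero (μ := stdG) (X := id) aemeasurable_id
    (by simp)
  rw [variance_id_gaussianReal] at h
  simpa using h.symm

lemma integrable_sq_stdG : Integrable (fun a : ℝ => a ^ 2) stdG :=
  (memLp_id_gaussianReal (μ := 0) (v := 1) 2).integrable_sq

/-- The mean minimizes the mean square distance. -/
lemma integral_norm_sub_sq {X : Type*} [MeasurableSpace X] (μ : Measure X) [IsProbabilityMeasure μ]
    (f : X → ℂ) (hf : MemLp f 2 μ) (c : ℂ) :
    ∫ x, ‖f x - c‖ ^ 2 ∂μ = ∫ x, ‖f x - ∫ y, f y ∂μ‖ ^ 2 ∂μ + ‖(∫ y, f y ∂μ) - c‖ ^ 2 := by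
  set m := ∫ y, f y ∂μ with hm
  have hfi : Integrable f μ := hf.integrable (by norm_num)
  have hsub : MemLp (fun x => f x - m) 2 μ := hf.sub (memLp_const m)
  have h1 : ∀ x, ‖f x - c‖ ^ 2 = ‖f x - m‖ ^ 2 + 2 * ((f x - m) * (starRingEnd ℂ) (m - c)).re
      + ‖m - c‖ ^ 2 := by
    intro x
    simp only [← Complex.normSq_eq_norm_sq]
    have := Complex.normSq_add (f x - m) (m - c)
    rw [sub_add_sub_cancel] at this
    rw [this]; ring
  simp_rw [h1]
  have hi : Integrable (fun x => (f x - m) * (starRingEnd ℂ) (m - c)) μ :=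
    (hfi.sub (integrable_const m)).mul_const _
  have hi2 : Integrable (fun x => 2 * ((f x - m) * (starRingEnd ℂ) (m - c)).re) μ :=
    (hi.re).const_mul 2
  rw [integral_add (by exact (hsub.integrable_norm_pow (by norm_num)).add hi2) (integrable_const _),
    integral_add (hsub.integrable_norm_pow (by norm_num)) hi2]
  have h2 : ∫ x, 2 * ((f x - m) * (starRingEnd ℂ) (m - c)).re ∂μ = 0 := by
    rw [integral_const_mul]
    have := integral_re hi
    simp only [RCLike.re_eq_complex_re] at this
    rw [this, integral_mul_const, integral_sub hfi (integrable_const m)]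
    simp [hm]
  rw [h2]
  simp

/-- The variance is at most the mean square distance to the constant `f 0`, and that is at most `L²`
times the second moment of the Gaussian. -/
lemma variance_lipschitz_stdG (f : ℝ → ℂ) (L : ℝ) (hL : ∀ a b, ‖f a - f b‖ ≤ L * |a - b|) :
    ∫ x, ‖f x - ∫ y, f y ∂stdG‖ ^ 2 ∂stdG ≤ L ^ 2 := by
  have hcont : Continuous f := by
    have : LipschitzWith (Real.toNNReal L) f := LipschitzWith.of_dist_le_mul fun a b => by
      rw [dist_eq_norm, Real.dist_eq]
      exact (hL a b).trans (by gcongr; exact Real.le_coe_toNNReal L)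
    exact this.continuous
  have hsub : MemLp (fun x => f x - f 0) 2 stdG := by
    have h1 : MemLp (fun a : ℝ => L * a) 2 stdG :=
      (memLp_id_gaussianReal (μ := 0) (v := 1) 2).const_mul L
    refine h1.mono (by fun_prop) (.of_forall fun a => ?_)
    have := hL a 0
    rw [sub_zero] at this
    refine this.trans ?_
    rw [norm_mul, Real.norm_eq_abs, Real.norm_eq_abs]
    gcongr
    exact le_abs_self L
  have hf : MemLp f 2 stdG := by
    have := hsub.add (memLp_const (f 0))
    refine (memLp_congr_ae (.of_forall fun x => ?_)).1 this
    simp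
  have h1 := integral_norm_sub_sq stdG f hf (f 0)
  have h2 : ∫ x, ‖f x - f 0‖ ^ 2 ∂stdG ≤ ∫ x : ℝ, L ^ 2 * x ^ 2 ∂stdG := by
    refine integral_mono (hsub.integrable_norm_pow (by norm_num)) (integrable_sq_stdG.const_mul _)
      fun x => ?_
    have := hL x 0
    rw [sub_zero] at this
    simp only
    calc ‖f x - f 0‖ ^ 2 ≤ (L * |x|) ^ 2 := by gcongr
      _ = L ^ 2 * x ^ 2 := by rw [mul_pow, sq_abs]
  rw [integral_const_mul, integral_sq_stdG, mul_one] at h2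
  have h3 := sq_nonneg ‖(∫ y, f y ∂stdG) - f 0‖
  linarith

/-- The standard Gaussian law on `ℝ^N`. -/
noncomputable abbrev stdGN (N : ℕ) : Measure (Fin N → ℝ) := Measure.pi fun _ => stdG

lemma integral_stdGN_succ {V : Type*} [NormedAddCommGroup V] [NormedSpace ℝ V] {N : ℕ}
    (i : Fin (N + 1)) (f : (Fin (N + 1) → ℝ) → V) (hf : Integrable f (stdGN (N + 1))) :
    ∫ x, f x ∂(stdGN (N + 1)) = ∫ y, ∫ a, f (i.insertNth a y) ∂stdG ∂(stdGN N) := by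
  have hmp := (measurePreserving_piFinSuccAbove (fun _ : Fin (N + 1) => stdG) i).symm
  rw [← hmp.integral_comp (MeasurableEquiv.measurableEmbedding _),
    integral_prod_symm]
  · rfl
  · exact (hmp.integrable_comp_emb (MeasurableEquiv.measurableEmbedding _)).2 hf

lemma insertNth_update {N : ℕ} (i : Fin (N + 1)) (a b : ℝ) (y : Fin N → ℝ) :
    Function.update (i.insertNth a y : Fin (N + 1) → ℝ) i b = i.insertNth b y := by
  simp

/-- The variance of a coordinatewise Lipschitz function of independent Gaussians. -/
lemma variance_lipschitz_stdGN : ∀ (N : ℕ) (f : (Fin N → ℝ) → ℂ) (_ : Continuous f) (C : ℝ)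
    (_ : ∀ x, ‖f x‖ ≤ C) (L : Fin N → ℝ)
    (_ : ∀ x i a, ‖f (Function.update x i a) - f x‖ ≤ L i * |a - x i|),
    ∫ x, ‖f x - ∫ y, f y ∂(stdGN N)‖ ^ 2 ∂(stdGN N) ≤ ∑ i, L i ^ 2 := by
  intro N
  induction N with
  | zero =>
    intro f _ C _ L _
    have : ∀ x : Fin 0 → ℝ, f x = f 0 := fun x => by congr 1; exact Subsingleton.elim _ _
    simp [this]
  | succ N ih =>
    intro f hf C hC L hL
    have hi : Integrable f (stdGN (N + 1)) := integrable_of_bound hf.aestronglyMeasurable C hC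
    have hcons : Continuous fun p : ℝ × (Fin N → ℝ) => (Fin.insertNth 0 p.1 p.2 : Fin (N + 1) → ℝ) :=
      Continuous.finInsertNth 0 continuous_fst continuous_snd
    set e := MeasurableEquiv.piFinSuccAbove (fun _ : Fin (N + 1) => ℝ) 0
    have hmp := (measurePreserving_piFinSuccAbove (fun _ : Fin (N + 1) => stdG) 0).symm
    set F : ℝ → ℂ := fun a => ∫ y, f (Fin.insertNth 0 a y) ∂(stdGN N) with hF
    have hslice : ∀ a, Continuous fun y : Fin N → ℝ => f (Fin.insertNth 0 a y) := fun a =>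
      hf.comp (hcons.comp (by fun_prop : Continuous fun y : Fin N → ℝ => (a, y)))
    have hsi : ∀ a, Integrable (fun y : Fin N → ℝ => f (Fin.insertNth 0 a y)) (stdGN N) := fun a =>
      integrable_of_bound (hslice a).aestronglyMeasurable C fun y => hC _
    -- Averaging over the other coordinates preserves the Lipschitz constant in the first one.
    have hFL : ∀ a b, ‖F a - F b‖ ≤ L 0 * |a - b| := by
      intro a b
      simp only [hF]
      rw [← integral_sub (hsi a) (hsi b)]
      refine (norm_integral_le_of_norm_le_const (μ := stdGN N) (C := L 0 * |a - b|)
        (.of_forall fun y => ?_)).trans (by simp)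
      have := hL (Fin.insertNth 0 b y) 0 a
      rwa [insertNth_update, Fin.insertNth_apply_same] at this
    have hmean : ∫ x, f x ∂(stdGN (N + 1)) = ∫ a, F a ∂stdG := by
      rw [← hmp.integral_comp (MeasurableEquiv.measurableEmbedding _), integral_prod]
      · rfl
      · exact (hmp.integrable_comp_emb (MeasurableEquiv.measurableEmbedding _)).2 hi
    set m := ∫ x, f x ∂(stdGN (N + 1)) with hm
    have hgi : Integrable (fun x => ‖f x - m‖ ^ 2) (stdGN (N + 1)) := by
      refine Integrable.of_bound (by fun_prop) ((C + ‖m‖) ^ 2) (.of_forall fun x => ?_)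
      rw [Real.norm_eq_abs, abs_of_nonneg (by positivity)]
      gcongr
      exact (norm_sub_le _ _).trans (by gcongr; exact hC x)
    have hgi2 := (hmp.integrable_comp_emb (MeasurableEquiv.measurableEmbedding _)).2 hgi
    have hsum : ∫ x, ‖f x - m‖ ^ 2 ∂(stdGN (N + 1))
        = ∫ a, ∫ y, ‖f (Fin.insertNth 0 a y) - m‖ ^ 2 ∂(stdGN N) ∂stdG := by
      rw [← hmp.integral_comp (MeasurableEquiv.measurableEmbedding _)]
      exact integral_prod _ hgi2
    -- With the first coordinate frozen, the mean square distance to `m` is the variance in the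
    -- remaining coordinates, bounded by induction, plus the squared deviation of the partial mean
    -- `F a`, bounded by the one-dimensional case.
    have hsl : ∀ a, ∫ y, ‖f (Fin.insertNth 0 a y) - m‖ ^ 2 ∂(stdGN N)
        ≤ ∑ i : Fin N, L i.succ ^ 2 + ‖F a - m‖ ^ 2 := by
      intro a
      rw [integral_norm_sub_sq (stdGN N) _ (MemLp.of_bound (hslice a).aestronglyMeasurable C
        (.of_forall fun y => hC _)) m]
      refine add_le_add ?_ le_rfl
      refine ih _ (hslice a) C (fun y => hC _) (fun i => L i.succ) fun y i b => ?_
      have := hL (Fin.insertNth 0 a y) i.succ b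
      simpa [Fin.insertNth_zero', Fin.cons_update] using this
    have hFc : Continuous F := by
      have : LipschitzWith (Real.toNNReal (L 0)) F := LipschitzWith.of_dist_le_mul fun a b => by
        rw [dist_eq_norm, Real.dist_eq]
        exact (hFL a b).trans (by gcongr; exact Real.le_coe_toNNReal _)
      exact this.continuous
    have hFb : ∀ a, ‖F a‖ ≤ C := fun a =>
      (norm_integral_le_of_norm_le_const (μ := stdGN N) (C := C) (.of_forall fun y => hC _)).trans
        (by simp)
    have hFmi : Integrable (fun a => ‖F a - m‖ ^ 2) stdG := by
      refine Integrable.of_bound (by fun_prop) ((C + ‖m‖) ^ 2) (.of_forall fun x => ?_)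
      rw [Real.norm_eq_abs, abs_of_nonneg (by positivity)]
      gcongr
      exact (norm_sub_le _ _).trans (by gcongr; exact hFb x)
    rw [hsum, Fin.sum_univ_succ]
    calc _ ≤ ∫ a, (∑ i : Fin N, L i.succ ^ 2 + ‖F a - m‖ ^ 2) ∂stdG := by
          refine integral_mono hgi2.integral_prod_left ((integrable_const _).add hFmi) hsl
      _ = ∑ i : Fin N, L i.succ ^ 2 + ∫ a, ‖F a - m‖ ^ 2 ∂stdG := by
          rw [integral_add (integrable_const _) hFmi]; simp
      _ ≤ _ := by
          rw [add_comm]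
          gcongr
          rw [hmean]
          exact variance_lipschitz_stdG F (L 0) hFL

/-- Gaussian integration by parts in a coordinate. -/
lemma stein_stdGN {N : ℕ} (i : Fin N) (f f' : (Fin N → ℝ) → ℂ) (hf : Continuous f)
    (hf' : Continuous f') (C : ℝ) (hC : ∀ x, ‖f x‖ ≤ C) (hC' : ∀ x, ‖f' x‖ ≤ C)
    (hd : ∀ x a, HasDerivAt (fun b => f (Function.update x i b)) (f' (Function.update x i a)) a) :
    ∫ x, (x i : ℂ) * f x ∂(stdGN N) = ∫ x, f' x ∂(stdGN N) := by
  cases N with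
  | zero => exact i.elim0
  | succ N =>
    have hxi : Integrable (fun x : Fin (N + 1) → ℝ => (x i : ℂ)) (stdGN (N + 1)) := by
      have := (measurePreserving_eval (fun _ : Fin (N + 1) => stdG) i).integrable_comp_of_integrable
        ((memLp_id_gaussianReal (μ := 0) (v := 1) 1).integrable (by norm_num))
      exact this.ofReal
    rw [integral_stdGN_succ i _ (hxi.mul_bdd hf.aestronglyMeasurable (.of_forall hC)),
      integral_stdGN_succ i _ (integrable_of_bound hf'.aestronglyMeasurable C hC')]
    congr 1
    ext y
    have hins : Continuous fun a : ℝ => (i.insertNth a y : Fin (N + 1) → ℝ) :=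
      Continuous.finInsertNth i continuous_id continuous_const
    simp only [Fin.insertNth_apply_same]
    refine stein (fun a => f (i.insertNth a y)) (fun a => f' (i.insertNth a y)) (fun a => ?_)
      (hf'.comp hins) C (fun a => hC _) (fun a => hC' _)
    have := hd (i.insertNth 0 y) a
    simpa only [insertNth_update] using this

lemma integral_mul_stdGN {N : ℕ} (i j : Fin N) :
    ∫ x, x i * x j ∂(stdGN N) = if i = j then 1 else 0 := by
  have hm := fun i : Fin N => measurePreserving_eval (fun _ : Fin N => stdG) i
  have hmeas : ∀ i : Fin N, AEStronglyMeasurable (fun x : Fin N → ℝ => x i)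
    (Measure.pi fun _ : Fin N => stdG) := fun i => (measurable_pi_apply i).aestronglyMeasurable
  split_ifs with h
  · subst h
    simp_rw [← sq]
    have h1 := integral_map (hm i).aemeasurable (f := fun a : ℝ => a ^ 2) (by fun_prop)
    rw [(hm i).map_eq, integral_sq_stdG] at h1
    exact h1.symm
  · have hind := (iIndepFun_pi (μ := fun _ : Fin N => stdG) (X := fun _ => id)
      (fun _ => aemeasurable_id)).indepFun h
    have := hind.integral_mul_eq_mul_integral (hmeas i) (hmeas j)
    simp only [id] at this
    refine this.trans ?_
    have h1 := integral_map (hm i).aemeasurable (f := fun a : ℝ => a) (by fun_prop)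
    rw [(hm i).map_eq, integral_id_gaussianReal] at h1
    simp only [Function.eval] at h1
    rw [← h1, zero_mul]

lemma integrable_mul_stdGN {N : ℕ} (i j : Fin N) :
    Integrable (fun x : Fin N → ℝ => x i * x j) (stdGN N) := by
  have h : ∀ k : Fin N, MemLp (fun x : Fin N → ℝ => x k) 2 (stdGN N) := fun k =>
    (memLp_id_gaussianReal (μ := 0) (v := 1) 2).comp_measurePreserving
      (measurePreserving_eval (fun _ : Fin N => stdG) k)
  exact (h i).integrable_mul (h j)

/-- The array of independent Gaussians as the image of a Gaussian vector. -/
lemma measurePreserving_array (n : ℕ) :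
    MeasurePreserving (fun (y : Fin (n * n) → ℝ) (j k : Fin n) => y (finProdFinEquiv (j, k)))
      (stdGN (n * n)) (gaussians n) := by
  have h1 : MeasurePreserving (fun (y : Fin (n * n) → ℝ) (p : Fin n × Fin n) =>
      y (finProdFinEquiv p)) (stdGN (n * n)) (Measure.pi fun _ : Fin n × Fin n => stdG) := by
    have := (measurePreserving_piCongrLeft (α := fun _ : Fin (n * n) => ℝ) (fun _ => stdG)
      finProdFinEquiv).symm
    convert! this using 1
  have h2 : MeasurePreserving (MeasurableEquiv.curry (Fin n) (Fin n) ℝ)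
      (Measure.pi fun _ : Fin n × Fin n => stdG) (gaussians n) := by
    refine ⟨by fun_prop, ?_⟩
    have := Measure.infinitePi_map_curry (ι := Fin n) (κ := Fin n) fun _ _ => stdG
    simp only [Measure.infinitePi_eq_pi] at this
    exact this
  exact h2.comp h1

end Gaussian

/-! ### Transfer of the Gaussian tools to square arrays -/

section Array

variable {n : ℕ}

instance isProbabilityMeasure_gaussians (n : ℕ) : IsProbabilityMeasure (gaussians n) := by
  unfold gaussians; infer_instance

/-- Replace one entry of an array. -/
def upd (x : Fin n → Fin n → ℝ) (j k : Fin n) (a : ℝ) : Fin n → Fin n → ℝ :=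
  Function.update x j (Function.update (x j) k a)

/-- The array with the entries of a vector. -/
def toArray (y : Fin (n * n) → ℝ) : Fin n → Fin n → ℝ := fun j k => y (finProdFinEquiv (j, k))

lemma continuous_toArray : Continuous (toArray (n := n)) := by
  unfold toArray; fun_prop

lemma toArray_update (y : Fin (n * n) → ℝ) (j k : Fin n) (a : ℝ) :
    toArray (Function.update y (finProdFinEquiv (j, k)) a) = upd (toArray y) j k a := by
  ext j' k'
  unfold toArray upd
  by_cases hj : j' = j
  · subst hj
    by_cases hk : k' = k
    · subst hk; simp
    · simp [Function.update_of_ne, hk]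
  · simp [Function.update_of_ne, hj]

lemma integral_gaussians {V : Type*} [NormedAddCommGroup V] [NormedSpace ℝ V]
    (f : (Fin n → Fin n → ℝ) → V) (hf : AEStronglyMeasurable f (gaussians n)) :
    ∫ x, f x ∂(gaussians n) = ∫ y, f (toArray y) ∂(stdGN (n * n)) := by
  have := measurePreserving_array n
  rw [← this.map_eq, integral_map this.aemeasurable (by rwa [this.map_eq])]
  rfl

lemma variance_lipschitz_gaussians (f : (Fin n → Fin n → ℝ) → ℂ) (hf : Continuous f) (C : ℝ)
    (hC : ∀ x, ‖f x‖ ≤ C) (L : Fin n → Fin n → ℝ)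
    (hL : ∀ x j k a, ‖f (upd x j k a) - f x‖ ≤ L j k * |a - x j k|) :
    ∫ x, ‖f x - ∫ y, f y ∂(gaussians n)‖ ^ 2 ∂(gaussians n) ≤ ∑ j, ∑ k, L j k ^ 2 := by
  rw [integral_gaussians _ (by fun_prop), integral_gaussians f hf.aestronglyMeasurable]
  refine (variance_lipschitz_stdGN (n * n) (fun y => f (toArray y)) (hf.comp continuous_toArray) C
    (fun y => hC _) (fun i => L (finProdFinEquiv.symm i).1 (finProdFinEquiv.symm i).2)
    fun y i a => ?_).trans_eq ?_
  · obtain ⟨⟨j, k⟩, rfl⟩ := finProdFinEquiv.surjective i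
    rw [toArray_update, Equiv.symm_apply_apply]
    exact hL _ _ _ _
  · rw [← finProdFinEquiv.sum_comp, Fintype.sum_prod_type]
    simp

lemma stein_gaussians (j k : Fin n) (f f' : (Fin n → Fin n → ℝ) → ℂ) (hf : Continuous f)
    (hf' : Continuous f') (C : ℝ) (hC : ∀ x, ‖f x‖ ≤ C) (hC' : ∀ x, ‖f' x‖ ≤ C)
    (hd : ∀ x a, HasDerivAt (fun b => f (upd x j k b)) (f' (upd x j k a)) a) :
    ∫ x, (x j k : ℂ) * f x ∂(gaussians n) = ∫ x, f' x ∂(gaussians n) := by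
  rw [integral_gaussians _ (by fun_prop), integral_gaussians _ (by fun_prop)]
  refine stein_stdGN (finProdFinEquiv (j, k)) (fun y => f (toArray y)) (fun y => f' (toArray y))
    (hf.comp continuous_toArray) (hf'.comp continuous_toArray) C (fun y => hC _) (fun y => hC' _)
    fun y a => ?_
  simp only [toArray_update]
  exact hd _ _

lemma integrable_mul_gaussians (j k j' k' : Fin n) :
    Integrable (fun x : Fin n → Fin n → ℝ => x j k * x j' k') (gaussians n) := by
  have := measurePreserving_array n
  rw [← this.map_eq, integrable_map_measure (by fun_prop) this.aemeasurable]
  exact integrable_mul_stdGN _ _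

lemma integral_mul_gaussians (j k j' k' : Fin n) :
    ∫ x, x j k * x j' k' ∂(gaussians n) = if j = j' ∧ k = k' then 1 else 0 := by
  rw [integral_gaussians _ (by fun_prop)]
  refine (integral_mul_stdGN _ _).trans ?_
  simp

lemma integrable_entry_gaussians (j k : Fin n) :
    Integrable (fun x : Fin n → Fin n → ℝ => (x j k : ℂ)) (gaussians n) := by
  have h1 := integrable_mul_gaussians j k j k
  have h2 : MemLp (fun x : Fin n → Fin n → ℝ => x j k) 2 (gaussians n) := by
    rw [memLp_two_iff_integrable_sq (Continuous.aestronglyMeasurable (by fun_prop))]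
    simpa only [sq] using h1
  exact (h2.integrable (by norm_num)).ofReal

/-- This symmetry is what kills the means of resolvent entries between different levels. -/
lemma measurePreserving_neg_gaussians (n : ℕ) :
    MeasurePreserving (fun x : Fin n → Fin n → ℝ => -x) (gaussians n) (gaussians n) := by
  have h0 : MeasurePreserving (fun a : ℝ => -a) stdG stdG :=
    ⟨measurable_neg, by rw [gaussianReal_map_neg, neg_zero]⟩
  exact measurePreserving_pi (fun _ => Measure.pi fun _ => stdG)
    (fun _ => Measure.pi fun _ => stdG)
    (fun _ : Fin n => measurePreserving_pi (fun _ => stdG) (fun _ => stdG) fun _ : Fin n => h0)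

end Array

/-! ### Covariance, unitary invariance and integration by parts for the GUE -/

section GUE

variable {n : ℕ}

/-- The coefficient of `x_ab` in the entry `(a, b)` of `gueMatrix x`. -/
noncomputable def gueP (a b : Fin n) : ℂ :=
  if a = b then 1 else if a < b then (Real.sqrt 2 : ℂ)⁻¹ else -Complex.I * (Real.sqrt 2 : ℂ)⁻¹

/-- The coefficient of `x_ba` in the entry `(a, b)` of `gueMatrix x`. -/
noncomputable def gueQ (a b : Fin n) : ℂ :=
  if a = b then 0 else if a < b then Complex.I * (Real.sqrt 2 : ℂ)⁻¹ else (Real.sqrt 2 : ℂ)⁻¹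

lemma gueMatrix_apply (x : Fin n → Fin n → ℝ) (a b : Fin n) :
    gueMatrix x a b = gueP a b * x a b + gueQ a b * x b a := by
  unfold gueMatrix gueP gueQ
  simp only [Matrix.of_apply]
  split_ifs with h1 h2
  · subst h1; ring
  · ring
  · ring

lemma sqrt_two_inv_sq : ((Real.sqrt 2 : ℝ) : ℂ)⁻¹ * ((Real.sqrt 2 : ℝ) : ℂ)⁻¹ = 1 / 2 := by
  rw [← mul_inv, ← Complex.ofReal_mul, Real.mul_self_sqrt (by norm_num)]
  norm_num

/-- This is `⟨w_ab²⟩ = 0` off the diagonal: the real and imaginary parts contribute `1/2` and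
`-1/2`. -/
lemma gueP_sq_add (a b : Fin n) (h : a ≠ b) : gueP a b * gueP a b + gueQ a b * gueQ a b = 0 := by
  unfold gueP gueQ
  rw [if_neg h, if_neg h]
  have h2 := sqrt_two_inv_sq
  have h3 := Complex.I_mul_I
  split_ifs
  · linear_combination (1 + Complex.I * Complex.I) * h2 + (1 / 2) * h3
  · linear_combination (1 + Complex.I * Complex.I) * h2 + (1 / 2) * h3

/-- This is `⟨w_ab w_ba⟩ = 1` off the diagonal, the real and imaginary parts contributing `1/2`
each. -/
lemma gueP_mul_gueQ_add (a b : Fin n) (h : a ≠ b) :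
    gueP a b * gueQ b a + gueQ a b * gueP b a = 1 := by
  unfold gueP gueQ
  rw [if_neg h, if_neg h, if_neg h.symm, if_neg h.symm]
  have h2 := sqrt_two_inv_sq
  have h3 := Complex.I_mul_I
  rcases lt_or_gt_of_ne h with hlt | hlt
  · rw [if_pos hlt, if_pos hlt, if_neg hlt.not_gt, if_neg hlt.not_gt]
    linear_combination (1 - Complex.I * Complex.I) * h2 - (1 / 2) * h3
  · rw [if_pos hlt, if_pos hlt, if_neg hlt.not_gt, if_neg hlt.not_gt]
    linear_combination (1 - Complex.I * Complex.I) * h2 - (1 / 2) * h3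

lemma norm_gueP_le (a b : Fin n) : ‖gueP a b‖ ≤ 1 := by
  have h : ‖((Real.sqrt 2 : ℝ) : ℂ)⁻¹‖ ≤ 1 := by
    rw [norm_inv, Complex.norm_real, Real.norm_eq_abs, abs_of_nonneg (Real.sqrt_nonneg _)]
    exact inv_le_one_of_one_le₀ (by rw [Real.one_le_sqrt]; norm_num)
  unfold gueP
  split_ifs
  · simp
  · exact h
  · simpa using h

lemma norm_gueQ_le (a b : Fin n) : ‖gueQ a b‖ ≤ 1 := by
  have h : ‖((Real.sqrt 2 : ℝ) : ℂ)⁻¹‖ ≤ 1 := by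
    rw [norm_inv, Complex.norm_real, Real.norm_eq_abs, abs_of_nonneg (Real.sqrt_nonneg _)]
    exact inv_le_one_of_one_le₀ (by rw [Real.one_le_sqrt]; norm_num)
  unfold gueQ
  split_ifs
  · simp
  · simpa using h
  · exact h

/-- The derivative of `gueMatrix` in the direction of the entry `(j, k)`. -/
noncomputable def gueDir (j k : Fin n) : Matrix (Fin n) (Fin n) ℂ :=
  Matrix.of fun a b => (if j = a ∧ k = b then gueP a b else 0) + (if j = b ∧ k = a then gueQ a b else 0)

lemma gueMatrix_eq_sum (x : Fin n → Fin n → ℝ) (a b : Fin n) :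
    gueMatrix x a b = ∑ j, ∑ k, (x j k : ℂ) * gueDir j k a b := by
  simp only [gueDir, Matrix.of_apply, mul_add, Finset.sum_add_distrib, mul_ite, mul_zero, ite_and]
  rw [gueMatrix_apply]
  simp only [Finset.sum_ite_irrel, Finset.sum_const_zero, Finset.sum_ite_eq', Finset.mem_univ,
    if_true]
  ring

lemma gueMatrix_upd (x : Fin n → Fin n → ℝ) (j k : Fin n) (t : ℝ) :
    gueMatrix (upd x j k t) = gueMatrix x + ((t : ℂ) - x j k) • gueDir j k := by
  ext a b
  have hu : ∀ a b, ((upd x j k t a b : ℝ) : ℂ) = x a b + if j = a ∧ k = b then (t : ℂ) - x j k else 0 := by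
    intro a b
    unfold upd
    by_cases hj : a = j
    · subst hj
      by_cases hk : b = k
      · subst hk; simp
      · simp [Function.update_of_ne, hk, Ne.symm hk]
    · simp [Function.update_of_ne, hj, Ne.symm hj]
  simp only [Matrix.add_apply, Matrix.smul_apply, smul_eq_mul, gueMatrix_apply, gueDir,
    Matrix.of_apply, hu]
  split_ifs <;> ring

/-- The covariance `⟨w_ab w_cd⟩` of the GUE, expressed through the coefficients of the independent
Gaussians. -/
lemma gueDir_cov (a b c d : Fin n) :
    ∑ j, ∑ k, gueDir j k a b * gueDir j k c d = if a = d ∧ b = c then 1 else 0 := by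
  have : ∀ j k, gueDir j k a b * gueDir j k c d
      = (if j = a then (if k = b then gueP a b * gueDir a b c d else 0) else 0)
        + (if j = b then (if k = a then gueQ a b * gueDir b a c d else 0) else 0) := by
    intro j k
    have h0 : gueDir j k a b = (if j = a then (if k = b then gueP a b else 0) else 0)
        + (if j = b then (if k = a then gueQ a b else 0) else 0) := by
      simp only [gueDir, Matrix.of_apply, ite_and]
    rw [h0, add_mul]
    congr 1
    · split_ifs <;> simp_all
    · split_ifs <;> simp_all
  simp only [this, Finset.sum_add_distrib, Finset.sum_ite_irrel, Finset.sum_const_zero,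
    Finset.sum_ite_eq', Finset.mem_univ, if_true]
  simp only [gueDir, Matrix.of_apply]
  by_cases hab : a = b
  · subst hab
    by_cases h1 : a = c
    · subst h1
      by_cases h2 : a = d
      · subst h2; simp [gueP, gueQ]
      · simp [h2]
    · simp [h1]
  · by_cases h1 : a = c ∧ b = d
    · obtain ⟨rfl, rfl⟩ := h1
      have := gueP_sq_add a b hab
      simp [hab, Ne.symm hab]
      linear_combination this
    · by_cases h2 : a = d ∧ b = c
      · obtain ⟨rfl, rfl⟩ := h2
        have := gueP_mul_gueQ_add a b hab
        simp [hab, Ne.symm hab]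
        linear_combination this
      · have h3 : ¬ (b = d ∧ a = c) := fun h => h1 ⟨h.2, h.1⟩
        have h4 : ¬ (b = c ∧ a = d) := fun h => h2 ⟨h.2, h.1⟩
        simp [h1, h2, h3, h4]

/-- One Gaussian variable moves at most two matrix entries, each with a coefficient of modulus at
most one. This bound, independent of `n`, drives the concentration estimate. -/
lemma sum_norm_gueDir_le (j k : Fin n) : ∑ a, ∑ b, ‖gueDir j k a b‖ ≤ 2 := by
  have : ∀ a b, ‖gueDir j k a b‖ ≤ (if j = a then (if k = b then 1 else 0) else 0)
      + (if j = b then (if k = a then 1 else 0) else 0) := by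
    intro a b
    simp only [gueDir, Matrix.of_apply, ite_and]
    refine (norm_add_le _ _).trans (add_le_add ?_ ?_)
    · split_ifs <;> simp [norm_gueP_le]
    · split_ifs <;> simp [norm_gueQ_le]
  refine (Finset.sum_le_sum fun a _ => Finset.sum_le_sum fun b _ => this a b).trans ?_
  simp [Finset.sum_add_distrib]
  norm_num

lemma continuous_gueMatrix : Continuous (gueMatrix (n := n)) := by
  refine continuous_matrix fun a b => ?_
  simp only [gueMatrix_apply]
  fun_prop

lemma gueMatrix_neg (x : Fin n → Fin n → ℝ) : gueMatrix (-x) = -gueMatrix x := by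
  ext a b
  simp only [gueMatrix_apply, Matrix.neg_apply, Pi.neg_apply]
  push_cast; ring

lemma gueMatrix_isHermitian (x : Fin n → Fin n → ℝ) : (gueMatrix x).IsHermitian := by
  ext a b
  unfold gueMatrix
  simp only [Matrix.conjTranspose_apply, Matrix.of_apply]
  rcases lt_trichotomy a b with h | h | h
  · rw [if_neg h.ne', if_neg h.not_gt, if_neg h.ne, if_pos h]
    simp [Complex.conj_ofReal]
  · subst h; simp [Complex.conj_ofReal]
  · rw [if_neg h.ne, if_pos h, if_neg h.ne', if_neg h.not_gt]
    simp [Complex.conj_ofReal, sub_eq_add_neg]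

/-- The GUE matrix in the basis given by the columns of `U`. -/
noncomputable def rotGue (U : Matrix (Fin n) (Fin n) ℂ) (x : Fin n → Fin n → ℝ) :
    Matrix (Fin n) (Fin n) ℂ := Uᴴ * gueMatrix x * U

/-- The derivative of `rotGue` in the direction of an entry. -/
noncomputable def rotDir (U : Matrix (Fin n) (Fin n) ℂ) (j k : Fin n) :
    Matrix (Fin n) (Fin n) ℂ := Uᴴ * gueDir j k * U

variable (U : Matrix (Fin n) (Fin n) ℂ)

lemma rotGue_eq_sum (x : Fin n → Fin n → ℝ) (a b : Fin n) :
    rotGue U x a b = ∑ j, ∑ k, (x j k : ℂ) * rotDir U j k a b := by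
  have : gueMatrix x = ∑ j, ∑ k, (x j k : ℂ) • gueDir j k := by
    ext a b
    simp [Matrix.sum_apply, gueMatrix_eq_sum x a b]
  unfold rotGue rotDir
  rw [this]
  simp [Matrix.mul_sum, Matrix.sum_mul, Matrix.sum_apply]

lemma rotGue_upd (x : Fin n → Fin n → ℝ) (j k : Fin n) (t : ℝ) :
    rotGue U (upd x j k t) = rotGue U x + ((t : ℂ) - x j k) • rotDir U j k := by
  unfold rotGue rotDir
  rw [gueMatrix_upd]
  simp [Matrix.mul_add, Matrix.add_mul]

lemma rotGue_neg (x : Fin n → Fin n → ℝ) : rotGue U (-x) = -rotGue U x := by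
  simp [rotGue, gueMatrix_neg]

lemma continuous_rotGue : Continuous (rotGue U) := by
  unfold rotGue
  exact (continuous_const.matrix_mul continuous_gueMatrix).matrix_mul continuous_const

lemma rotGue_isHermitian (x : Fin n → Fin n → ℝ) : (rotGue U x).IsHermitian :=
  isHermitian_conjTranspose_mul_mul U (gueMatrix_isHermitian x)

/-- Unitary invariance of the GUE at the level of covariances, which is all that integration by
parts uses: the sum factors into two entries of `Uᴴ * U`. -/
lemma rotDir_cov (hU : Uᴴ * U = 1) (a b c d : Fin n) :
    ∑ j, ∑ k, rotDir U j k a b * rotDir U j k c d = if a = d ∧ b = c then 1 else 0 := by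
  have h1 : ∀ j k, rotDir U j k a b * rotDir U j k c d
      = ∑ p : Fin n × Fin n, ∑ q : Fin n × Fin n, (Uᴴ a p.1 * U p.2 b * (Uᴴ c q.1 * U q.2 d)) *
        (gueDir j k p.1 p.2 * gueDir j k q.1 q.2) := by
    intro j k
    have : ∀ a b, rotDir U j k a b = ∑ p : Fin n × Fin n, Uᴴ a p.1 * U p.2 b * gueDir j k p.1 p.2 := by
      intro a b
      rw [Fintype.sum_prod_type_right]
      simp only [rotDir, Matrix.mul_apply, Finset.sum_mul]
      refine Finset.sum_congr rfl fun _ _ => Finset.sum_congr rfl fun _ _ => ?_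
      ring
    rw [this, this, Finset.sum_mul_sum]
    refine Finset.sum_congr rfl fun _ _ => Finset.sum_congr rfl fun _ _ => ?_
    ring
  have h2 : ∑ j, ∑ k, rotDir U j k a b * rotDir U j k c d
      = ∑ p : Fin n × Fin n, ∑ q : Fin n × Fin n, (Uᴴ a p.1 * U p.2 b * (Uᴴ c q.1 * U q.2 d)) *
        ∑ j, ∑ k, (gueDir j k p.1 p.2 * gueDir j k q.1 q.2) := by
    simp_rw [h1, Finset.mul_sum]
    calc _ = ∑ j : Fin n, ∑ p : Fin n × Fin n, ∑ k : Fin n, ∑ q : Fin n × Fin n,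
          (Uᴴ a p.1 * U p.2 b * (Uᴴ c q.1 * U q.2 d)) *
          (gueDir j k p.1 p.2 * gueDir j k q.1 q.2) :=
          Finset.sum_congr rfl fun _ _ => Finset.sum_comm
      _ = ∑ p : Fin n × Fin n, ∑ j : Fin n, ∑ k : Fin n, ∑ q : Fin n × Fin n, _ := Finset.sum_comm
      _ = ∑ p : Fin n × Fin n, ∑ j : Fin n, ∑ q : Fin n × Fin n, ∑ k : Fin n, _ :=
          Finset.sum_congr rfl fun _ _ => Finset.sum_congr rfl fun _ _ => Finset.sum_comm
      _ = _ := Finset.sum_congr rfl fun _ _ => Finset.sum_comm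
  rw [h2]
  simp_rw [gueDir_cov]
  have h3 : ∀ p : Fin n × Fin n, ∑ q : Fin n × Fin n,
      (Uᴴ a p.1 * U p.2 b * (Uᴴ c q.1 * U q.2 d)) * (if p.1 = q.2 ∧ p.2 = q.1 then 1 else 0)
      = (Uᴴ a p.1 * U p.1 d) * (Uᴴ c p.2 * U p.2 b) := by
    intro p
    rw [Finset.sum_eq_single (p.2, p.1)]
    · simp; ring
    · intro q _ hq
      rw [if_neg, mul_zero]
      rintro ⟨h, h'⟩
      exact hq (Prod.ext h'.symm h.symm)
    · simp
  simp_rw [h3]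
  rw [Fintype.sum_prod_type]
  change ∑ x, ∑ y, (Uᴴ a x * U x d) * (Uᴴ c y * U y b) = _
  rw [← Finset.sum_mul_sum, ← Matrix.mul_apply, ← Matrix.mul_apply, hU,
    Matrix.one_apply, Matrix.one_apply]
  by_cases h4 : a = d <;> by_cases h5 : b = c <;> simp [h4, h5, eq_comm]

/-- Collects the derivatives in all `n²` Gaussian variables, weighted by their coefficients in the
entry `(a, b)`, into one derivative along the matrix unit at `(b, a)`. -/
lemma sum_rotDir_smul (hU : Uᴴ * U = 1) (a b : Fin n) :
    ∑ j, ∑ k, rotDir U j k a b • rotDir U j k = Matrix.single b a 1 := by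
  ext c d
  simp only [Matrix.sum_apply, Matrix.smul_apply, smul_eq_mul]
  rw [rotDir_cov U hU, Matrix.single_apply]
  simp only [and_comm]

/-- Gaussian integration by parts for the GUE. -/
lemma gue_integration_by_parts (hU : Uᴴ * U = 1) (a b : Fin n) (f : (Fin n → Fin n → ℝ) → ℂ)
    (D : (Fin n → Fin n → ℝ) → Matrix (Fin n) (Fin n) ℂ →ₗ[ℂ] ℂ) (hf : Continuous f)
    (hD : ∀ K, Continuous fun x => D x K) (C : ℝ) (hC : ∀ x, ‖f x‖ ≤ C)
    (hDC : ∀ K, ∃ C', ∀ x, ‖D x K‖ ≤ C')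
    (hd : ∀ x j k t, HasDerivAt (fun t => f (upd x j k t)) (D (upd x j k t) (rotDir U j k)) t) :
    ∫ x, rotGue U x a b * f x ∂(gaussians n) = ∫ x, D x (Matrix.single b a 1) ∂(gaussians n) := by
  have hDi : ∀ K, Integrable (fun x => D x K) (gaussians n) := fun K => by
    obtain ⟨C', hC'⟩ := hDC K
    exact integrable_of_bound (hD K).aestronglyMeasurable C' hC'
  have hi : ∀ j k, Integrable (fun x : Fin n → Fin n → ℝ => (x j k : ℂ) * f x) (gaussians n) :=
    fun j k => (integrable_entry_gaussians j k).mul_bdd hf.aestronglyMeasurable (.of_forall hC)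
  have h1 : ∀ x, rotGue U x a b * f x = ∑ j, ∑ k, rotDir U j k a b * ((x j k : ℂ) * f x) := by
    intro x
    rw [rotGue_eq_sum, Finset.sum_mul]
    refine Finset.sum_congr rfl fun j _ => ?_
    rw [Finset.sum_mul]
    exact Finset.sum_congr rfl fun k _ => by ring
  have h2 : ∀ j k, ∫ x, (x j k : ℂ) * f x ∂(gaussians n) = ∫ x, D x (rotDir U j k) ∂(gaussians n) := by
    intro j k
    obtain ⟨C', hC'⟩ := hDC (rotDir U j k)
    exact stein_gaussians j k f _ hf (hD _) (max C C') (fun x => (hC x).trans (le_max_left _ _))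
      (fun x => (hC' x).trans (le_max_right _ _)) (fun x t => hd x j k t)
  simp_rw [h1]
  rw [integral_finsetSum _ fun j _ => integrable_finsetSum _ fun k _ => (hi j k).const_mul _]
  simp_rw [integral_finsetSum _ fun k _ => (hi _ k).const_mul (rotDir U _ k a b),
    integral_const_mul, h2]
  -- Complex linearity of `D x` is essential here: the coefficients of the directions are complex
  -- although the variables are real.
  simp_rw [← sum_rotDir_smul U hU a b, map_sum, map_smul, smul_eq_mul]
  rw [integral_finsetSum _ fun j _ => integrable_finsetSum _ fun k _ => (hDi _).const_mul _]
  refine Finset.sum_congr rfl fun j _ => ?_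
  rw [integral_finsetSum _ fun k _ => (hDi _).const_mul _]
  simp_rw [integral_const_mul]

/-- The entries of the GUE matrix have variance one. -/
lemma integral_norm_sq_rotGue (hU : Uᴴ * U = 1) (a b : Fin n) :
    Integrable (fun x => ‖rotGue U x a b‖ ^ 2) (gaussians n) ∧
      ∫ x, ‖rotGue U x a b‖ ^ 2 ∂(gaussians n) = 1 := by
  have h1 : ∀ x, ((‖rotGue U x a b‖ ^ 2 : ℝ) : ℂ)
      = ∑ j, ∑ k, ∑ j', ∑ k', (rotDir U j k a b * rotDir U j' k' b a) *
        ((x j k * x j' k' : ℝ) : ℂ) := by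
    intro x
    have : ((‖rotGue U x a b‖ ^ 2 : ℝ) : ℂ) = rotGue U x a b * rotGue U x b a := by
      rw [← (rotGue_isHermitian U x).apply b a, Complex.star_def, Complex.mul_conj,
        Complex.normSq_eq_norm_sq]
    rw [this, rotGue_eq_sum, rotGue_eq_sum]
    simp_rw [Finset.sum_mul, Finset.mul_sum]
    push_cast
    refine Finset.sum_congr rfl fun _ _ => Finset.sum_congr rfl fun _ _ =>
      Finset.sum_congr rfl fun _ _ => Finset.sum_congr rfl fun _ _ => by ring
  have hi : ∀ j k j' k', Integrable (fun x : Fin n → Fin n → ℝ =>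
      (rotDir U j k a b * rotDir U j' k' b a) * ((x j k * x j' k' : ℝ) : ℂ)) (gaussians n) :=
    fun j k j' k' => (integrable_mul_gaussians j k j' k').ofReal.const_mul _
  have hi4 : Integrable (fun x => ((‖rotGue U x a b‖ ^ 2 : ℝ) : ℂ)) (gaussians n) := by
    simp_rw [h1]
    exact integrable_finsetSum _ fun _ _ => integrable_finsetSum _ fun _ _ =>
      integrable_finsetSum _ fun _ _ => integrable_finsetSum _ fun _ _ => hi _ _ _ _
  refine ⟨hi4.re.congr (.of_forall fun x => Complex.ofReal_re _), ?_⟩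
  have h2 : ((∫ x, ‖rotGue U x a b‖ ^ 2 ∂(gaussians n) : ℝ) : ℂ) = 1 := by
    rw [← integral_complex_ofReal]
    simp_rw [h1]
    rw [integral_finsetSum _ fun _ _ => integrable_finsetSum _ fun _ _ =>
      integrable_finsetSum _ fun _ _ => integrable_finsetSum _ fun _ _ => hi _ _ _ _]
    have h3 := rotDir_cov U hU a b b a
    rw [if_pos ⟨rfl, rfl⟩] at h3
    rw [← h3]
    refine Finset.sum_congr rfl fun j _ => ?_
    rw [integral_finsetSum _ fun _ _ =>
      integrable_finsetSum _ fun _ _ => integrable_finsetSum _ fun _ _ => hi _ _ _ _]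
    refine Finset.sum_congr rfl fun k _ => ?_
    rw [integral_finsetSum _ fun _ _ => integrable_finsetSum _ fun _ _ => hi _ _ _ _]
    rw [Finset.sum_eq_single j, integral_finsetSum _ fun _ _ => hi _ _ _ _,
      Finset.sum_eq_single k, integral_const_mul, integral_complex_ofReal, integral_mul_gaussians]
    · simp
    · intro k' _ hk'
      rw [integral_const_mul, integral_complex_ofReal, integral_mul_gaussians, if_neg]
      · simp
      · exact fun h => hk' h.2.symm
    · simp
    · intro j' _ hj'
      rw [integral_finsetSum _ fun _ _ => hi _ _ _ _]
      refine Finset.sum_eq_zero fun k' _ => ?_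
      rw [integral_const_mul, integral_complex_ofReal, integral_mul_gaussians, if_neg]
      · simp
      · exact fun h => hj' h.1.symm
    · simp
  exact_mod_cast h2

end GUE

/-! ### Functional calculus, resolvents and evolutions of Hermitian matrices in operator norm -/

section Spectral

open scoped Matrix.Norms.L2Operator

variable {ι : Type*} [Fintype ι] [DecidableEq ι]

lemma norm_entry_le (M : Matrix ι ι ℂ) (p q : ι) : ‖M p q‖ ≤ ‖M‖ := by
  have h1 := l2_opNorm_mulVec M (EuclideanSpace.single q 1)
  have h2 := PiLp.norm_apply_le ((EuclideanSpace.equiv ι ℂ).symm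
    (M *ᵥ (EuclideanSpace.single q (1 : ℂ)).ofLp)) p
  have h3 : ‖(EuclideanSpace.single q (1 : ℂ) : EuclideanSpace ℂ ι)‖ = 1 := by simp
  rw [h3, mul_one] at h1
  refine le_trans (le_of_eq ?_) (h2.trans h1)
  simp

lemma norm_le_one_of_unitary (V : Matrix ι ι ℂ) (hV : Vᴴ * V = 1) : ‖V‖ ≤ 1 := by
  have h1 := l2_opNorm_conjTranspose_mul_self V
  rw [hV] at h1
  have h2 : ‖(1 : Matrix ι ι ℂ)‖ ≤ 1 := by
    rw [← diagonal_one, l2_opNorm_diagonal]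
    exact (pi_norm_le_iff_of_nonneg zero_le_one).2 fun i => by simp
  nlinarith [norm_nonneg V]

/-- The norm of a trace of a product. -/
lemma norm_trace_mul_le (K M : Matrix ι ι ℂ) :
    ‖trace (K * M)‖ ≤ (∑ p, ∑ q, ‖K p q‖) * ‖M‖ := by
  rw [Matrix.trace, Finset.sum_mul]
  refine (norm_sum_le _ _).trans (Finset.sum_le_sum fun p _ => ?_)
  rw [Matrix.diag_apply, Matrix.mul_apply, Finset.sum_mul]
  refine (norm_sum_le _ _).trans (Finset.sum_le_sum fun q _ => ?_)
  rw [norm_mul]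
  gcongr
  exact norm_entry_le M q p

variable {H : Matrix ι ι ℂ} (hH : H.IsHermitian)

/-- The functional calculus of a Hermitian matrix. -/
noncomputable def fc (f : ℝ → ℂ) : Matrix ι ι ℂ :=
  (hH.eigenvectorUnitary : Matrix ι ι ℂ) * diagonal (fun i => f (hH.eigenvalues i)) *
    (hH.eigenvectorUnitary : Matrix ι ι ℂ)ᴴ

lemma eigenvectorUnitary_mul_left :
    (hH.eigenvectorUnitary : Matrix ι ι ℂ)ᴴ * (hH.eigenvectorUnitary : Matrix ι ι ℂ) = 1 :=
  Unitary.coe_star_mul_self hH.eigenvectorUnitary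

lemma eigenvectorUnitary_mul_right :
    (hH.eigenvectorUnitary : Matrix ι ι ℂ) * (hH.eigenvectorUnitary : Matrix ι ι ℂ)ᴴ = 1 :=
  Unitary.coe_mul_star_self hH.eigenvectorUnitary

lemma fc_mul (f g : ℝ → ℂ) : fc hH f * fc hH g = fc hH (fun x => f x * g x) := by
  unfold fc
  rw [show ∀ A B C D : Matrix ι ι ℂ, A * B * C * (A * D * C) = A * B * (C * A) * (D * C) by
    intros; simp only [Matrix.mul_assoc], eigenvectorUnitary_mul_left, Matrix.mul_one,
    ← Matrix.mul_assoc, Matrix.mul_assoc _ (diagonal _) (diagonal _), diagonal_mul_diagonal]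

lemma fc_one : fc hH (fun _ => 1) = 1 := by
  unfold fc
  rw [diagonal_one, Matrix.mul_one, eigenvectorUnitary_mul_right]

lemma fc_id : fc hH (fun x => (x : ℂ)) = H := by
  have := hH.spectral_theorem
  rw [Unitary.conjStarAlgAut_apply] at this
  exact this.symm

lemma fc_sub (f g : ℝ → ℂ) : fc hH f - fc hH g = fc hH (fun x => f x - g x) := by
  unfold fc
  rw [← Matrix.sub_mul, ← Matrix.mul_sub, diagonal_sub]

lemma fc_smul (c : ℂ) (f : ℝ → ℂ) : c • fc hH f = fc hH (fun x => c * f x) := by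
  unfold fc
  rw [← Matrix.smul_mul, ← Matrix.mul_smul, ← diagonal_smul]
  rfl

lemma fc_apply (f : ℝ → ℂ) (p q : ι) : fc hH f p q = ∑ i,
    (hH.eigenvectorUnitary : Matrix ι ι ℂ) p i * f (hH.eigenvalues i) *
      star ((hH.eigenvectorUnitary : Matrix ι ι ℂ) q i) := by
  unfold fc
  simp [Matrix.mul_apply, diagonal_apply, Matrix.conjTranspose_apply]

lemma norm_fc_le (f : ℝ → ℂ) (C : ℝ) (hC : ∀ x, ‖f x‖ ≤ C) : ‖fc hH f‖ ≤ C := by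
  have hC0 : 0 ≤ C := (norm_nonneg _).trans (hC 0)
  have h1 : ‖(hH.eigenvectorUnitary : Matrix ι ι ℂ)‖ ≤ 1 :=
    norm_le_one_of_unitary _ (eigenvectorUnitary_mul_left hH)
  have h2 : ‖(diagonal (fun i => f (hH.eigenvalues i)) : Matrix ι ι ℂ)‖ ≤ C := by
    rw [l2_opNorm_diagonal]
    exact (pi_norm_le_iff_of_nonneg hC0).2 fun i => hC _
  unfold fc
  refine (l2_opNorm_mul _ _).trans ?_
  rw [l2_opNorm_conjTranspose]
  calc _ ≤ (1 * C) * 1 := by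
        gcongr
        exact (l2_opNorm_mul _ _).trans (by gcongr)
    _ = C := by ring

/-- The resolvent `(H - z)⁻¹`. -/
noncomputable def green (H : Matrix ι ι ℂ) (z : ℂ) : Matrix ι ι ℂ := (H - z • (1 : Matrix ι ι ℂ))⁻¹

lemma ofReal_sub_ne_zero {z : ℂ} (hz : z.im ≠ 0) (x : ℝ) : (x : ℂ) - z ≠ 0 := by
  intro h
  apply hz
  have := congrArg Complex.im h
  simpa using this

lemma norm_inv_ofReal_sub_le {z : ℂ} (hz : z.im ≠ 0) (x : ℝ) : ‖((x : ℂ) - z)⁻¹‖ ≤ |z.im|⁻¹ := by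
  rw [norm_inv]
  refine inv_anti₀ (abs_pos.2 hz) ?_
  have := Complex.abs_im_le_norm ((x : ℂ) - z)
  simpa using this

include hH

lemma sub_mul_fc {z : ℂ} (hz : z.im ≠ 0) :
    (H - z • (1 : Matrix ι ι ℂ)) * fc hH (fun x => ((x : ℂ) - z)⁻¹) = 1 := by
  have h1 : H - z • (1 : Matrix ι ι ℂ) = fc hH (fun x => (x : ℂ) - z) := by
    rw [← fc_sub, fc_id]
    congr 1
    rw [← fc_one hH, fc_smul]
    simp
  rw [h1, fc_mul, ← fc_one hH]
  congr 1
  ext x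
  exact mul_inv_cancel₀ (ofReal_sub_ne_zero hz x)

lemma green_eq_fc {z : ℂ} (hz : z.im ≠ 0) : green H z = fc hH (fun x => ((x : ℂ) - z)⁻¹) :=
  Matrix.inv_eq_right_inv (sub_mul_fc hH hz)

lemma sub_mul_green {z : ℂ} (hz : z.im ≠ 0) : (H - z • (1 : Matrix ι ι ℂ)) * green H z = 1 := by
  rw [green_eq_fc hH hz]; exact sub_mul_fc hH hz

lemma green_mul_sub {z : ℂ} (hz : z.im ≠ 0) : green H z * (H - z • (1 : Matrix ι ι ℂ)) = 1 :=
  mul_eq_one_comm.1 (sub_mul_green hH hz)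

lemma norm_green_le {z : ℂ} (hz : z.im ≠ 0) : ‖green H z‖ ≤ |z.im|⁻¹ := by
  rw [green_eq_fc hH hz]
  exact norm_fc_le hH _ _ (norm_inv_ofReal_sub_le hz)

lemma norm_green_apply_le {z : ℂ} (hz : z.im ≠ 0) (p q : ι) : ‖green H z p q‖ ≤ |z.im|⁻¹ :=
  (norm_entry_le _ p q).trans (norm_green_le hH hz)

omit hH in
/-- The resolvent identity. -/
lemma green_sub_green {A B : Matrix ι ι ℂ} (hA : A.IsHermitian) (hB : B.IsHermitian) {z w : ℂ}
    (hz : z.im ≠ 0) (hw : w.im ≠ 0) :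
    green A z - green B w = green A z * ((B - A) + (z - w) • (1 : Matrix ι ι ℂ)) * green B w := by
  have h1 : (B - A) + (z - w) • (1 : Matrix ι ι ℂ)
      = (B - w • (1 : Matrix ι ι ℂ)) - (A - z • (1 : Matrix ι ι ℂ)) := by
    rw [sub_smul]; abel
  rw [h1, Matrix.mul_sub, Matrix.sub_mul, green_mul_sub hA hz, Matrix.one_mul, Matrix.mul_assoc,
    sub_mul_green hB hw, Matrix.mul_one]

lemma evolution_eq_fc (t : ℝ) : evolution H t = fc hH (fun x => Complex.exp (Complex.I * t * x)) := by
  unfold evolution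
  have h1 : (Complex.I * (t : ℂ)) • H = (hH.eigenvectorUnitary : Matrix ι ι ℂ) *
      diagonal (fun i => Complex.I * t * (hH.eigenvalues i : ℂ)) *
      (hH.eigenvectorUnitary : Matrix ι ι ℂ)⁻¹ := by
    rw [Matrix.inv_eq_left_inv (eigenvectorUnitary_mul_left hH)]
    conv_lhs => rw [← fc_id hH, fc_smul]
    rfl
  rw [h1, Matrix.exp_conj, Matrix.exp_diagonal,
    Matrix.inv_eq_left_inv (eigenvectorUnitary_mul_left hH)]
  · unfold fc
    congr 3
    ext i
    rw [Pi.coe_exp, ← Complex.exp_eq_exp_ℂ]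
  · exact (Matrix.isUnit_iff_isUnit_det _).2
      (Matrix.isUnit_det_of_left_inverse (eigenvectorUnitary_mul_left hH))

lemma norm_evolution_le (t : ℝ) : ‖evolution H t‖ ≤ 1 := by
  rw [evolution_eq_fc hH]
  exact norm_fc_le hH _ _ fun x => (norm_exp_I_mul t x).le

/-- The difference of evolutions is bounded by the Hamiltonian. -/
lemma evolution_sub_evolution (s t : ℝ) : ∃ D : Matrix ι ι ℂ, ‖D‖ ≤ |s - t| ∧
    evolution H s - evolution H t = D * H ∧ evolution H s - evolution H t = H * D := by
  -- The divided difference of the two exponentials. At `x = 0` the convention `0⁻¹ = 0` is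
  -- harmless, since the numerator vanishes there.
  set φ : ℝ → ℂ := fun x =>
    (Complex.exp (Complex.I * s * x) - Complex.exp (Complex.I * t * x)) * (x : ℂ)⁻¹ with hφ
  have hmul : ∀ x : ℝ, φ x * x
      = Complex.exp (Complex.I * s * x) - Complex.exp (Complex.I * t * x) := by
    intro x
    by_cases hx : x = 0
    · subst hx; simp
    · have : (x : ℂ) ≠ 0 := by exact_mod_cast hx
      simp only [hφ]; field_simp
  have hd : evolution H s - evolution H t
      = fc hH (fun x => Complex.exp (Complex.I * s * x) - Complex.exp (Complex.I * t * x)) := by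
    rw [evolution_eq_fc hH, evolution_eq_fc hH, fc_sub]
  refine ⟨fc hH φ, norm_fc_le hH _ _ fun x => ?_, ?_, ?_⟩
  · simp only [hφ]
    rw [norm_mul, norm_inv, Complex.norm_real, Real.norm_eq_abs]
    have h1 : ‖Complex.exp (Complex.I * s * x) - Complex.exp (Complex.I * t * x)‖ ≤ |s - t| * |x| := by
      have : Complex.exp (Complex.I * s * x) - Complex.exp (Complex.I * t * x)
          = Complex.exp (Complex.I * t * x) *
            (Complex.exp (Complex.I * (((s - t) * x : ℝ) : ℂ)) - 1) := by
        rw [mul_sub, ← Complex.exp_add, mul_one]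
        congr 2
        push_cast; ring
      rw [this, norm_mul, norm_exp_I_mul, one_mul]
      refine (Real.norm_exp_I_mul_ofReal_sub_one_le).trans ?_
      rw [Real.norm_eq_abs, abs_mul]
    by_cases hx : x = 0
    · subst hx; simp
    · rw [← div_eq_mul_inv, div_le_iff₀ (abs_pos.2 hx)]; exact h1
  · have : fc hH φ * H = fc hH φ * fc hH (fun x => (x : ℂ)) := by rw [fc_id]
    rw [hd, this, fc_mul]
    congr 1; ext x; exact (hmul x).symm
  · have : H * fc hH φ = fc hH (fun x => (x : ℂ)) * fc hH φ := by rw [fc_id]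
    rw [hd, this, fc_mul]
    congr 1; ext x; exact (hmul x).symm.trans (mul_comm _ _)

omit hH in
/-- The norm of a column of a matrix. -/
lemma norm_mul_single (M : Matrix ι ι ℂ) (p : ι) :
    ‖M * Matrix.single p p (1 : ℂ)‖ ^ 2 ≤ ∑ a, ‖M a p‖ ^ 2 := by
  rw [sq, ← l2_opNorm_conjTranspose_mul_self]
  have : (M * Matrix.single p p (1 : ℂ))ᴴ * (M * Matrix.single p p (1 : ℂ))
      = diagonal (Pi.single p (((∑ a, ‖M a p‖ ^ 2 : ℝ)) : ℂ)) := by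
    ext i j
    rw [Matrix.mul_apply]
    simp only [Matrix.conjTranspose_apply, Matrix.mul_apply, Matrix.single_apply, mul_ite, mul_one,
      mul_zero]
    by_cases hi : p = i
    · subst hi
      by_cases hj : p = j
      · subst hj
        simp only [and_true, Finset.sum_ite_eq, Finset.mem_univ,
          if_true, diagonal_apply_eq, Pi.single_eq_same]
        push_cast
        refine Finset.sum_congr rfl fun a _ => ?_
        rw [mul_comm, Complex.star_def, Complex.mul_conj, Complex.normSq_eq_norm_sq]
        push_cast; rfl
      · simp [hj]
    · simp [hi, diagonal_apply, Ne.symm hi]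
  rw [this, l2_opNorm_diagonal]
  refine (pi_norm_le_iff_of_nonneg (by positivity)).2 fun i => ?_
  by_cases hi : i = p
  · subst hi
    rw [Pi.single_eq_same, Complex.norm_real, Real.norm_eq_abs, abs_of_nonneg (by positivity)]
  · rw [Pi.single_eq_of_ne hi, norm_zero]; positivity

omit hH in
-- An entry of `B * M` sees only one column of `M`, so the Euclidean norm of that column replaces
-- the operator norm of `M`.
lemma norm_mul_apply_le (B M : Matrix ι ι ℂ) (q p : ι) :
    ‖(B * M) q p‖ ≤ ‖B‖ * Real.sqrt (∑ a, ‖M a p‖ ^ 2) := by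
  have h1 : (B * M) q p = (B * (M * Matrix.single p p (1 : ℂ))) q p := by
    rw [← Matrix.mul_assoc, Matrix.mul_single_apply_same, mul_one]
  rw [h1]
  refine (norm_entry_le _ q p).trans ((l2_opNorm_mul _ _).trans ?_)
  gcongr
  exact Real.le_sqrt_of_sq_le (norm_mul_single M p)

/-- The time-Lipschitz constant of an entry involves only a column of `H`. For the random
Hamiltonian its mean square is bounded in `n` without any estimate of the operator norm of `w`. -/
lemma norm_mul_evolution_sub_le (B : Matrix ι ι ℂ) (s t : ℝ) (q p : ι) :
    ‖(B * evolution H s) q p - (B * evolution H t) q p‖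
      ≤ ‖B‖ * Real.sqrt (∑ a, ‖H a p‖ ^ 2) * |s - t| := by
  obtain ⟨D, hD, h1, -⟩ := evolution_sub_evolution hH s t
  rw [← Matrix.sub_apply, ← Matrix.mul_sub, h1, ← Matrix.mul_assoc]
  refine (norm_mul_apply_le _ _ _ _).trans ?_
  rw [mul_right_comm]
  gcongr
  exact (l2_opNorm_mul _ _).trans (by gcongr)

lemma norm_evolution_mul_sub_le (B : Matrix ι ι ℂ) (s t : ℝ) (q p : ι) :
    ‖(evolution H s * B) q p - (evolution H t * B) q p‖
      ≤ ‖B‖ * Real.sqrt (∑ a, ‖H a q‖ ^ 2) * |s - t| := by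
  obtain ⟨D, hD, -, h1⟩ := evolution_sub_evolution hH s t
  rw [← Matrix.sub_apply, ← Matrix.sub_mul, h1, Matrix.mul_assoc]
  have h2 : (H * (D * B)) q p = star (((D * B)ᴴ * H) p q) := by
    rw [← Matrix.conjTranspose_apply, Matrix.conjTranspose_mul, Matrix.conjTranspose_conjTranspose,
      hH.eq]
  rw [h2, norm_star]
  refine (norm_mul_apply_le _ _ _ _).trans ?_
  rw [mul_right_comm, l2_opNorm_conjTranspose]
  gcongr
  refine (l2_opNorm_mul _ _).trans ?_
  rw [mul_comm]
  gcongr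

omit [Fintype ι] [DecidableEq ι] hH in
lemma laplace_kernel_integrable {z : ℂ} (hz : 0 < z.im) (x : ℝ) :
    Integrable (fun τ : ℝ => Complex.exp (Complex.I * z * τ) * Complex.exp (Complex.I * (-τ : ℝ) * x))
      (volume.restrict (Set.Ioi 0)) := by
  have := integrableOn_exp_mul_complex_Ioi (a := Complex.I * (z - x)) (by simp [hz]) 0
  refine this.congr_fun (fun τ _ => ?_) measurableSet_Ioi
  simp only
  rw [← Complex.exp_add]; congr 1; push_cast; ring

omit [Fintype ι] [DecidableEq ι] hH in
lemma laplace_kernel {z : ℂ} (hz : 0 < z.im) (x : ℝ) :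
    ∫ τ : ℝ in Set.Ioi 0, Complex.exp (Complex.I * z * τ) * Complex.exp (Complex.I * (-τ : ℝ) * x)
      = -Complex.I * ((x : ℂ) - z)⁻¹ := by
  have h1 := integral_exp_mul_complex_Ioi (a := Complex.I * (z - x)) (by simp [hz]) 0
  have h2 : ∀ τ : ℝ, Complex.exp (Complex.I * z * τ) * Complex.exp (Complex.I * (-τ : ℝ) * x)
      = Complex.exp (Complex.I * (z - x) * τ) := by
    intro τ
    rw [← Complex.exp_add]; congr 1; push_cast; ring
  simp_rw [h2]
  rw [h1]
  have h3 : (x : ℂ) - z ≠ 0 := ofReal_sub_ne_zero hz.ne' x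
  have h4 : z - (x : ℂ) ≠ 0 := fun h => h3 (by linear_combination -h)
  have := Complex.I_ne_zero
  simp only [Complex.ofReal_zero, mul_zero, Complex.exp_zero]
  field_simp
  linear_combination ((z : ℂ) - x) * Complex.I_sq

/-- In the eigenbasis the entry is a finite sum of exponentials `e^{-ixτ}`, each with transform `-i
(x - z)⁻¹`. -/
lemma laplace_mul_evolution (A : Matrix ι ι ℂ) {z : ℂ} (hz : 0 < z.im) (q p : ι) :
    laplace (fun τ => (A * evolution H (-τ)) q p) z = -Complex.I * (A * green H z) q p := by
  have h1 : ∀ f : ℝ → ℂ, (A * fc hH f) q p = ∑ i, (∑ a, A q a *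
      (hH.eigenvectorUnitary : Matrix ι ι ℂ) a i * star ((hH.eigenvectorUnitary : Matrix ι ι ℂ) p i))
      * f (hH.eigenvalues i) := by
    intro f
    rw [Matrix.mul_apply]
    simp_rw [fc_apply, Finset.mul_sum, Finset.sum_mul]
    rw [Finset.sum_comm]
    exact Finset.sum_congr rfl fun _ _ => Finset.sum_congr rfl fun _ _ => by ring
  unfold laplace
  simp_rw [evolution_eq_fc hH, green_eq_fc hH hz.ne', h1, Finset.mul_sum]
  rw [integral_finsetSum]
  · refine Finset.sum_congr rfl fun i _ => ?_
    have := laplace_kernel hz (hH.eigenvalues i)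
    rw [mul_left_comm, ← this, ← integral_const_mul]
    congr 1
    ext τ
    ring
  · intro i _
    simp_rw [mul_left_comm (Complex.exp (Complex.I * z * _))]
    exact (laplace_kernel_integrable hz (hH.eigenvalues i)).const_mul _

/-- The forward evolution gives the resolvent in the lower half-plane. Evaluating at `-z` and
reversing the sign of the spectrum reduces it to the kernel of the backward case. -/
lemma laplace_evolution_mul (B : Matrix ι ι ℂ) {z : ℂ} (hz : z.im < 0) (q p : ι) :
    laplace (fun τ => (evolution H τ * B) q p) (-z) = Complex.I * (green H z * B) q p := by
  have hz' : 0 < (-z).im := by simpa using hz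
  have h1 : ∀ f : ℝ → ℂ, (fc hH f * B) q p = ∑ i, (∑ a,
      (hH.eigenvectorUnitary : Matrix ι ι ℂ) q i *
      star ((hH.eigenvectorUnitary : Matrix ι ι ℂ) a i) * B a p) * f (hH.eigenvalues i) := by
    intro f
    rw [Matrix.mul_apply]
    simp_rw [fc_apply, Finset.sum_mul]
    rw [Finset.sum_comm]
    exact Finset.sum_congr rfl fun _ _ => Finset.sum_congr rfl fun _ _ => by ring
  unfold laplace
  simp_rw [evolution_eq_fc hH, green_eq_fc hH hz.ne, h1, Finset.mul_sum]
  have hflip : ∀ τ x : ℝ, Complex.exp (Complex.I * τ * x)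
      = Complex.exp (Complex.I * (-τ : ℝ) * ((-x : ℝ) : ℂ)) := by
    intro τ x; congr 1; push_cast; ring
  rw [integral_finsetSum]
  · refine Finset.sum_congr rfl fun i _ => ?_
    have := laplace_kernel hz' (-hH.eigenvalues i)
    rw [mul_left_comm, show Complex.I * ((hH.eigenvalues i : ℂ) - z)⁻¹
      = -Complex.I * (((-hH.eigenvalues i : ℝ) : ℂ) - -z)⁻¹ by
        push_cast
        rw [show -(hH.eigenvalues i : ℂ) - -z = -((hH.eigenvalues i : ℂ) - z) by ring, inv_neg]
        ring, ← this, ← integral_const_mul]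
    congr 1
    ext τ
    rw [hflip]
    ring
  · intro i _
    simp_rw [mul_left_comm (Complex.exp (Complex.I * (-z) * _))]
    refine Integrable.const_mul ?_ _
    have := laplace_kernel_integrable hz' (-hH.eigenvalues i)
    simpa only [← hflip] using this

/-- Weighted diagonal matrix elements of a resolvent form the Stieltjes transform of a
probability measure. -/
lemma exists_spectral_measure {κ : Type*} (S : Finset κ) (hS : S.Nonempty) (p : κ → ι) :
    ∃ m : Measure ℝ, IsProbabilityMeasure m ∧ ∀ z : ℂ, z.im ≠ 0 →
      stieltjes m z = (S.card : ℂ)⁻¹ * ∑ a ∈ S, green H z (p a) (p a) := by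
  set V := (hH.eigenvectorUnitary : Matrix ι ι ℂ) with hV
  -- The mass at an eigenvalue is the average over `S` of the squared moduli of its eigenvector at
  -- the sites `p a`. The rows of a unitary matrix are normalized, so the masses sum to one.
  set w : ι → ℝ := fun i => (S.card : ℝ)⁻¹ * ∑ a ∈ S, ‖V (p a) i‖ ^ 2 with hw
  have hw0 : ∀ i, 0 ≤ w i := fun i => by positivity
  have hcard : (S.card : ℝ) ≠ 0 := by exact_mod_cast hS.card_pos.ne'
  have hrow : ∀ a, ∑ i, ‖V a i‖ ^ 2 = 1 := by
    intro a
    have h1 := congrFun (congrFun (eigenvectorUnitary_mul_right hH) a) a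
    rw [Matrix.mul_apply, Matrix.one_apply_eq] at h1
    have h2 : ((∑ i, ‖V a i‖ ^ 2 : ℝ) : ℂ) = 1 := by
      rw [← h1]; push_cast
      refine Finset.sum_congr rfl fun i _ => ?_
      rw [Matrix.conjTranspose_apply, Complex.star_def, Complex.mul_conj, Complex.normSq_eq_norm_sq]
      push_cast; rfl
    exact_mod_cast h2
  have hw1 : ∑ i, w i = 1 := by
    simp only [hw]
    rw [← Finset.mul_sum, Finset.sum_comm]
    simp only [hrow, Finset.sum_const, nsmul_eq_mul, mul_one]
    exact inv_mul_cancel₀ hcard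
  refine ⟨∑ i, ENNReal.ofReal (w i) • Measure.dirac (hH.eigenvalues i), ⟨?_⟩, fun z hz => ?_⟩
  · simp only [Measure.coe_finsetSum, Finset.sum_apply, Measure.smul_apply, measure_univ,
      smul_eq_mul, mul_one]
    rw [← ENNReal.ofReal_sum_of_nonneg fun i _ => hw0 i, hw1, ENNReal.ofReal_one]
  · unfold stieltjes
    rw [integral_finsetSum_measure]
    · have h1 : ∀ i, ∫ x : ℝ, ((x : ℂ) - z)⁻¹
          ∂(ENNReal.ofReal (w i) • Measure.dirac (hH.eigenvalues i))
          = (w i : ℂ) * ((hH.eigenvalues i : ℂ) - z)⁻¹ := by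
        intro i
        rw [integral_smul_measure, integral_dirac, ENNReal.toReal_ofReal (hw0 i), Complex.real_smul]
      simp_rw [h1, green_eq_fc hH hz, fc_apply, hw]
      rw [Finset.sum_comm, Finset.mul_sum]
      refine Finset.sum_congr rfl fun i _ => ?_
      push_cast
      rw [Finset.mul_sum, Finset.mul_sum, Finset.sum_mul]
      refine Finset.sum_congr rfl fun a _ => ?_
      have : ((‖V (p a) i‖ : ℂ)) ^ 2 = V (p a) i * star (V (p a) i) := by
        rw [Complex.star_def, Complex.mul_conj, Complex.normSq_eq_norm_sq]; push_cast; rfl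
      rw [this]
      ring
    · intro i _
      refine Integrable.smul_measure ?_ ENNReal.ofReal_ne_top
      exact integrable_dirac (by simp [enorm_lt_top])

end Spectral

/-! ### The Hamiltonian in the reservoir eigenbasis and the derivative of its resolvent -/

section Model

open scoped Matrix.Norms.L2Operator

variable {n : ℕ}

lemma sum_units (α : ℤˣ) (f : ℤˣ → ℂ) : ∑ ε, f ε = f (-α) + f α := by
  have : (Finset.univ : Finset ℤˣ) = {-α, α} := by
    rcases Int.units_eq_one_or α with rfl | rfl <;> decide
  rw [this, Finset.sum_pair]
  rcases Int.units_eq_one_or α with rfl | rfl <;> decide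

lemma neg_unit_ne (α : ℤˣ) : -α ≠ α := by
  rcases Int.units_eq_one_or α with rfl | rfl <;> decide

/-- The coupling `v σ^x ⊗ K / √n`. -/
noncomputable def coup (v : ℝ) : Matrix (Fin n) (Fin n) ℂ →ₗ[ℂ] Matrix (ℤˣ × Fin n) (ℤˣ × Fin n) ℂ where
  toFun K := (v : ℂ) • (sigmaX ⊗ₖ (((Real.sqrt (n : ℝ) : ℝ) : ℂ)⁻¹ • K))
  map_add' K L := by simp [Matrix.kronecker_add]
  map_smul' c K := by
    simp only [RingHom.id_apply, Matrix.kronecker_smul]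
    rw [smul_comm _ c, smul_comm _ c]

/-- The strength of the coupling. -/
noncomputable def cpl (v : ℝ) (n : ℕ) : ℂ := (v : ℂ) * ((Real.sqrt (n : ℝ) : ℝ) : ℂ)⁻¹

lemma cpl_sq (v : ℝ) {n : ℕ} (hn : 0 < n) : cpl v n * cpl v n * n = (v : ℂ) ^ 2 := by
  have h1 : ((Real.sqrt (n : ℝ) : ℝ) : ℂ) * ((Real.sqrt (n : ℝ) : ℝ) : ℂ) = n := by
    rw [← Complex.ofReal_mul, Real.mul_self_sqrt (by positivity)]; simp
  have h2 : ((Real.sqrt (n : ℝ) : ℝ) : ℂ) ≠ 0 := by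
    have : Real.sqrt (n : ℝ) ≠ 0 := by positivity
    exact_mod_cast this
  unfold cpl
  rw [← h1]
  field_simp

lemma coup_apply (v : ℝ) (K : Matrix (Fin n) (Fin n) ℂ) (p q : ℤˣ × Fin n) :
    coup v K p q = if q.1 = -p.1 then cpl v n * K p.2 q.2 else 0 := by
  simp only [coup, LinearMap.coe_mk, AddHom.coe_mk, Matrix.smul_apply, Matrix.kroneckerMap_apply,
    sigmaX, Matrix.of_apply, smul_eq_mul, cpl]
  split_ifs <;> ring

variable (s v : ℝ) (e : Fin n → ℝ) (U : Matrix (Fin n) (Fin n) ℂ)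

/-- The Hamiltonian in the eigenbasis of the reservoir. -/
noncomputable def ham (x : Fin n → Fin n → ℝ) : Matrix (ℤˣ × Fin n) (ℤˣ × Fin n) ℂ :=
  hamiltonian s v (diagonal fun a => (e a : ℂ)) (rotGue U x)

lemma ham_eq (x : Fin n → Fin n → ℝ) : ham s v e U x =
    diagonal (fun p : ℤˣ × Fin n => (e p.2 : ℂ) + sgn p.1 * s) + coup v (rotGue U x) := by
  unfold ham hamiltonian
  congr 1
  ext p q
  simp only [Matrix.add_apply, Matrix.smul_apply, Matrix.kroneckerMap_apply, sigmaZ, smul_eq_mul,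
    diagonal_apply, Matrix.one_apply]
  by_cases hpq : p = q
  · subst hpq; simp; ring
  · rw [if_neg hpq]
    by_cases h1 : p.1 = q.1
    · have h2 : p.2 ≠ q.2 := fun h2 => hpq (Prod.ext h1 h2)
      simp [h2]
    · simp [h1]

lemma sgn_star (α : ℤˣ) : star (sgn α) = sgn α := by
  simp [sgn]

lemma coup_isHermitian {K : Matrix (Fin n) (Fin n) ℂ} (hK : K.IsHermitian) :
    (coup v K).IsHermitian := by
  ext p q
  rw [Matrix.conjTranspose_apply, coup_apply, coup_apply]
  by_cases h : q.1 = -p.1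
  · rw [if_pos h, if_pos (by rw [h, neg_neg]), star_mul', hK.apply]
    congr 1
    simp [cpl, Complex.conj_ofReal]
  · rw [if_neg h, if_neg (fun h' => h (by rw [h', neg_neg])), star_zero]

lemma ham_isHermitian (x : Fin n → Fin n → ℝ) : (ham s v e U x).IsHermitian := by
  rw [ham_eq]
  refine IsHermitian.add ?_ (coup_isHermitian v (rotGue_isHermitian U x))
  refine isHermitian_diagonal_of_self_adjoint _ ?_
  ext p
  simp [sgn_star, Complex.conj_ofReal]

lemma ham_upd (x : Fin n → Fin n → ℝ) (j k : Fin n) (t : ℝ) :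
    ham s v e U (upd x j k t) = ham s v e U x + ((t : ℂ) - x j k) • coup v (rotDir U j k) := by
  rw [ham_eq, ham_eq, rotGue_upd, map_add, map_smul, add_assoc]

lemma continuous_ham : Continuous (ham s v e U) := by
  have h1 : Continuous fun K : Matrix (Fin n) (Fin n) ℂ => coup v K :=
    (coup (n := n) v).continuous_of_finiteDimensional
  have h2 : ham s v e U = fun x =>
    diagonal (fun p : ℤˣ × Fin n => (e p.2 : ℂ) + sgn p.1 * s) + coup v (rotGue U x) :=
    funext (ham_eq s v e U)
  rw [h2]
  exact continuous_const.add (h1.comp (continuous_rotGue U))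

/-- The resolvent of the Hamiltonian. -/
noncomputable def GX (z : ℂ) (x : Fin n → Fin n → ℝ) : Matrix (ℤˣ × Fin n) (ℤˣ × Fin n) ℂ :=
  green (ham s v e U x) z

lemma norm_GX_le {z : ℂ} (hz : z.im ≠ 0) (x : Fin n → Fin n → ℝ) : ‖GX s v e U z x‖ ≤ |z.im|⁻¹ :=
  norm_green_le (ham_isHermitian s v e U x) hz

lemma norm_GX_apply_le {z : ℂ} (hz : z.im ≠ 0) (x : Fin n → Fin n → ℝ) (p q : ℤˣ × Fin n) :
    ‖GX s v e U z x p q‖ ≤ |z.im|⁻¹ :=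
  norm_green_apply_le (ham_isHermitian s v e U x) hz p q

lemma continuous_GX {z : ℂ} (hz : z.im ≠ 0) : Continuous (GX s v e U z) := by
  refine continuous_iff_continuousAt.2 fun x => ?_
  refine tendsto_iff_norm_sub_tendsto_zero.2 ?_
  have h1 : Tendsto (fun y => |z.im|⁻¹ * ‖ham s v e U x - ham s v e U y‖ * |z.im|⁻¹) (𝓝 x) (𝓝 0) := by
    have h2 : Continuous fun y => |z.im|⁻¹ * ‖ham s v e U x - ham s v e U y‖ * |z.im|⁻¹ :=
      (continuous_const.mul (continuous_const.sub (continuous_ham s v e U)).norm).mul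
        continuous_const
    have := h2.tendsto x
    simpa using this
  refine squeeze_zero (fun y => norm_nonneg _) (fun y => ?_) h1
  unfold GX
  rw [green_sub_green (ham_isHermitian s v e U y) (ham_isHermitian s v e U x) hz hz, sub_self,
    zero_smul, add_zero]
  refine (l2_opNorm_mul _ _).trans ?_
  gcongr
  · refine (l2_opNorm_mul _ _).trans ?_
    gcongr
    exact norm_GX_le s v e U hz y
  · exact norm_GX_le s v e U hz x

lemma continuous_GX_apply {z : ℂ} (hz : z.im ≠ 0) (p q : ℤˣ × Fin n) :
    Continuous fun x => GX s v e U z x p q :=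
  (continuous_GX s v e U hz).matrix_elem p q

/-- The functional `K ↦ (A (v σ^x ⊗ K / √n) B)_pq`. -/
noncomputable def sandwich (A B : Matrix (ℤˣ × Fin n) (ℤˣ × Fin n) ℂ) (p q : ℤˣ × Fin n) :
    Matrix (Fin n) (Fin n) ℂ →ₗ[ℂ] ℂ where
  toFun K := (A * coup v K * B) p q
  map_add' K L := by simp [Matrix.mul_add, Matrix.add_mul]
  map_smul' c K := by simp

/-- Bounded functions of the Gaussian array, differentiable with bounded continuous derivative. -/
structure GueSmooth (f : (Fin n → Fin n → ℝ) → ℂ)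
    (D : (Fin n → Fin n → ℝ) → Matrix (Fin n) (Fin n) ℂ →ₗ[ℂ] ℂ) : Prop where
  cont : Continuous f
  bdd : ∃ C, ∀ x, ‖f x‖ ≤ C
  dcont : ∀ K, Continuous fun x => D x K
  dbdd : ∀ K, ∃ C, ∀ x, ‖D x K‖ ≤ C
  deriv : ∀ x j k t, HasDerivAt (fun t => f (upd x j k t)) (D (upd x j k t) (rotDir U j k)) t

lemma gueSmooth_const (c : ℂ) : GueSmooth U (fun _ => c) (fun _ => 0) where
  cont := continuous_const
  bdd := ⟨‖c‖, fun _ => le_rfl⟩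
  dcont _ := continuous_const
  dbdd _ := ⟨0, fun _ => by simp⟩
  deriv _ _ _ _ := by simpa using hasDerivAt_const _ _

lemma GueSmooth.mul {U : Matrix (Fin n) (Fin n) ℂ} {f g : (Fin n → Fin n → ℝ) → ℂ}
    {D E : (Fin n → Fin n → ℝ) → Matrix (Fin n) (Fin n) ℂ →ₗ[ℂ] ℂ} (hf : GueSmooth U f D)
    (hg : GueSmooth U g E) :
    GueSmooth U (fun x => f x * g x) (fun x => g x • D x + f x • E x) where
  cont := hf.cont.mul hg.cont
  bdd := by
    obtain ⟨C, hC⟩ := hf.bdd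
    obtain ⟨C', hC'⟩ := hg.bdd
    refine ⟨C * C', fun x => ?_⟩
    rw [norm_mul]
    exact mul_le_mul (hC x) (hC' x) (norm_nonneg _) ((norm_nonneg _).trans (hC x))
  dcont K := (hg.cont.mul (hf.dcont K)).add (hf.cont.mul (hg.dcont K))
  dbdd K := by
    obtain ⟨C, hC⟩ := hf.bdd
    obtain ⟨C', hC'⟩ := hg.bdd
    obtain ⟨B, hB⟩ := hf.dbdd K
    obtain ⟨B', hB'⟩ := hg.dbdd K
    refine ⟨C' * B + C * B', fun x => ?_⟩
    simp only [LinearMap.add_apply, LinearMap.smul_apply, smul_eq_mul]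
    refine (norm_add_le _ _).trans ?_
    rw [norm_mul, norm_mul]
    exact add_le_add
      (mul_le_mul (hC' x) (hB x) (norm_nonneg _) ((norm_nonneg _).trans (hC' x)))
      (mul_le_mul (hC x) (hB' x) (norm_nonneg _) ((norm_nonneg _).trans (hC x)))
  deriv x j k t := by
    convert! (hf.deriv x j k t).mul (hg.deriv x j k t) using 1
    simp only [LinearMap.add_apply, LinearMap.smul_apply, smul_eq_mul]
    ring

lemma continuous_upd (x : Fin n → Fin n → ℝ) (j k : Fin n) : Continuous (upd x j k) := by
  unfold upd
  exact continuous_const.update j (continuous_const.update k continuous_id)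

lemma upd_apply_same (x : Fin n → Fin n → ℝ) (j k : Fin n) (t : ℝ) : upd x j k t j k = t := by
  simp [upd]

lemma upd_upd (x : Fin n → Fin n → ℝ) (j k : Fin n) (t t' : ℝ) :
    upd (upd x j k t) j k t' = upd x j k t' := by
  simp [upd]

lemma GX_upd_sub {z : ℂ} (hz : z.im ≠ 0) (x : Fin n → Fin n → ℝ) (j k : Fin n) (t : ℝ) :
    GX s v e U z (upd x j k t) - GX s v e U z x
      = -((t : ℂ) - x j k) • (GX s v e U z (upd x j k t) * coup v (rotDir U j k) * GX s v e U z x) := by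
  unfold GX
  rw [green_sub_green (ham_isHermitian s v e U _) (ham_isHermitian s v e U x) hz hz, sub_self,
    zero_smul, add_zero, ham_upd, sub_add_cancel_left]
  simp only [neg_smul, Matrix.mul_neg, Matrix.neg_mul, Matrix.mul_smul, Matrix.smul_mul]

/-- By the resolvent identity the difference quotient is exactly `-G(t') V G(t)`, with `V` the
direction of the coupling, so continuity of the resolvent gives the derivative `-G V G`. -/
lemma gueSmooth_GX {z : ℂ} (hz : z.im ≠ 0) (p q : ℤˣ × Fin n) :
    GueSmooth U (fun x => GX s v e U z x p q)
      (fun x => -sandwich v (GX s v e U z x) (GX s v e U z x) p q) where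
  cont := continuous_GX_apply s v e U hz p q
  bdd := ⟨|z.im|⁻¹, fun x => norm_GX_apply_le s v e U hz x p q⟩
  dcont K := by
    have := continuous_GX s v e U hz
    simp only [LinearMap.neg_apply, sandwich, LinearMap.coe_mk, AddHom.coe_mk]
    exact (((this.matrix_mul continuous_const).matrix_mul this).matrix_elem p q).neg
  dbdd K := by
    refine ⟨|z.im|⁻¹ * ‖coup v K‖ * |z.im|⁻¹, fun x => ?_⟩
    simp only [LinearMap.neg_apply, sandwich, LinearMap.coe_mk, AddHom.coe_mk, norm_neg]
    refine (norm_entry_le _ p q).trans ((l2_opNorm_mul _ _).trans ?_)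
    gcongr
    · refine (l2_opNorm_mul _ _).trans ?_
      gcongr
      exact norm_GX_le s v e U hz x
    · exact norm_GX_le s v e U hz x
  deriv x j k t := by
    rw [hasDerivAt_iff_tendsto_slope]
    have hc : Continuous fun t' => (GX s v e U z (upd x j k t') * coup v (rotDir U j k) *
        GX s v e U z (upd x j k t)) p q :=
      (((((continuous_GX s v e U hz).comp (continuous_upd x j k)).matrix_mul
        continuous_const).matrix_mul continuous_const).matrix_elem p q)
    refine ((hc.neg.tendsto t).mono_left nhdsWithin_le_nhds).congr' ?_
    filter_upwards [self_mem_nhdsWithin] with t' ht'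
    have h1 := congrFun (congrFun (GX_upd_sub s v e U hz (upd x j k t) j k t') p) q
    rw [upd_upd, upd_apply_same, Matrix.sub_apply, Matrix.smul_apply, smul_eq_mul] at h1
    have h2 : (t' : ℂ) - t ≠ 0 := by
      rw [← Complex.ofReal_sub]; exact_mod_cast sub_ne_zero.2 ht'
    rw [slope_def_module, h1, Complex.real_smul]
    push_cast
    field_simp
    rfl

end Model

/-! ### Self-averaging of partial traces, and the sign symmetry -/

section Concentration

open scoped Matrix.Norms.L2Operator

variable {n : ℕ} (s v : ℝ) (e : Fin n → ℝ) (U : Matrix (Fin n) (Fin n) ℂ)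

/-- The matrix with entries `d_a` at `((δ, a), (α, a))`. -/
noncomputable def pairing (α δ : ℤˣ) (d : Fin n → ℂ) : Matrix (ℤˣ × Fin n) (ℤˣ × Fin n) ℂ :=
  Matrix.of fun p q => if p.1 = δ ∧ q.1 = α ∧ p.2 = q.2 then d p.2 else 0

/-- `J* J` is diagonal, so the operator norm is controlled by the largest weight. Together with the
next two lemmas this bounds sums over all reservoir states without a factor `n`. -/
lemma norm_pairing_le (α δ : ℤˣ) (d : Fin n → ℂ) (a : ℝ) (ha : 0 ≤ a) (hd : ∀ k, ‖d k‖ ≤ a) :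
    ‖pairing α δ d‖ ≤ a := by
  have h1 : (pairing α δ d)ᴴ * pairing α δ d
      = diagonal (fun p => if p.1 = α then star (d p.2) * d p.2 else 0) := by
    ext p q
    rw [Matrix.mul_apply]
    simp only [Matrix.conjTranspose_apply, pairing, Matrix.of_apply, diagonal_apply]
    rw [Fintype.sum_prod_type, Finset.sum_eq_single δ, Finset.sum_eq_single p.2]
    · by_cases h2 : p.1 = α
      · by_cases h3 : p = q
        · subst h3; simp [h2]
        · rw [if_neg h3]
          by_cases h4 : q.1 = α
          · have : p.2 ≠ q.2 := fun h5 => h3 (Prod.ext (h2.trans h4.symm) h5)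
            simp [this]
          · simp [h4]
      · simp [h2]
    · intro b _ hb
      simp [hb]
    · exact fun h => absurd (Finset.mem_univ _) h
    · intro b _ hb
      simp [hb]
    · exact fun h => absurd (Finset.mem_univ _) h
  have h2 := l2_opNorm_conjTranspose_mul_self (pairing α δ d)
  rw [h1, l2_opNorm_diagonal] at h2
  have h3 : ‖(fun p : ℤˣ × Fin n => if p.1 = α then star (d p.2) * d p.2 else 0)‖ ≤ a * a := by
    refine (pi_norm_le_iff_of_nonneg (by positivity)).2 fun p => ?_
    split_ifs
    · rw [norm_mul, norm_star]
      exact mul_le_mul (hd _) (hd _) (norm_nonneg _) ha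
    · rw [norm_zero]; positivity
  nlinarith [norm_nonneg (pairing α δ d)]

lemma mul_pairing_mul_apply (A B : Matrix (ℤˣ × Fin n) (ℤˣ × Fin n) ℂ) (α δ : ℤˣ)
    (d : Fin n → ℂ) (q p : ℤˣ × Fin n) :
    (B * pairing α δ d * A) q p = ∑ a, d a * (A (α, a) p * B q (δ, a)) := by
  rw [Matrix.mul_assoc, Matrix.mul_apply, Fintype.sum_prod_type, Finset.sum_eq_single δ]
  · refine Finset.sum_congr rfl fun a _ => ?_
    have : (pairing α δ d * A) (δ, a) p = d a * A (α, a) p := by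
      rw [Matrix.mul_apply, Fintype.sum_prod_type, Finset.sum_eq_single α, Finset.sum_eq_single a]
      · simp [pairing]
      · intro b _ hb
        simp [pairing, Ne.symm hb]
      · exact fun h => absurd (Finset.mem_univ _) h
      · intro b _ hb
        simp [pairing, hb]
      · exact fun h => absurd (Finset.mem_univ _) h
    rw [this]; ring
  · intro b _ hb
    refine Finset.sum_eq_zero fun a _ => ?_
    have : (pairing α δ d * A) (b, a) p = 0 := by
      rw [Matrix.mul_apply]
      refine Finset.sum_eq_zero fun c _ => ?_
      simp [pairing, hb]
    rw [this, mul_zero]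
  · exact fun h => absurd (Finset.mem_univ _) h

lemma trace_pairing_mul (M : Matrix (ℤˣ × Fin n) (ℤˣ × Fin n) ℂ) (α δ : ℤˣ) (d : Fin n → ℂ) :
    trace (pairing α δ d * M) = ∑ a, d a * M (α, a) (δ, a) := by
  rw [Matrix.trace, Fintype.sum_prod_type, Finset.sum_eq_single δ]
  · refine Finset.sum_congr rfl fun a _ => ?_
    rw [Matrix.diag_apply, Matrix.mul_apply, Fintype.sum_prod_type, Finset.sum_eq_single α,
      Finset.sum_eq_single a]
    · simp [pairing]
    · intro b _ hb
      simp [pairing, Ne.symm hb]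
    · exact fun h => absurd (Finset.mem_univ _) h
    · intro b _ hb
      simp [pairing, hb]
    · exact fun h => absurd (Finset.mem_univ _) h
  · intro b _ hb
    refine Finset.sum_eq_zero fun a _ => ?_
    rw [Matrix.diag_apply, Matrix.mul_apply]
    refine Finset.sum_eq_zero fun c _ => ?_
    simp [pairing, hb]
  · exact fun h => absurd (Finset.mem_univ _) h

/-- The weighted partial trace `n⁻¹ Σ_k d_k G_{αk,βk}`. -/
noncomputable def ptr (z : ℂ) (α β : ℤˣ) (d : Fin n → ℂ) (x : Fin n → Fin n → ℝ) : ℂ :=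
  (n : ℂ)⁻¹ * ∑ k, d k * GX s v e U z x (α, k) (β, k)

lemma ptr_eq_trace (z : ℂ) (α β : ℤˣ) (d : Fin n → ℂ) (x : Fin n → Fin n → ℝ) :
    ptr s v e U z α β d x = (n : ℂ)⁻¹ * trace (pairing α β d * GX s v e U z x) := by
  rw [trace_pairing_mul]; rfl

lemma continuous_ptr {z : ℂ} (hz : z.im ≠ 0) (α β : ℤˣ) (d : Fin n → ℂ) :
    Continuous (ptr s v e U z α β d) := by
  unfold ptr
  exact continuous_const.mul (continuous_finsetSum _ fun k _ =>
    continuous_const.mul (continuous_GX_apply s v e U hz _ _))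

lemma norm_ptr_le (hn : 0 < n) {z : ℂ} (hz : z.im ≠ 0) (α β : ℤˣ) (d : Fin n → ℂ) (a : ℝ)
    (hd : ∀ k, ‖d k‖ ≤ a) (x : Fin n → Fin n → ℝ) :
    ‖ptr s v e U z α β d x‖ ≤ a * |z.im|⁻¹ := by
  unfold ptr
  have hn' : (n : ℝ) ≠ 0 := by positivity
  rw [norm_mul, norm_inv, Complex.norm_natCast]
  calc _ ≤ (n : ℝ)⁻¹ * ∑ _k : Fin n, a * |z.im|⁻¹ := by
        gcongr
        refine (norm_sum_le _ _).trans (Finset.sum_le_sum fun k _ => ?_)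
        rw [norm_mul]
        exact mul_le_mul (hd k) (norm_GX_apply_le s v e U hz x _ _) (norm_nonneg _)
          ((norm_nonneg _).trans (hd k))
    _ = a * |z.im|⁻¹ := by
        rw [Finset.sum_const, Finset.card_univ, Fintype.card_fin, nsmul_eq_mul]
        field_simp

/-- The isometry `1 ⊗ U`. -/
noncomputable def lift1 : Matrix (ℤˣ × Fin n) (ℤˣ × Fin n) ℂ := (1 : Matrix ℤˣ ℤˣ ℂ) ⊗ₖ U

lemma lift1_conjTranspose_mul (hU : Uᴴ * U = 1) : (lift1 U)ᴴ * lift1 U = 1 := by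
  unfold lift1
  rw [Matrix.conjTranspose_kronecker, ← Matrix.mul_kronecker_mul, hU, Matrix.conjTranspose_one,
    Matrix.one_mul, Matrix.one_kronecker_one]

/-- The entrywise sum of norms of a direction is small only in the original basis; this lets the
rotation be shifted onto the other factors, where the operator norm ignores it. -/
lemma coup_rot (K : Matrix (Fin n) (Fin n) ℂ) :
    coup v (Uᴴ * K * U) = (lift1 U)ᴴ * coup v K * lift1 U := by
  simp only [coup, LinearMap.coe_mk, AddHom.coe_mk, lift1]
  rw [Matrix.conjTranspose_kronecker, Matrix.conjTranspose_one, Matrix.mul_smul, Matrix.smul_mul,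
    ← Matrix.mul_kronecker_mul, ← Matrix.mul_kronecker_mul, Matrix.one_mul, Matrix.mul_one,
    Matrix.mul_smul, Matrix.smul_mul]

lemma sum_norm_coup (K : Matrix (Fin n) (Fin n) ℂ) :
    ∑ p, ∑ q, ‖coup v K p q‖ = 2 * ‖cpl v n‖ * ∑ a, ∑ b, ‖K a b‖ := by
  have h1 : ∀ p : ℤˣ × Fin n, ∑ q, ‖coup v K p q‖ = ‖cpl v n‖ * ∑ b, ‖K p.2 b‖ := by
    intro p
    rw [Fintype.sum_prod_type, Finset.sum_eq_single (-p.1)]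
    · rw [Finset.mul_sum]
      refine Finset.sum_congr rfl fun b _ => ?_
      rw [coup_apply, if_pos rfl, norm_mul]
    · intro β _ hβ
      refine Finset.sum_eq_zero fun b _ => ?_
      rw [coup_apply, if_neg hβ, norm_zero]
    · exact fun h => absurd (Finset.mem_univ _) h
  simp_rw [h1]
  rw [Fintype.sum_prod_type]
  simp only [Finset.sum_const, Finset.card_univ, Fintype.card_units_int, nsmul_eq_mul,
    ← Finset.mul_sum]
  push_cast; ring

/-- The size of the fluctuations of partial traces. -/
noncomputable def fluct (v : ℝ) (z : ℂ) (a : ℝ) (n : ℕ) : ℝ :=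
  4 * |v| * a * |z.im|⁻¹ * |z.im|⁻¹ / Real.sqrt n

lemma norm_cpl (v : ℝ) (n : ℕ) : ‖cpl v n‖ = |v| / Real.sqrt n := by
  unfold cpl
  rw [norm_mul, norm_inv, Complex.norm_real, Complex.norm_real, Real.norm_eq_abs, Real.norm_eq_abs,
    abs_of_nonneg (Real.sqrt_nonneg _), div_eq_mul_inv]

/-- The increment is a trace of one sparse coupling direction against a matrix of bounded operator
norm. The normalization gives `1/n` and the coupling `1/√n`, so over `n²` variables the squared
constants sum to `fluct ^ 2`, of order `1/n`. -/
lemma ptr_lipschitz (hU : Uᴴ * U = 1) {z : ℂ} (hz : z.im ≠ 0) (α β : ℤˣ)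
    (d : Fin n → ℂ) (a : ℝ) (ha : 0 ≤ a) (hd : ∀ k, ‖d k‖ ≤ a) (x : Fin n → Fin n → ℝ)
    (j k : Fin n) (t : ℝ) :
    ‖ptr s v e U z α β d (upd x j k t) - ptr s v e U z α β d x‖
      ≤ (fluct v z a n / n) * |t - x j k| := by
  set G := GX s v e U z x
  set G' := GX s v e U z (upd x j k t)
  set J := pairing α β d
  set V := lift1 U
  have hV : ‖V‖ ≤ 1 := norm_le_one_of_unitary _ (lift1_conjTranspose_mul U hU)
  have h1 : ptr s v e U z α β d (upd x j k t) - ptr s v e U z α β d x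
      = -((n : ℂ)⁻¹ * (((t : ℂ) - x j k) *
        trace (coup v (gueDir j k) * (V * (G * (J * (G' * Vᴴ))))))) := by
    rw [ptr_eq_trace, ptr_eq_trace, ← mul_sub, ← Matrix.trace_sub, ← Matrix.mul_sub,
      GX_upd_sub s v e U hz, Matrix.mul_smul, Matrix.trace_smul, smul_eq_mul]
    have h2 : trace (J * (G' * coup v (rotDir U j k) * G))
        = trace (coup v (gueDir j k) * (V * (G * (J * (G' * Vᴴ))))) := by
      rw [rotDir, coup_rot]
      calc trace (J * (G' * (Vᴴ * coup v (gueDir j k) * V) * G))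
          = trace ((J * (G' * Vᴴ)) * (coup v (gueDir j k) * (V * G))) := by
            simp only [Matrix.mul_assoc]
        _ = trace ((coup v (gueDir j k) * (V * G)) * (J * (G' * Vᴴ))) := Matrix.trace_mul_comm _ _
        _ = _ := by simp only [Matrix.mul_assoc]
    rw [h2]; ring
  have hM : ‖V * (G * (J * (G' * Vᴴ)))‖ ≤ 1 * (|z.im|⁻¹ * (a * (|z.im|⁻¹ * 1))) := by
    refine (l2_opNorm_mul _ _).trans ?_
    gcongr
    refine (l2_opNorm_mul _ _).trans ?_
    gcongr
    · exact norm_GX_le s v e U hz x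
    refine (l2_opNorm_mul _ _).trans ?_
    gcongr
    · exact norm_pairing_le α β d a ha hd
    refine (l2_opNorm_mul _ _).trans ?_
    gcongr
    · exact norm_GX_le s v e U hz _
    · rw [l2_opNorm_conjTranspose]; exact hV
  rw [h1, norm_neg, norm_mul, norm_mul, norm_inv, Complex.norm_natCast, ← Complex.ofReal_sub,
    Complex.norm_real, Real.norm_eq_abs]
  have htr := norm_trace_mul_le (coup v (gueDir j k)) (V * (G * (J * (G' * Vᴴ))))
  rw [sum_norm_coup, norm_cpl] at htr
  have hdir := sum_norm_gueDir_le j k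
  calc _ ≤ (n : ℝ)⁻¹ * (|t - x j k| * ((2 * (|v| / Real.sqrt n) * 2) *
        (1 * (|z.im|⁻¹ * (a * (|z.im|⁻¹ * 1)))))) := by
        gcongr
        refine htr.trans ?_
        gcongr
    _ = _ := by unfold fluct; ring

/-- The nonnegativity of the variance of `‖f‖`. -/
lemma integral_norm_le_sqrt {X : Type*} [MeasurableSpace X] (μ : Measure X)
    [IsProbabilityMeasure μ] (f : X → ℂ) (hf : MemLp f 2 μ) :
    ∫ x, ‖f x‖ ∂μ ≤ Real.sqrt (∫ x, ‖f x‖ ^ 2 ∂μ) := by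
  refine Real.le_sqrt_of_sq_le ?_
  have h2 : MemLp (fun x => (‖f x‖ : ℂ)) 2 μ := by
    have := hf.norm
    exact this.ofReal
  have h1 := integral_norm_sub_sq μ (fun x => (‖f x‖ : ℂ)) h2 0
  simp only [sub_zero, Complex.norm_real, norm_norm] at h1
  rw [integral_complex_ofReal, Complex.norm_real, Real.norm_eq_abs, sq_abs] at h1
  have h3 : 0 ≤ ∫ x, ‖(‖f x‖ : ℂ) - ((∫ y, ‖f y‖ ∂μ : ℝ) : ℂ)‖ ^ 2 ∂μ :=
    integral_nonneg fun x => by positivity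
  linarith

/-- Concentration of partial traces, in mean square. -/
lemma ptr_variance (hn : 0 < n) (hU : Uᴴ * U = 1) {z : ℂ} (hz : z.im ≠ 0) (α β : ℤˣ)
    (d : Fin n → ℂ) (a : ℝ) (ha : 0 ≤ a) (hd : ∀ k, ‖d k‖ ≤ a) :
    ∫ x, ‖ptr s v e U z α β d x - ∫ y, ptr s v e U z α β d y ∂(gaussians n)‖ ^ 2 ∂(gaussians n)
      ≤ fluct v z a n ^ 2 := by
  refine (variance_lipschitz_gaussians _ (continuous_ptr s v e U hz α β d) (a * |z.im|⁻¹)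
    (norm_ptr_le s v e U hn hz α β d a hd) (fun _ _ => fluct v z a n / n)
    (fun x j k t => ptr_lipschitz s v e U hU hz α β d a ha hd x j k t)).trans (le_of_eq ?_)
  have hn' : (n : ℝ) ≠ 0 := by positivity
  simp only [Finset.sum_const, Finset.card_univ, Fintype.card_fin, nsmul_eq_mul]
  field_simp

lemma ptr_concentration (hn : 0 < n) (hU : Uᴴ * U = 1) {z : ℂ} (hz : z.im ≠ 0) (α β : ℤˣ)
    (d : Fin n → ℂ) (a : ℝ) (ha : 0 ≤ a) (hd : ∀ k, ‖d k‖ ≤ a) :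
    ∫ x, ‖ptr s v e U z α β d x - ∫ y, ptr s v e U z α β d y ∂(gaussians n)‖ ∂(gaussians n)
      ≤ fluct v z a n := by
  have hc := continuous_ptr s v e U hz α β d
  refine (integral_norm_le_sqrt (gaussians n) (fun x => ptr s v e U z α β d x -
    ∫ y, ptr s v e U z α β d y ∂(gaussians n)) ?_).trans ?_
  · exact (MemLp.of_bound hc.aestronglyMeasurable _
      (.of_forall (norm_ptr_le s v e U hn hz α β d a hd))).sub (memLp_const _)
  · refine Real.sqrt_le_iff.2 ⟨by unfold fluct; positivity, ?_⟩
    exact ptr_variance s v e U hn hU hz α β d a ha hd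

/-- The sign change of the Gaussian array is implemented by `σ^z ⊗ 1`. -/
lemma GX_neg {z : ℂ} (hz : z.im ≠ 0) (x : Fin n → Fin n → ℝ) (p q : ℤˣ × Fin n) :
    GX s v e U z (-x) p q = sgn p.1 * sgn q.1 * GX s v e U z x p q := by
  set S : Matrix (ℤˣ × Fin n) (ℤˣ × Fin n) ℂ := diagonal fun p => sgn p.1 with hS
  have hsq : ∀ α : ℤˣ, sgn α * sgn α = 1 := by
    intro α
    rcases Int.units_eq_one_or α with rfl | rfl <;> simp [sgn]
  have hSS : S * S = 1 := by
    rw [hS, diagonal_mul_diagonal]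
    simp only [hsq, diagonal_one]
  have hH : ham s v e U (-x) = S * ham s v e U x * S := by
    ext p q
    rw [hS, mul_diagonal, diagonal_mul, ham_eq, ham_eq, rotGue_neg, map_neg]
    simp only [Matrix.add_apply, Matrix.neg_apply, coup_apply, diagonal_apply]
    by_cases hpq : p = q
    · subst hpq
      rw [if_pos rfl, if_neg (neg_unit_ne _).symm]
      linear_combination (-((e p.2 : ℂ) + sgn p.1 * s)) * hsq p.1
    · rw [if_neg hpq]
      split_ifs with h
      · have : sgn p.1 * sgn q.1 = -1 := by
          rw [h]
          have : sgn (-p.1) = -sgn p.1 := by simp [sgn]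
          rw [this, mul_neg, hsq]
        linear_combination (-(cpl v n * rotGue U x p.2 q.2)) * this
      · ring
  have hG : GX s v e U z (-x) = S * GX s v e U z x * S := by
    unfold GX green
    refine Matrix.inv_eq_right_inv ?_
    have h1 : ham s v e U (-x) - z • (1 : Matrix _ _ ℂ)
        = S * (ham s v e U x - z • (1 : Matrix _ _ ℂ)) * S := by
      rw [hH, Matrix.mul_sub, Matrix.sub_mul, Matrix.mul_smul, Matrix.smul_mul, Matrix.mul_one, hSS]
    rw [h1]
    have h2 := sub_mul_green (ham_isHermitian s v e U x) hz
    unfold green at h2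
    calc _ = S * (ham s v e U x - z • (1 : Matrix _ _ ℂ)) * (S * S) *
          (ham s v e U x - z • (1 : Matrix _ _ ℂ))⁻¹ * S := by simp only [Matrix.mul_assoc]
      _ = S * ((ham s v e U x - z • (1 : Matrix _ _ ℂ)) *
          (ham s v e U x - z • (1 : Matrix _ _ ℂ))⁻¹) * S := by
            rw [hSS, Matrix.mul_one]; simp only [Matrix.mul_assoc]
      _ = 1 := by rw [h2, Matrix.mul_one, hSS]
  rw [hG, hS, mul_diagonal, diagonal_mul]
  ring

/-- The Gaussian law is invariant under a sign change, which multiplies entries between different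
levels by `-1`; the mean therefore equals its own negative. -/
lemma integral_GX_off {z : ℂ} (hz : z.im ≠ 0) (α β : ℤˣ) (h : β ≠ α) (a b : Fin n) :
    ∫ x, GX s v e U z x (α, a) (β, b) ∂(gaussians n) = 0 := by
  have h1 := (measurePreserving_neg_gaussians n).integral_comp
    (MeasurableEquiv.neg _).measurableEmbedding (fun x => GX s v e U z x (α, a) (β, b))
  simp only [GX_neg s v e U hz] at h1
  rw [integral_const_mul] at h1
  have h2 : sgn α * sgn β = -1 := by
    rcases Int.units_eq_one_or α with rfl | rfl <;>
      rcases Int.units_eq_one_or β with rfl | rfl <;> simp_all [sgn]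
  rw [h2] at h1
  have h3 : (2 : ℂ) * ∫ x, GX s v e U z x (α, a) (β, b) ∂(gaussians n) = 0 := by
    linear_combination -h1
  simpa using h3

end Concentration
-- Signs of imaginary parts and bounds on the one-particle functions
lemma im_inv_ofReal_sub (x : ℝ) (z : ℂ) :
    (((x : ℂ) - z)⁻¹).im = z.im * (Complex.normSq ((x : ℂ) - z))⁻¹ := by
  rw [Complex.inv_im]; simp [div_eq_mul_inv]

lemma continuous_inv_ofReal_sub {z : ℂ} (hz : z.im ≠ 0) :
    Continuous fun x : ℝ => ((x : ℂ) - z)⁻¹ :=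
  (Complex.continuous_ofReal.sub continuous_const).inv₀ (ofReal_sub_ne_zero hz)

lemma integrable_inv_ofReal_sub (m : Measure ℝ) [IsFiniteMeasure m] {z : ℂ} (hz : z.im ≠ 0) :
    Integrable (fun x : ℝ => ((x : ℂ) - z)⁻¹) m :=
  integrable_of_bound (continuous_inv_ofReal_sub hz).aestronglyMeasurable _
    (norm_inv_ofReal_sub_le hz)

lemma complex_integral_im {X : Type*} [MeasurableSpace X] {μ : Measure X} {f : X → ℂ}
    (hf : Integrable f μ) : ∫ x, (f x).im ∂μ = (∫ x, f x ∂μ).im :=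
  integral_im hf

lemma stieltjes_im (m : Measure ℝ) [IsFiniteMeasure m] {z : ℂ} (hz : z.im ≠ 0) :
    (stieltjes m z).im = z.im * ∫ x, (Complex.normSq ((x : ℂ) - z))⁻¹ ∂m := by
  unfold stieltjes
  rw [← complex_integral_im (integrable_inv_ofReal_sub m hz), ← integral_const_mul]
  simp_rw [im_inv_ofReal_sub]

lemma stieltjes_im_mul_nonneg (m : Measure ℝ) [IsFiniteMeasure m] {z : ℂ} (hz : z.im ≠ 0) :
    0 ≤ (stieltjes m z).im * z.im := by
  rw [stieltjes_im m hz]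
  have : 0 ≤ ∫ x, (Complex.normSq ((x : ℂ) - z))⁻¹ ∂m :=
    integral_nonneg fun x => inv_nonneg.2 (Complex.normSq_nonneg _)
  nlinarith [mul_nonneg (mul_self_nonneg z.im) this]

lemma abs_im_le_abs_im_sub {z w : ℂ} (v : ℝ) (h : 0 ≤ w.im * z.im) :
    |z.im| ≤ |z.im + v ^ 2 * w.im| := by
  rw [← sq_le_sq]
  nlinarith [mul_nonneg (sq_nonneg v) h, sq_nonneg (v ^ 2 * w.im)]

lemma fE_denominator_im (s v E : ℝ) (α : ℤˣ) (z w : ℂ) :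
    ((E : ℂ) + sgn α * (s : ℂ) - z - (v : ℂ) ^ 2 * w).im = -(z.im + v ^ 2 * w.im) := by
  have h1 : (sgn α * (s : ℂ)).im = 0 := by simp [sgn]
  have h2 : ((v : ℂ) ^ 2 * w).im = v ^ 2 * w.im := by
    rw [← Complex.ofReal_pow, Complex.im_ofReal_mul]
  rw [Complex.sub_im, Complex.sub_im, Complex.add_im, h1, h2, Complex.ofReal_im]
  ring

/-- The self-energy pushes the denominator further from the real axis, since its imaginary part has
the sign of `Im z`. Only the weak inequality is assumed, because that is what survives in limits. -/
lemma abs_im_le_norm_denominator (s v E : ℝ) (α : ℤˣ) {z w : ℂ} (h : 0 ≤ w.im * z.im) :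
    |z.im| ≤ ‖(E : ℂ) + sgn α * (s : ℂ) - z - (v : ℂ) ^ 2 * w‖ := by
  refine (abs_im_le_abs_im_sub v h).trans ?_
  have := Complex.abs_im_le_norm ((E : ℂ) + sgn α * (s : ℂ) - z - (v : ℂ) ^ 2 * w)
  rwa [fE_denominator_im, abs_neg] at this

lemma fE_denominator_ne_zero (s v E : ℝ) (α : ℤˣ) {z w : ℂ} (hz : z.im ≠ 0)
    (h : 0 ≤ w.im * z.im) : (E : ℂ) + sgn α * (s : ℂ) - z - (v : ℂ) ^ 2 * w ≠ 0 :=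
  norm_pos_iff.1 ((abs_pos.2 hz).trans_le (abs_im_le_norm_denominator s v E α h))

lemma norm_fE_le (s v : ℝ) (f : ℤˣ → ℂ → ℂ) (α : ℤˣ) (E : ℝ) {z : ℂ} (hz : z.im ≠ 0)
    (h : 0 ≤ (f (-α) z).im * z.im) : ‖fE s v f α E z‖ ≤ |z.im|⁻¹ := by
  unfold fE
  rw [norm_inv]
  exact inv_anti₀ (abs_pos.2 hz) (abs_im_le_norm_denominator s v E α h)

/-! ### The Schwinger–Dyson equation -/

section Loop

open scoped Matrix.Norms.L2Operator

variable {n : ℕ} (s v : ℝ) (e : Fin n → ℝ) (U : Matrix (Fin n) (Fin n) ℂ)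

/-- The mean normalized partial trace of the resolvent. -/
noncomputable def gbar (α : ℤˣ) (z : ℂ) : ℂ := ∫ x, ptr s v e U z α α (fun _ => 1) x ∂(gaussians n)

/-- Holds for every realization, and is the source of the sign of `gbar`, of its Lipschitz bound and
of the approximating measures. -/
lemma ptr_spectral (hn : 0 < n) (α : ℤˣ) (x : Fin n → Fin n → ℝ) :
    ∃ m : Measure ℝ, IsProbabilityMeasure m ∧ ∀ z : ℂ, z.im ≠ 0 →
      stieltjes m z = ptr s v e U z α α (fun _ => 1) x := by
  have : NeZero n := ⟨hn.ne'⟩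
  obtain ⟨m, hm, h⟩ := exists_spectral_measure (ham_isHermitian s v e U x) Finset.univ
    ⟨0, Finset.mem_univ (0 : Fin n)⟩ (fun a => (α, a))
  refine ⟨m, hm, fun z hz => ?_⟩
  rw [h z hz]
  simp [ptr, GX]

lemma integrable_ptr (hn : 0 < n) {z : ℂ} (hz : z.im ≠ 0) (α β : ℤˣ) (d : Fin n → ℂ) (a : ℝ)
    (hd : ∀ k, ‖d k‖ ≤ a) : Integrable (ptr s v e U z α β d) (gaussians n) :=
  integrable_of_bound (continuous_ptr s v e U hz α β d).aestronglyMeasurable _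
    (norm_ptr_le s v e U hn hz α β d a hd)

lemma gbar_im_mul_nonneg (hn : 0 < n) (α : ℤˣ) {z : ℂ} (hz : z.im ≠ 0) :
    0 ≤ (gbar s v e U α z).im * z.im := by
  unfold gbar
  rw [← complex_integral_im (integrable_ptr s v e U hn hz α α (fun _ => 1) 1 (by simp)),
    ← integral_mul_const]
  refine integral_nonneg fun x => ?_
  obtain ⟨m, hm, h⟩ := ptr_spectral s v e U hn α x
  simp only [Pi.zero_apply, ← h z hz]
  exact stieltjes_im_mul_nonneg m hz

lemma norm_gbar_le (hn : 0 < n) (α : ℤˣ) {z : ℂ} (hz : z.im ≠ 0) :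
    ‖gbar s v e U α z‖ ≤ |z.im|⁻¹ := by
  unfold gbar
  refine (norm_integral_le_integral_norm _).trans ?_
  calc _ ≤ ∫ _x, |z.im|⁻¹ ∂(gaussians n) := by
        refine integral_mono_of_nonneg (.of_forall fun x => norm_nonneg _) (integrable_const _)
          (.of_forall fun x => ?_)
        simpa using norm_ptr_le s v e U hn hz α α (fun _ => 1) 1 (by simp) x
    _ = _ := by simp

/-- A coupling along a matrix unit changes the reservoir state from `b` to `a` and flips the level,
which leaves a sum over the two levels alone. -/
lemma sandwich_single (A B : Matrix (ℤˣ × Fin n) (ℤˣ × Fin n) ℂ) (p q : ℤˣ × Fin n)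
    (b a : Fin n) : sandwich v A B p q (Matrix.single b a 1)
      = cpl v n * ∑ ε, A p (ε, b) * B (-ε, a) q := by
  simp only [sandwich, LinearMap.coe_mk, AddHom.coe_mk]
  rw [Matrix.mul_assoc, Matrix.mul_apply, Fintype.sum_prod_type, Finset.mul_sum]
  refine Finset.sum_congr rfl fun ε _ => ?_
  have h1 : ∀ b', (coup v (Matrix.single b a (1 : ℂ)) * B) (ε, b') q
      = if b = b' then cpl v n * B (-ε, a) q else 0 := by
    intro b'
    rw [Matrix.mul_apply, Fintype.sum_prod_type, Finset.sum_eq_single (-ε),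
      Finset.sum_eq_single a]
    · rw [coup_apply, if_pos rfl, Matrix.single_apply]
      by_cases hb : b = b' <;> simp [hb]
    · intro c _ hc
      rw [coup_apply, Matrix.single_apply, if_neg (c := b = _ ∧ a = _) (fun h => hc h.2.symm)]
      simp
    · exact fun h => absurd (Finset.mem_univ _) h
    · intro ε' _ hε'
      refine Finset.sum_eq_zero fun c _ => ?_
      rw [coup_apply, if_neg hε', zero_mul]
    · exact fun h => absurd (Finset.mem_univ _) h
  simp only [h1, mul_ite, mul_zero, Finset.sum_ite_eq, Finset.mem_univ, if_true]
  ring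

/-- One row of `(H - z) G = 1`. The random matrix appears linearly, ready for integration by parts.
-/
lemma row_equation {z : ℂ} (hz : z.im ≠ 0) (x : Fin n → Fin n → ℝ) (α : ℤˣ) (a : Fin n)
    (q : ℤˣ × Fin n) :
    ((e a : ℂ) + sgn α * s - z) * GX s v e U z x (α, a) q
      = (if (α, a) = q then 1 else 0)
        - cpl v n * ∑ b, rotGue U x a b * GX s v e U z x (-α, b) q := by
  have h1 := congrFun (congrFun (sub_mul_green (ham_isHermitian s v e U x) hz) (α, a)) q
  rw [Matrix.sub_mul, Matrix.sub_apply, Matrix.smul_mul, Matrix.one_mul, Matrix.smul_apply,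
    ham_eq, Matrix.add_mul, Matrix.add_apply, diagonal_mul, Matrix.one_apply, smul_eq_mul] at h1
  have h2 : (coup v (rotGue U x) * green (diagonal (fun p : ℤˣ × Fin n => (e p.2 : ℂ) + sgn p.1 * s)
      + coup v (rotGue U x)) z) (α, a) q
      = cpl v n * ∑ b, rotGue U x a b * GX s v e U z x (-α, b) q := by
    rw [← ham_eq, Matrix.mul_apply, Fintype.sum_prod_type, Finset.sum_eq_single (-α),
      Finset.mul_sum]
    · refine Finset.sum_congr rfl fun b _ => ?_
      rw [coup_apply, if_pos rfl, mul_assoc]; rfl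
    · intro ε _ hε
      refine Finset.sum_eq_zero fun c _ => ?_
      rw [coup_apply, if_neg hε, zero_mul]
    · exact fun h => absurd (Finset.mem_univ _) h
  rw [h2, ← ham_eq] at h1
  unfold GX at *
  linear_combination h1

lemma GueSmooth.integrable {U : Matrix (Fin n) (Fin n) ℂ} {f : (Fin n → Fin n → ℝ) → ℂ}
    {D : (Fin n → Fin n → ℝ) → Matrix (Fin n) (Fin n) ℂ →ₗ[ℂ] ℂ} (hf : GueSmooth U f D) :
    Integrable f (gaussians n) := by
  obtain ⟨C, hC⟩ := hf.bdd
  exact integrable_of_bound hf.cont.aestronglyMeasurable C hC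

lemma GueSmooth.integrable_deriv {U : Matrix (Fin n) (Fin n) ℂ} {f : (Fin n → Fin n → ℝ) → ℂ}
    {D : (Fin n → Fin n → ℝ) → Matrix (Fin n) (Fin n) ℂ →ₗ[ℂ] ℂ} (hf : GueSmooth U f D)
    (K : Matrix (Fin n) (Fin n) ℂ) : Integrable (fun x => D x K) (gaussians n) := by
  obtain ⟨C, hC⟩ := hf.dbdd K
  exact integrable_of_bound (hf.dcont K).aestronglyMeasurable C hC

lemma integrable_rotGue_mul (hU : Uᴴ * U = 1) (a b : Fin n) {f : (Fin n → Fin n → ℝ) → ℂ}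
    (hf : Continuous f) (hb : ∃ C, ∀ x, ‖f x‖ ≤ C) :
    Integrable (fun x => rotGue U x a b * f x) (gaussians n) := by
  obtain ⟨C, hC⟩ := hb
  have hc : Continuous fun x => rotGue U x a b := (continuous_rotGue U).matrix_elem a b
  have h1 : Integrable (fun x => rotGue U x a b) (gaussians n) := by
    refine MemLp.integrable (q := 2) (by norm_num) ?_
    rw [memLp_two_iff_integrable_sq_norm hc.aestronglyMeasurable]
    exact (integral_norm_sq_rotGue U hU a b).1
  exact h1.mul_bdd hf.aestronglyMeasurable (.of_forall hC)

/-- The Schwinger–Dyson equation for a row of the resolvent. -/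
lemma schwinger_dyson (hn : 0 < n) (hU : Uᴴ * U = 1) {z : ℂ} (hz : z.im ≠ 0) (α : ℤˣ) (a : Fin n)
    (q : ℤˣ × Fin n) {φ : (Fin n → Fin n → ℝ) → ℂ}
    {D : (Fin n → Fin n → ℝ) → Matrix (Fin n) (Fin n) ℂ →ₗ[ℂ] ℂ} (hφ : GueSmooth U φ D) :
    ((e a : ℂ) + sgn α * s - z) * ∫ x, GX s v e U z x (α, a) q * φ x ∂(gaussians n)
      = (if (α, a) = q then 1 else 0) * ∫ x, φ x ∂(gaussians n)
        + (v : ℂ) ^ 2 * ∫ x, (ptr s v e U z (-α) (-α) (fun _ => 1) x * GX s v e U z x (α, a) q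
          + ptr s v e U z (-α) α (fun _ => 1) x * GX s v e U z x (-α, a) q) * φ x ∂(gaussians n)
        - cpl v n * ∑ b, ∫ x, GX s v e U z x (-α, b) q * D x (Matrix.single b a 1)
          ∂(gaussians n) := by
  have hsm : ∀ p, GueSmooth U (fun x => GX s v e U z x p q * φ x) _ := fun p =>
    (gueSmooth_GX s v e U hz p q).mul hφ
  have hG : ∀ p q : ℤˣ × Fin n, ∃ C, ∀ x, ‖GX s v e U z x p q‖ ≤ C := fun p q =>
    (gueSmooth_GX s v e U hz p q).bdd
  have hmul : ∀ {f g : (Fin n → Fin n → ℝ) → ℂ}, Continuous f → (∃ C, ∀ x, ‖f x‖ ≤ C) →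
      Integrable g (gaussians n) → Integrable (fun x => f x * g x) (gaussians n) :=
    fun hf ⟨C, hC⟩ hg => hg.bdd_mul hf.aestronglyMeasurable (.of_forall hC)
  -- The derivative falls either on the resolvent, producing a product of two of its entries, or on
  -- the test function `φ`.
  have hibp : ∀ b, ∫ x, rotGue U x a b * (GX s v e U z x (-α, b) q * φ x) ∂(gaussians n)
      = -(cpl v n * ∫ x, (∑ ε, GX s v e U z x (-α, b) (ε, b) * GX s v e U z x (-ε, a) q) * φ x
          ∂(gaussians n))
        + ∫ x, GX s v e U z x (-α, b) q * D x (Matrix.single b a 1) ∂(gaussians n) := by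
    intro b
    obtain ⟨C, hC⟩ := (hsm (-α, b)).bdd
    rw [gue_integration_by_parts U hU a b _ _ (hsm (-α, b)).cont (hsm (-α, b)).dcont C hC
      (hsm (-α, b)).dbdd (hsm (-α, b)).deriv]
    simp only [LinearMap.add_apply, LinearMap.smul_apply, LinearMap.neg_apply, smul_eq_mul,
      sandwich_single]
    rw [integral_add, ← integral_const_mul, ← integral_neg]
    · congr 2
      ext x; ring
    · have h1 := hmul hφ.cont hφ.bdd
        ((gueSmooth_GX s v e U hz (-α, b) q).integrable_deriv (Matrix.single b a 1))
      simpa only [LinearMap.neg_apply, sandwich_single] using h1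
    · exact hmul (continuous_GX_apply s v e U hz _ _) (hG _ _) (hφ.integrable_deriv _)
  have hrow : ((e a : ℂ) + sgn α * s - z) * ∫ x, GX s v e U z x (α, a) q * φ x ∂(gaussians n)
      = (if (α, a) = q then 1 else 0) * ∫ x, φ x ∂(gaussians n)
        - cpl v n * ∑ b, ∫ x, rotGue U x a b * (GX s v e U z x (-α, b) q * φ x) ∂(gaussians n) := by
    have hint : ∀ b, Integrable (fun x => rotGue U x a b * (GX s v e U z x (-α, b) q * φ x))
        (gaussians n) := fun b =>
      integrable_rotGue_mul U hU a b (hsm (-α, b)).cont (hsm (-α, b)).bdd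
    rw [← integral_const_mul, ← integral_const_mul, ← integral_finsetSum _ fun b _ => hint b,
      ← integral_const_mul, ← integral_sub (hφ.integrable.const_mul _)
        ((integrable_finsetSum _ fun b _ => hint b).const_mul _)]
    refine integral_congr_ae (.of_forall fun x => ?_)
    simp only
    rw [← mul_assoc, row_equation s v e U hz x α a q, sub_mul, mul_assoc, Finset.sum_mul]
    simp only [mul_assoc]
  rw [hrow]
  simp only [hibp]
  -- Since the squared coupling times `n` is `v²`, the sum over `b` is `v²` times the normalized
  -- partial traces: the diagonal one from `ε = -α`, the off-diagonal one from `ε = α`.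
  have hsum : (v : ℂ) ^ 2 * ∫ x, (ptr s v e U z (-α) (-α) (fun _ => 1) x * GX s v e U z x (α, a) q
          + ptr s v e U z (-α) α (fun _ => 1) x * GX s v e U z x (-α, a) q) * φ x ∂(gaussians n)
      = cpl v n * cpl v n * ∑ b, ∫ x, (∑ ε, GX s v e U z x (-α, b) (ε, b) *
          GX s v e U z x (-ε, a) q) * φ x ∂(gaussians n) := by
    rw [← integral_finsetSum, ← cpl_sq v hn, mul_assoc, ← integral_const_mul]
    · congr 2
      ext x
      rw [← Finset.sum_mul, ← mul_assoc]
      congr 1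
      simp only [ptr, one_mul, sum_units α, neg_neg, Finset.sum_add_distrib, ← Finset.sum_mul]
      have : (n : ℂ) ≠ 0 := by exact_mod_cast hn.ne'
      field_simp
    · intro b _
      have hbdd : ∃ C, ∀ x, ‖∑ ε, GX s v e U z x (-α, b) (ε, b) * GX s v e U z x (-ε, a) q‖ ≤ C := by
        refine ⟨∑ _ε : ℤˣ, |z.im|⁻¹ * |z.im|⁻¹, fun x => (norm_sum_le _ _).trans
          (Finset.sum_le_sum fun ε _ => ?_)⟩
        rw [norm_mul]
        exact mul_le_mul (norm_GX_apply_le s v e U hz x _ _) (norm_GX_apply_le s v e U hz x _ _)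
          (norm_nonneg _) (by positivity)
      exact hmul (continuous_finsetSum _ fun ε _ => (continuous_GX_apply s v e U hz _ _).mul
        (continuous_GX_apply s v e U hz _ _)) hbdd hφ.integrable
  rw [hsum, Finset.sum_add_distrib, Finset.sum_neg_distrib, ← Finset.mul_sum]
  ring

end Loop

/-! ### Approximate equations for the means of one and two resolvents -/

section TwoPoint

open scoped Matrix.Norms.L2Operator

variable {n : ℕ} (s v : ℝ) (e : Fin n → ℝ) (U : Matrix (Fin n) (Fin n) ℂ)

lemma integral_ptr_off {z : ℂ} (hz : z.im ≠ 0) (α β : ℤˣ) (h : β ≠ α) (d : Fin n → ℂ) :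
    ∫ x, ptr s v e U z α β d x ∂(gaussians n) = 0 := by
  unfold ptr
  rw [integral_const_mul, integral_finsetSum]
  · simp only [integral_const_mul, integral_GX_off s v e U hz α β h, mul_zero,
      Finset.sum_const_zero]
  · exact fun k _ => ((gueSmooth_GX s v e U hz _ _).integrable).const_mul _

/-- Concentration in `L¹` against a bounded factor is enough to decouple the partial trace; no
covariance has to be computed. -/
lemma covariance_ptr_le (hn : 0 < n) (hU : Uᴴ * U = 1) {z : ℂ} (hz : z.im ≠ 0) (α β : ℤˣ)
    (d : Fin n → ℂ) (a : ℝ) (ha : 0 ≤ a) (hd : ∀ k, ‖d k‖ ≤ a) {Y : (Fin n → Fin n → ℝ) → ℂ} (C : ℝ)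
    (hC : ∀ x, ‖Y x‖ ≤ C) :
    ‖∫ x, (ptr s v e U z α β d x - ∫ y, ptr s v e U z α β d y ∂(gaussians n)) * Y x
      ∂(gaussians n)‖ ≤ C * fluct v z a n := by
  have hC0 : 0 ≤ C := (norm_nonneg _).trans (hC 0)
  refine (norm_integral_le_integral_norm _).trans ?_
  refine le_trans ?_ (mul_le_mul_of_nonneg_left
    (ptr_concentration s v e U hn hU hz α β d a ha hd) hC0)
  rw [← integral_const_mul]
  refine integral_mono_of_nonneg (.of_forall fun x => norm_nonneg _) ?_ (.of_forall fun x => ?_)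
  · exact (((integrable_ptr s v e U hn hz α β d a hd).sub (integrable_const _)).norm).const_mul _
  · simp only
    rw [norm_mul, mul_comm]
    exact mul_le_mul_of_nonneg_right (hC x) (norm_nonneg _)

lemma integrable_ptr_mul (hn : 0 < n) {z : ℂ}
    (hz : z.im ≠ 0) (α β : ℤˣ)
    (d : Fin n → ℂ) (a : ℝ) (hd : ∀ k, ‖d k‖ ≤ a) {Y : (Fin n → Fin n → ℝ) → ℂ}
    (hY : Continuous Y) (C : ℝ) (hC : ∀ x, ‖Y x‖ ≤ C) :
    Integrable (fun x => ptr s v e U z α β d x * Y x) (gaussians n) :=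
  (integrable_ptr s v e U hn hz α β d a hd).mul_bdd hY.aestronglyMeasurable (.of_forall hC)

/-- The Schwinger–Dyson equation with the mean of the partial trace moved to the left. -/
lemma schwinger_dyson_centred (hn : 0 < n) (hU : Uᴴ * U = 1) {z : ℂ} (hz : z.im ≠ 0) (α : ℤˣ)
    (a : Fin n) (q : ℤˣ × Fin n) {φ : (Fin n → Fin n → ℝ) → ℂ}
    {D : (Fin n → Fin n → ℝ) → Matrix (Fin n) (Fin n) ℂ →ₗ[ℂ] ℂ} (hφ : GueSmooth U φ D) :
    ∫ x, GX s v e U z x (α, a) q * φ x ∂(gaussians n)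
      = fE s v (gbar s v e U) α (e a) z * ((if (α, a) = q then 1 else 0) * ∫ x, φ x ∂(gaussians n)
        + (v : ℂ) ^ 2 * ∫ x, (ptr s v e U z (-α) (-α) (fun _ => 1) x - gbar s v e U (-α) z)
            * (GX s v e U z x (α, a) q * φ x) ∂(gaussians n)
        + (v : ℂ) ^ 2 * ∫ x, ptr s v e U z (-α) α (fun _ => 1) x
            * (GX s v e U z x (-α, a) q * φ x) ∂(gaussians n)
        - cpl v n * ∑ b, ∫ x, GX s v e U z x (-α, b) q * D x (Matrix.single b a 1)
          ∂(gaussians n)) := by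
  have h1 := schwinger_dyson s v e U hn hU hz α a q hφ
  have hne := fE_denominator_ne_zero s v (e a) α hz (gbar_im_mul_nonneg s v e U hn (-α) hz)
  have hG : ∀ p, Continuous fun x => GX s v e U z x p q * φ x := fun p =>
    (continuous_GX_apply s v e U hz _ _).mul hφ.cont
  have hGi : ∀ p, ∃ C, ∀ x, ‖GX s v e U z x p q * φ x‖ ≤ C := fun p =>
    ((gueSmooth_GX s v e U hz p q).mul hφ).bdd
  have hpi : ∀ α β p, Integrable (fun x => ptr s v e U z α β (fun _ => 1) x *
      (GX s v e U z x p q * φ x)) (gaussians n) := fun α β p => by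
    obtain ⟨C, hC⟩ := hGi p
    exact integrable_ptr_mul s v e U hn hz α β _ 1 (by simp) (hG p) C hC
  have hgi : Integrable (fun x => GX s v e U z x (α, a) q * φ x) (gaussians n) :=
    ((gueSmooth_GX s v e U hz _ q).mul hφ).integrable
  have h2 : ∫ x, (ptr s v e U z (-α) (-α) (fun _ => 1) x * GX s v e U z x (α, a) q
          + ptr s v e U z (-α) α (fun _ => 1) x * GX s v e U z x (-α, a) q) * φ x ∂(gaussians n)
      = ∫ x, (ptr s v e U z (-α) (-α) (fun _ => 1) x - gbar s v e U (-α) z)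
            * (GX s v e U z x (α, a) q * φ x) ∂(gaussians n)
        + gbar s v e U (-α) z * ∫ x, GX s v e U z x (α, a) q * φ x ∂(gaussians n)
        + ∫ x, ptr s v e U z (-α) α (fun _ => 1) x
            * (GX s v e U z x (-α, a) q * φ x) ∂(gaussians n) := by
    simp only [sub_mul]
    rw [integral_sub (hpi _ _ _) (hgi.const_mul _), integral_const_mul, sub_add_cancel,
      ← integral_add (hpi _ _ _) (hpi _ _ _)]
    congr 1
    ext x; ring
  rw [h2] at h1
  unfold fE
  rw [eq_inv_mul_iff_mul_eq₀ hne]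
  linear_combination h1

/-- The error in the one-point equation. -/
noncomputable def onePointError (v : ℝ) (z : ℂ) (n : ℕ) : ℝ :=
  |z.im|⁻¹ * (2 * (v ^ 2 * (|z.im|⁻¹ * fluct v z 1 n)))

/-- With a constant test function the derivative term disappears. The two remaining corrections
contain a centred partial trace and one whose mean vanishes by the sign symmetry. -/
lemma one_point (hn : 0 < n) (hU : Uᴴ * U = 1) {z : ℂ} (hz : z.im ≠ 0) (α : ℤˣ) (a : Fin n) :
    ‖∫ x, GX s v e U z x (α, a) (α, a) ∂(gaussians n) - fE s v (gbar s v e U) α (e a) z‖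
      ≤ onePointError v z n := by
  have h1 := schwinger_dyson_centred s v e U hn hU hz α a (α, a) (gueSmooth_const U 1)
  simp only [mul_one, if_true, LinearMap.zero_apply, mul_zero, integral_zero,
    Finset.sum_const_zero, sub_zero, integral_const, probReal_univ, one_smul] at h1
  rw [h1]
  have hd := norm_fE_le s v (gbar s v e U) α (e a) hz (gbar_im_mul_nonneg s v e U hn (-α) hz)
  have e1 := covariance_ptr_le s v e U hn hU hz (-α) (-α) (fun _ => 1) 1 zero_le_one (by simp)
    _
    (fun x => norm_GX_apply_le s v e U hz x (α, a) (α, a))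
  have e2 := covariance_ptr_le s v e U hn hU hz (-α) α (fun _ => 1) 1 zero_le_one (by simp)
    _
    (fun x => norm_GX_apply_le s v e U hz x (-α, a) (α, a))
  rw [integral_ptr_off s v e U hz _ _ (by simp)] at e2
  simp only [sub_zero] at e2
  have hv : ‖(v : ℂ) ^ 2‖ = v ^ 2 := by
    rw [norm_pow, Complex.norm_real, Real.norm_eq_abs, sq_abs]
  set I1 := ∫ x, (ptr s v e U z (-α) (-α) (fun _ => 1) x - gbar s v e U (-α) z)
            * (GX s v e U z x (α, a) (α, a)) ∂(gaussians n)
  set I2 := ∫ x, ptr s v e U z (-α) α (fun _ => 1) x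
            * (GX s v e U z x (-α, a) (α, a)) ∂(gaussians n)
  have e1' : ‖I1‖ ≤ |z.im|⁻¹ * fluct v z 1 n := e1
  calc _ = ‖fE s v (gbar s v e U) α (e a) z * ((v : ℂ) ^ 2 * I1 + (v : ℂ) ^ 2 * I2)‖ := by
        congr 1; ring
    _ ≤ _ := by
        rw [norm_mul]
        unfold onePointError
        refine mul_le_mul hd ?_ (norm_nonneg _) (by positivity)
        refine (norm_add_le _ _).trans ?_
        rw [norm_mul, norm_mul, hv]
        linarith [mul_le_mul_of_nonneg_left e1' (sq_nonneg v),
          mul_le_mul_of_nonneg_left e2 (sq_nonneg v)]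

/-- The mean one-point function almost solves the self-consistent equation. -/
lemma gbar_equation (hn : 0 < n) (hU : Uᴴ * U = 1) {z : ℂ} (hz : z.im ≠ 0) (α : ℤˣ) :
    ‖gbar s v e U α z - (n : ℂ)⁻¹ * ∑ a, fE s v (gbar s v e U) α (e a) z‖
      ≤ onePointError v z n := by
  have h1 : gbar s v e U α z = (n : ℂ)⁻¹ * ∑ a, ∫ x, GX s v e U z x (α, a) (α, a) ∂(gaussians n) := by
    unfold gbar ptr
    rw [integral_const_mul, integral_finsetSum]
    · simp
    · exact fun k _ => ((gueSmooth_GX s v e U hz _ _).integrable).const_mul _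
  have hn' : (n : ℝ) ≠ 0 := by positivity
  rw [h1, ← mul_sub, ← Finset.sum_sub_distrib, norm_mul, norm_inv, Complex.norm_natCast]
  calc _ ≤ (n : ℝ)⁻¹ * ∑ _a : Fin n, onePointError v z n := by
        gcongr
        exact (norm_sum_le _ _).trans (Finset.sum_le_sum fun a _ => one_point s v e U hn hU hz α a)
    _ = _ := by
        rw [Finset.sum_const, Finset.card_univ, Fintype.card_fin, nsmul_eq_mul]
        field_simp

/-- The two-resolvent function `Σ_a d_a G¹_{αa,p} G²_{q,δa}`. -/
noncomputable def twoGreen (z₁ z₂ : ℂ) (α δ : ℤˣ) (d : Fin n → ℂ) (q p : ℤˣ × Fin n)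
    (x : Fin n → Fin n → ℝ) : ℂ :=
  (GX s v e U z₂ x * pairing α δ d * GX s v e U z₁ x) q p

lemma twoGreen_eq (z₁ z₂ : ℂ) (α δ : ℤˣ) (d : Fin n → ℂ) (q p : ℤˣ × Fin n)
    (x : Fin n → Fin n → ℝ) : twoGreen s v e U z₁ z₂ α δ d q p x
      = ∑ a, d a * (GX s v e U z₁ x (α, a) p * GX s v e U z₂ x q (δ, a)) :=
  mul_pairing_mul_apply _ _ _ _ _ _ _

lemma continuous_twoGreen {z₁ z₂ : ℂ} (h₁ : z₁.im ≠ 0) (h₂ : z₂.im ≠ 0) (α δ : ℤˣ)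
    (d : Fin n → ℂ) (q p : ℤˣ × Fin n) : Continuous (twoGreen s v e U z₁ z₂ α δ d q p) :=
  (((continuous_GX s v e U h₂).matrix_mul continuous_const).matrix_mul
    (continuous_GX s v e U h₁)).matrix_elem q p

lemma norm_twoGreen_le {z₁ z₂ : ℂ} (h₁ : z₁.im ≠ 0) (h₂ : z₂.im ≠ 0) (α δ : ℤˣ)
    (d : Fin n → ℂ) (a : ℝ) (ha : 0 ≤ a) (hd : ∀ k, ‖d k‖ ≤ a) (q p : ℤˣ × Fin n)
    (x : Fin n → Fin n → ℝ) :
    ‖twoGreen s v e U z₁ z₂ α δ d q p x‖ ≤ |z₂.im|⁻¹ * a * |z₁.im|⁻¹ := by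
  refine (norm_entry_le _ q p).trans ((l2_opNorm_mul _ _).trans ?_)
  gcongr
  · refine (l2_opNorm_mul _ _).trans ?_
    gcongr
    · exact norm_GX_le s v e U h₂ x
    · exact norm_pairing_le α δ d a ha hd
  · exact norm_GX_le s v e U h₁ x

lemma integrable_twoGreen {z₁ z₂ : ℂ} (h₁ : z₁.im ≠ 0) (h₂ : z₂.im ≠ 0) (α δ : ℤˣ)
    (d : Fin n → ℂ) (a : ℝ) (ha : 0 ≤ a) (hd : ∀ k, ‖d k‖ ≤ a) (q p : ℤˣ × Fin n) :
    Integrable (twoGreen s v e U z₁ z₂ α δ d q p) (gaussians n) :=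
  integrable_of_bound (continuous_twoGreen s v e U h₁ h₂ α δ d q p).aestronglyMeasurable _
    (norm_twoGreen_le s v e U h₁ h₂ α δ d a ha hd q p)

/-- The exact equation for the two-resolvent function. -/
lemma two_point_identity (hn : 0 < n) (hU : Uᴴ * U = 1) {z₁ z₂ : ℂ} (h₁ : z₁.im ≠ 0)
    (h₂ : z₂.im ≠ 0) (α δ : ℤˣ) (q p : ℤˣ × Fin n) (d : Fin n → ℂ)
    (hd : d = fun a => fE s v (gbar s v e U) α (e a) z₁) :
    ∫ x, twoGreen s v e U z₁ z₂ α δ (fun _ => 1) q p x ∂(gaussians n)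
      = (if α = p.1 then d p.2 * ∫ x, GX s v e U z₂ x q (δ, p.2) ∂(gaussians n) else 0)
        + (v : ℂ) ^ 2 * ∫ x, (ptr s v e U z₁ (-α) (-α) (fun _ => 1) x - gbar s v e U (-α) z₁)
            * twoGreen s v e U z₁ z₂ α δ d q p x ∂(gaussians n)
        + (v : ℂ) ^ 2 * ∫ x, ptr s v e U z₁ (-α) α (fun _ => 1) x
            * twoGreen s v e U z₁ z₂ (-α) δ d q p x ∂(gaussians n)
        + (v : ℂ) ^ 2 * ∑ ε, ∫ x, ptr s v e U z₂ (-ε) δ d x *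
            twoGreen s v e U z₁ z₂ (-α) ε (fun _ => 1) q p x ∂(gaussians n) := by
  -- The test function is an entry of the second resolvent. Differentiating it splits that resolvent
  -- in two, and the sum over intermediate states re-forms a two-resolvent function at the flipped
  -- level.
  have hsd := fun a => schwinger_dyson_centred s v e U hn hU h₁ α a p (gueSmooth_GX s v e U h₂ q (δ, a))
  have hGG : ∀ p' q', Integrable (fun x => GX s v e U z₁ x p' p * GX s v e U z₂ x q q')
      (gaussians n) := fun p' q' =>
    ((gueSmooth_GX s v e U h₁ p' p).mul (gueSmooth_GX s v e U h₂ q q')).integrable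
  have hGGc : ∀ p' q', Continuous fun x => GX s v e U z₁ x p' p * GX s v e U z₂ x q q' :=
    fun p' q' => (continuous_GX_apply s v e U h₁ _ _).mul (continuous_GX_apply s v e U h₂ _ _)
  have hGGb : ∀ p' q', ∃ C, ∀ x, ‖GX s v e U z₁ x p' p * GX s v e U z₂ x q q'‖ ≤ C := fun p' q' =>
    ((gueSmooth_GX s v e U h₁ p' p).mul (gueSmooth_GX s v e U h₂ q q')).bdd
  have hP : ∀ β γ p' q', Integrable (fun x => ptr s v e U z₁ β γ (fun _ => 1) x *
      (GX s v e U z₁ x p' p * GX s v e U z₂ x q q')) (gaussians n) := fun β γ p' q' => by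
    obtain ⟨C, hC⟩ := hGGb p' q'
    exact integrable_ptr_mul s v e U hn h₁ β γ _ 1 (by simp) (hGGc p' q') C hC
  -- the derivative term
  have hD : ∀ a, -(cpl v n * ∑ b, ∫ x, GX s v e U z₁ x (-α, b) p *
        (-sandwich v (GX s v e U z₂ x) (GX s v e U z₂ x) q (δ, a)) (Matrix.single b a 1)
          ∂(gaussians n))
      = cpl v n * cpl v n * ∑ ε, ∫ x, GX s v e U z₂ x (-ε, a) (δ, a) *
          twoGreen s v e U z₁ z₂ (-α) ε (fun _ => 1) q p x ∂(gaussians n) := by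
    intro a
    have hI : ∀ b, Integrable (fun x => GX s v e U z₁ x (-α, b) p *
        (-sandwich v (GX s v e U z₂ x) (GX s v e U z₂ x) q (δ, a)) (Matrix.single b a 1))
          (gaussians n) := fun b =>
      ((gueSmooth_GX s v e U h₂ q (δ, a)).integrable_deriv (Matrix.single b a 1)).bdd_mul
        (continuous_GX_apply s v e U h₁ _ _).aestronglyMeasurable
        (.of_forall fun x => norm_GX_apply_le s v e U h₁ x _ _)
    have hI2 : ∀ ε, Integrable (fun x => GX s v e U z₂ x (-ε, a) (δ, a) *
          twoGreen s v e U z₁ z₂ (-α) ε (fun _ => 1) q p x) (gaussians n) := fun ε =>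
      (integrable_twoGreen s v e U h₁ h₂ (-α) ε (fun _ => 1) 1 zero_le_one (by simp) q p).bdd_mul
        (continuous_GX_apply s v e U h₂ _ _).aestronglyMeasurable
        (.of_forall fun x => norm_GX_apply_le s v e U h₂ x _ _)
    rw [← integral_finsetSum _ fun b _ => hI b, ← integral_finsetSum _ fun ε _ => hI2 ε,
      mul_assoc, ← mul_neg, ← integral_neg, ← integral_const_mul (cpl v n) (fun x => ∑ ε : ℤˣ, _)]
    congr 2
    ext x
    simp only [LinearMap.neg_apply, sandwich_single, twoGreen_eq, one_mul, mul_neg,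
      Finset.sum_neg_distrib, neg_neg, Finset.mul_sum]
    rw [Finset.sum_comm]
    refine Finset.sum_congr rfl fun ε _ => Finset.sum_congr rfl fun b _ => ?_
    ring
  -- sum over `a`
  have hL : ∫ x, twoGreen s v e U z₁ z₂ α δ (fun _ => 1) q p x ∂(gaussians n)
      = ∑ a, ∫ x, GX s v e U z₁ x (α, a) p * GX s v e U z₂ x q (δ, a) ∂(gaussians n) := by
    simp only [twoGreen_eq, one_mul]
    exact integral_finsetSum _ fun a _ => hGG _ _
  have hA : ∫ x, (ptr s v e U z₁ (-α) (-α) (fun _ => 1) x - gbar s v e U (-α) z₁)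
            * twoGreen s v e U z₁ z₂ α δ d q p x ∂(gaussians n)
      = ∑ a, d a * ∫ x, (ptr s v e U z₁ (-α) (-α) (fun _ => 1) x - gbar s v e U (-α) z₁)
            * (GX s v e U z₁ x (α, a) p * GX s v e U z₂ x q (δ, a)) ∂(gaussians n) := by
    simp only [← integral_const_mul]
    rw [← integral_finsetSum]
    · congr 1
      ext x
      rw [twoGreen_eq, Finset.mul_sum]
      refine Finset.sum_congr rfl fun a _ => ?_
      ring
    · intro a _
      simp only [sub_mul]
      exact ((hP _ _ _ _).sub ((hGG _ _).const_mul _)).const_mul _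
  have hB : ∫ x, ptr s v e U z₁ (-α) α (fun _ => 1) x
            * twoGreen s v e U z₁ z₂ (-α) δ d q p x ∂(gaussians n)
      = ∑ a, d a * ∫ x, ptr s v e U z₁ (-α) α (fun _ => 1) x
            * (GX s v e U z₁ x (-α, a) p * GX s v e U z₂ x q (δ, a)) ∂(gaussians n) := by
    simp only [← integral_const_mul]
    rw [← integral_finsetSum]
    · congr 1
      ext x
      rw [twoGreen_eq, Finset.mul_sum]
      refine Finset.sum_congr rfl fun a _ => ?_
      ring
    · exact fun a _ => (hP _ _ _ _).const_mul _
  have hC : ∀ ε, (v : ℂ) ^ 2 * ∫ x, ptr s v e U z₂ (-ε) δ d x *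
            twoGreen s v e U z₁ z₂ (-α) ε (fun _ => 1) q p x ∂(gaussians n)
      = ∑ a, d a * (cpl v n * cpl v n * ∫ x, GX s v e U z₂ x (-ε, a) (δ, a) *
          twoGreen s v e U z₁ z₂ (-α) ε (fun _ => 1) q p x ∂(gaussians n)) := by
    intro ε
    simp only [← integral_const_mul]
    rw [← integral_finsetSum]
    · congr 1
      ext x
      rw [← cpl_sq v hn, ptr]
      have hn0 : (n : ℂ) ≠ 0 := by exact_mod_cast hn.ne'
      rw [show ∀ A S T : ℂ, A * n * ((n : ℂ)⁻¹ * S * T) = S * (A * T) by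
        intros; field_simp, Finset.sum_mul]
      refine Finset.sum_congr rfl fun a _ => ?_
      ring
    · intro a _
      refine Integrable.const_mul (Integrable.const_mul ?_ _) _
      exact (integrable_twoGreen s v e U h₁ h₂ (-α) ε (fun _ => 1) 1 zero_le_one (by simp) q p).bdd_mul
        (continuous_GX_apply s v e U h₂ _ _).aestronglyMeasurable
        (.of_forall fun x => norm_GX_apply_le s v e U h₂ x _ _)
  have hE : (if α = p.1 then d p.2 * ∫ x, GX s v e U z₂ x q (δ, p.2) ∂(gaussians n) else 0)
      = ∑ a, d a * ((if (α, a) = p then 1 else 0) * ∫ x, GX s v e U z₂ x q (δ, a) ∂(gaussians n)) := by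
    rw [Finset.sum_eq_single p.2]
    · by_cases h : α = p.1
      · rw [if_pos h, if_pos (by rw [h]), one_mul]
      · rw [if_neg h, if_neg (fun h' => h (by rw [← h'])), zero_mul, mul_zero]
    · intro a _ ha
      rw [if_neg (fun h' => ha (by rw [← h'])), zero_mul, mul_zero]
    · exact fun h => absurd (Finset.mem_univ _) h
  rw [hL, hA, hB, hE, Finset.mul_sum, Finset.mul_sum, Finset.mul_sum]
  simp only [hC]
  rw [Finset.sum_comm (s := (Finset.univ : Finset ℤˣ)), ← Finset.sum_add_distrib,
    ← Finset.sum_add_distrib, ← Finset.sum_add_distrib]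
  refine Finset.sum_congr rfl fun a _ => ?_
  rw [hsd a, hd]
  simp only [← Finset.mul_sum]
  linear_combination fE s v (gbar s v e U) α (e a) z₁ * hD a

/-- The error in the two-point equation. -/
noncomputable def twoPointError (v : ℝ) (z₁ z₂ : ℂ) (n : ℕ) : ℝ :=
  |z₁.im|⁻¹ * onePointError v z₂ n
  + 2 * (v ^ 2 * (|z₂.im|⁻¹ * |z₁.im|⁻¹ * |z₁.im|⁻¹ * fluct v z₁ 1 n))
  + v ^ 2 * (2 * (|z₂.im|⁻¹ * 1 * |z₁.im|⁻¹ * fluct v z₂ |z₁.im|⁻¹ n)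
    + |z₁.im|⁻¹ * onePointError v z₂ n * (|z₂.im|⁻¹ * 1 * |z₁.im|⁻¹))

/-- In the exact identity every partial trace is replaced by its mean, and the means by products of
the one-particle functions. Only one term of order one besides the source survives, and it has both
levels flipped, so the equations close in pairs. -/
lemma two_point_equation (hn : 0 < n) (hU : Uᴴ * U = 1) {z₁ z₂ : ℂ} (h₁ : z₁.im ≠ 0)
    (h₂ : z₂.im ≠ 0) (α δ β γ : ℤˣ) (m : Fin n) :
    ‖∫ x, twoGreen s v e U z₁ z₂ α δ (fun _ => 1) (γ, m) (β, m) x ∂(gaussians n)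
      - ((if α = β ∧ δ = γ then fE s v (gbar s v e U) α (e m) z₁ * fE s v (gbar s v e U) δ (e m) z₂
          else 0)
        + (v : ℂ) ^ 2 * ((n : ℂ)⁻¹ * ∑ a, fE s v (gbar s v e U) α (e a) z₁ *
            fE s v (gbar s v e U) δ (e a) z₂) *
          ∫ x, twoGreen s v e U z₁ z₂ (-α) (-δ) (fun _ => 1) (γ, m) (β, m) x ∂(gaussians n))‖
      ≤ twoPointError v z₁ z₂ n := by
  set d : Fin n → ℂ := fun a => fE s v (gbar s v e U) α (e a) z₁ with hd
  have hdb : ∀ a, ‖d a‖ ≤ |z₁.im|⁻¹ := fun a =>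
    norm_fE_le s v (gbar s v e U) α (e a) h₁ (gbar_im_mul_nonneg s v e U hn (-α) h₁)
  have hv : ‖(v : ℂ) ^ 2‖ = v ^ 2 := by
    rw [norm_pow, Complex.norm_real, Real.norm_eq_abs, sq_abs]
  have hi0 : 0 ≤ |z₁.im|⁻¹ := by positivity
  have hX : ∀ α δ, ∀ x, ‖twoGreen s v e U z₁ z₂ α δ d (γ, m) (β, m) x‖
      ≤ |z₂.im|⁻¹ * |z₁.im|⁻¹ * |z₁.im|⁻¹ := fun α δ x =>
    norm_twoGreen_le s v e U h₁ h₂ α δ d _ hi0 hdb _ _ x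
  have hX1 : ∀ α δ, ∀ x, ‖twoGreen s v e U z₁ z₂ α δ (fun _ => 1) (γ, m) (β, m) x‖
      ≤ |z₂.im|⁻¹ * 1 * |z₁.im|⁻¹ := fun α δ x =>
    norm_twoGreen_le s v e U h₁ h₂ α δ _ _ zero_le_one (by simp) _ _ x
  have h0 := two_point_identity s v e U hn hU h₁ h₂ α δ (γ, m) (β, m) d rfl
  have hA := covariance_ptr_le s v e U hn hU h₁ (-α) (-α) (fun _ => 1) 1 zero_le_one (by simp)
    _ (hX α δ)
  have hB := covariance_ptr_le s v e U hn hU h₁ (-α) α (fun _ => 1) 1 zero_le_one (by simp)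
    _ (hX (-α) δ)
  rw [integral_ptr_off s v e U h₁ _ _ (by simp)] at hB
  simp only [sub_zero] at hB
  have hC1 := covariance_ptr_le s v e U hn hU h₂ (-δ) δ d _ hi0 hdb
    _ (hX1 (-α) δ)
  rw [integral_ptr_off s v e U h₂ _ _ (by simp)] at hC1
  simp only [sub_zero] at hC1
  have hC2 := covariance_ptr_le s v e U hn hU h₂ δ δ d _ hi0 hdb
    _ (hX1 (-α) (-δ))
  have hptr : ‖∫ y, ptr s v e U z₂ δ δ d y ∂(gaussians n)
      - (n : ℂ)⁻¹ * ∑ a, d a * fE s v (gbar s v e U) δ (e a) z₂‖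
      ≤ |z₁.im|⁻¹ * onePointError v z₂ n := by
    have hn' : (n : ℝ) ≠ 0 := by positivity
    have : ∫ y, ptr s v e U z₂ δ δ d y ∂(gaussians n)
        = (n : ℂ)⁻¹ * ∑ a, d a * ∫ x, GX s v e U z₂ x (δ, a) (δ, a) ∂(gaussians n) := by
      unfold ptr
      rw [integral_const_mul, integral_finsetSum]
      · simp only [integral_const_mul]
      · exact fun k _ => ((gueSmooth_GX s v e U h₂ _ _).integrable).const_mul _
    rw [this, ← mul_sub, ← Finset.sum_sub_distrib, norm_mul, norm_inv, Complex.norm_natCast]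
    calc _ ≤ (n : ℝ)⁻¹ * ∑ _a : Fin n, |z₁.im|⁻¹ * onePointError v z₂ n := by
          gcongr
          refine (norm_sum_le _ _).trans (Finset.sum_le_sum fun a _ => ?_)
          rw [← mul_sub, norm_mul]
          exact mul_le_mul (hdb a) (one_point s v e U hn hU h₂ δ a) (norm_nonneg _) hi0
      _ = _ := by
          rw [Finset.sum_const, Finset.card_univ, Fintype.card_fin, nsmul_eq_mul]
          field_simp
  have hfirst : ‖(if α = β then d m * ∫ x, GX s v e U z₂ x (γ, m) (δ, m) ∂(gaussians n) else 0)
      - (if α = β ∧ δ = γ then d m * fE s v (gbar s v e U) δ (e m) z₂ else 0)‖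
      ≤ |z₁.im|⁻¹ * onePointError v z₂ n := by
    have hop0 : 0 ≤ onePointError v z₂ n :=
      (norm_nonneg _).trans (one_point s v e U hn hU h₂ δ m)
    by_cases h : α = β
    · by_cases h' : δ = γ
      · rw [if_pos h, if_pos ⟨h, h'⟩, ← mul_sub, norm_mul, ← h']
        exact mul_le_mul (hdb m) (one_point s v e U hn hU h₂ δ m) (norm_nonneg _) hi0
      · rw [if_pos h, if_neg (fun h'' => h' h''.2), integral_GX_off s v e U h₂ _ _ h', mul_zero,
          sub_zero, norm_zero]
        positivity
    · rw [if_neg h, if_neg (fun h'' => h h''.1), sub_zero, norm_zero]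
      positivity
  have hXb : ‖∫ x, twoGreen s v e U z₁ z₂ (-α) (-δ) (fun _ => 1) (γ, m) (β, m) x ∂(gaussians n)‖
      ≤ |z₂.im|⁻¹ * 1 * |z₁.im|⁻¹ := by
    refine (norm_integral_le_of_norm_le_const (.of_forall (hX1 (-α) (-δ)))).trans ?_
    simp
  -- assemble
  set Y := ∫ x, twoGreen s v e U z₁ z₂ (-α) (-δ) (fun _ => 1) (γ, m) (β, m) x ∂(gaussians n)
  set Q := ∫ y, ptr s v e U z₂ δ δ d y ∂(gaussians n)
  have hsplit : ∫ x, (ptr s v e U z₂ δ δ d x - Q) *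
      twoGreen s v e U z₁ z₂ (-α) (-δ) (fun _ => 1) (γ, m) (β, m) x ∂(gaussians n)
      = ∫ x, ptr s v e U z₂ δ δ d x *
      twoGreen s v e U z₁ z₂ (-α) (-δ) (fun _ => 1) (γ, m) (β, m) x ∂(gaussians n) - Q * Y := by
    simp only [sub_mul]
    rw [integral_sub, integral_const_mul]
    · exact integrable_ptr_mul s v e U hn h₂ δ δ d _ hdb
        (continuous_twoGreen s v e U h₁ h₂ _ _ _ _ _) _ (hX1 _ _)
    · exact (integrable_twoGreen s v e U h₁ h₂ _ _ _ 1 zero_le_one (by simp) _ _).const_mul _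
  rw [hsplit] at hC2
  -- The level `ε = -δ` carries the diagonal partial trace, with mean close to the average of
  -- products; `ε = δ` carries an off-diagonal one, which goes into the error.
  rw [h0, sum_units δ]
  simp only [neg_neg]
  set A := ∫ x, (ptr s v e U z₁ (-α) (-α) (fun _ => 1) x - gbar s v e U (-α) z₁)
            * twoGreen s v e U z₁ z₂ α δ d (γ, m) (β, m) x ∂(gaussians n)
  have hA' : ‖A‖ ≤ |z₂.im|⁻¹ * |z₁.im|⁻¹ * |z₁.im|⁻¹ * fluct v z₁ 1 n := hA
  set B := ∫ x, ptr s v e U z₁ (-α) α (fun _ => 1) x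
            * twoGreen s v e U z₁ z₂ (-α) δ d (γ, m) (β, m) x ∂(gaussians n)
  set C1 := ∫ x, ptr s v e U z₂ (-δ) δ d x *
            twoGreen s v e U z₁ z₂ (-α) δ (fun _ => 1) (γ, m) (β, m) x ∂(gaussians n)
  set C2 := ∫ x, ptr s v e U z₂ δ δ d x *
            twoGreen s v e U z₁ z₂ (-α) (-δ) (fun _ => 1) (γ, m) (β, m) x ∂(gaussians n)
  set R := (n : ℂ)⁻¹ * ∑ a, d a * fE s v (gbar s v e U) δ (e a) z₂
  set F := if α = β then d m * ∫ x, GX s v e U z₂ x (γ, m) (δ, m) ∂(gaussians n) else 0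
  set F' := if α = β ∧ δ = γ then d m * fE s v (gbar s v e U) δ (e m) z₂ else 0
  calc ‖F + (v : ℂ) ^ 2 * A + (v : ℂ) ^ 2 * B + (v : ℂ) ^ 2 * (C2 + C1)
        - (F' + (v : ℂ) ^ 2 * R * Y)‖
      = ‖(F - F') + ((v : ℂ) ^ 2 * A + (v : ℂ) ^ 2 * B)
          + (v : ℂ) ^ 2 * ((C2 - Q * Y) + C1 + (Q - R) * Y)‖ := by congr 1; ring
    _ ≤ |z₁.im|⁻¹ * onePointError v z₂ n
        + (v ^ 2 * (|z₂.im|⁻¹ * |z₁.im|⁻¹ * |z₁.im|⁻¹ * fluct v z₁ 1 n) +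
          v ^ 2 * (|z₂.im|⁻¹ * |z₁.im|⁻¹ * |z₁.im|⁻¹ * fluct v z₁ 1 n))
        + v ^ 2 * (|z₂.im|⁻¹ * 1 * |z₁.im|⁻¹ * fluct v z₂ |z₁.im|⁻¹ n
          + |z₂.im|⁻¹ * 1 * |z₁.im|⁻¹ * fluct v z₂ |z₁.im|⁻¹ n
          + |z₁.im|⁻¹ * onePointError v z₂ n * (|z₂.im|⁻¹ * 1 * |z₁.im|⁻¹)) := by
        refine norm_add₃_le.trans (add_le_add (add_le_add hfirst ?_) ?_)
        · refine (norm_add_le _ _).trans (add_le_add ?_ ?_)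
          · rw [norm_mul, hv]; gcongr
          · rw [norm_mul, hv]; gcongr
        · rw [norm_mul, hv]
          gcongr
          refine norm_add₃_le.trans (add_le_add (add_le_add hC2 hC1) ?_)
          rw [norm_mul]
          exact mul_le_mul hptr hXb (norm_nonneg _) ((norm_nonneg _).trans hptr)
    _ = _ := by unfold twoPointError; ring

lemma tendsto_fluct (v : ℝ) (z : ℂ) (a : ℝ) :
    Tendsto (fun n : ℕ+ => fluct v z a n) atTop (𝓝 0) := by
  have h1 : Tendsto (fun n : ℕ => Real.sqrt n) atTop atTop :=
    Real.tendsto_sqrt_atTop.comp tendsto_natCast_atTop_atTop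
  have h2 : Tendsto (fun n : ℕ => fluct v z a n) atTop (𝓝 0) := by
    unfold fluct
    exact tendsto_const_nhds.div_atTop h1
  exact h2.comp tendsto_PNat_val_atTop_atTop

lemma tendsto_onePointError (v : ℝ) (z : ℂ) :
    Tendsto (fun n : ℕ+ => onePointError v z n) atTop (𝓝 0) := by
  have h := tendsto_fluct v z 1
  unfold onePointError
  have := ((((h.const_mul |z.im|⁻¹).const_mul (v ^ 2)).const_mul 2).const_mul |z.im|⁻¹)
  simpa using this

lemma tendsto_twoPointError (v : ℝ) (z₁ z₂ : ℂ) :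
    Tendsto (fun n : ℕ+ => twoPointError v z₁ z₂ n) atTop (𝓝 0) := by
  have h1 := tendsto_fluct v z₁ 1
  have h2 := tendsto_fluct v z₂ |z₁.im|⁻¹
  have h3 := tendsto_onePointError v z₂
  unfold twoPointError
  have := ((h3.const_mul |z₁.im|⁻¹).add
    (((h1.const_mul (|z₂.im|⁻¹ * |z₁.im|⁻¹ * |z₁.im|⁻¹)).const_mul (v ^ 2)).const_mul 2)).add
    ((((h2.const_mul (|z₂.im|⁻¹ * 1 * |z₁.im|⁻¹)).const_mul 2).add
      ((h3.const_mul |z₁.im|⁻¹).mul_const (|z₂.im|⁻¹ * 1 * |z₁.im|⁻¹))).const_mul (v ^ 2))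
  simpa using this

end TwoPoint

/-! ### Stability and uniqueness for the self-consistent equation -/

section FixedPoint

variable {nu0 : Measure ℝ} [IsProbabilityMeasure nu0] {s v : ℝ}

/-- The self-consistent equation at a point. -/
def SolvesAt (nu0 : Measure ℝ) (s v : ℝ) (f : ℤˣ → ℂ → ℂ) (z : ℂ) : Prop :=
  ∀ α, 0 ≤ (f α z).im * z.im ∧ f α z = ∫ E : ℝ, fE s v f α E z ∂nu0

lemma continuous_fE (s v : ℝ) (f : ℤˣ → ℂ → ℂ) (α : ℤˣ) {z : ℂ} (hz : z.im ≠ 0)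
    (h : 0 ≤ (f (-α) z).im * z.im) : Continuous fun E : ℝ => fE s v f α E z := by
  unfold fE
  refine Continuous.inv₀ (by fun_prop) fun E => fE_denominator_ne_zero s v E α hz h

lemma integrable_fE (f : ℤˣ → ℂ → ℂ) (α : ℤˣ) {z : ℂ} (hz : z.im ≠ 0)
    (h : 0 ≤ (f (-α) z).im * z.im) : Integrable (fun E : ℝ => fE s v f α E z) nu0 :=
  integrable_of_bound (continuous_fE s v f α hz h).aestronglyMeasurable _
    fun E => norm_fE_le s v f α E hz h

lemma memLp_fE (f : ℤˣ → ℂ → ℂ) (α : ℤˣ) {z : ℂ} (hz : z.im ≠ 0)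
    (h : 0 ≤ (f (-α) z).im * z.im) : MemLp (fun E : ℝ => fE s v f α E z) 2 nu0 :=
  MemLp.of_bound (continuous_fE s v f α hz h).aestronglyMeasurable _
    (.of_forall fun E => norm_fE_le s v f α E hz h)

/-- The mean square of `f_α(E, z)`. -/
noncomputable def sqMean (nu0 : Measure ℝ) (s v : ℝ) (f : ℤˣ → ℂ → ℂ) (α : ℤˣ) (z : ℂ) : ℝ :=
  ∫ E : ℝ, ‖fE s v f α E z‖ ^ 2 ∂nu0

omit [IsProbabilityMeasure nu0] in
lemma sqMean_nonneg (f : ℤˣ → ℂ → ℂ) (α : ℤˣ) (z : ℂ) : 0 ≤ sqMean nu0 s v f α z :=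
  integral_nonneg fun _ => by positivity

lemma fE_im (f : ℤˣ → ℂ → ℂ) (α : ℤˣ) (E : ℝ) (z : ℂ) :
    (fE s v f α E z).im = (z.im + v ^ 2 * (f (-α) z).im) * ‖fE s v f α E z‖ ^ 2 := by
  unfold fE
  rw [Complex.inv_im, fE_denominator_im, norm_inv, Complex.normSq_eq_norm_sq]
  ring

/-- Taking imaginary parts turns the nonlinear equation into a linear relation between `Im f_α` and
`Im f_{-α}` with coefficient `sqMean`. -/
lemma im_eq_of_solvesAt {f : ℤˣ → ℂ → ℂ} {z : ℂ} (hz : z.im ≠ 0) (hf : SolvesAt nu0 s v f z)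
    (α : ℤˣ) : (f α z).im = (z.im + v ^ 2 * (f (-α) z).im) * sqMean nu0 s v f α z := by
  have h1 := congrArg Complex.im (hf α).2
  rw [← complex_integral_im (integrable_fE f α hz (hf (-α)).1)] at h1
  rw [h1, sqMean, ← integral_const_mul]
  simp_rw [fE_im]

lemma sqMean_pos {f : ℤˣ → ℂ → ℂ} {z : ℂ} (hz : z.im ≠ 0) (hf : SolvesAt nu0 s v f z) (α : ℤˣ) :
    0 < sqMean nu0 s v f α z := by
  refine (integral_pos_iff_support_of_nonneg (fun _ => by positivity) ?_).2 ?_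
  · exact (memLp_two_iff_integrable_sq_norm
      (continuous_fE s v f α hz (hf (-α)).1).aestronglyMeasurable).1
      (memLp_fE f α hz (hf (-α)).1)
  · have : Function.support (fun E : ℝ => ‖fE s v f α E z‖ ^ 2) = Set.univ := by
      refine Set.eq_univ_of_forall fun E => ?_
      have : fE s v f α E z ≠ 0 := inv_ne_zero (fE_denominator_ne_zero s v E α hz (hf (-α)).1)
      simpa using this
    rw [this, measure_univ]
    exact one_pos

/-- The equation itself restores the strict inequality: `Im z` enters as a source with the right
sign and a positive coefficient. -/
lemma im_mul_pos_of_solvesAt {f : ℤˣ → ℂ → ℂ} {z : ℂ} (hz : z.im ≠ 0)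
    (hf : SolvesAt nu0 s v f z) (α : ℤˣ) : 0 < (f α z).im * z.im := by
  rw [im_eq_of_solvesAt hz hf α]
  have h1 := sqMean_pos hz hf α
  have h2 : 0 < (z.im + v ^ 2 * (f (-α) z).im) * z.im := by
    have := mul_nonneg (sq_nonneg v) (hf (-α)).1
    have := mul_self_pos.2 hz
    nlinarith
  nlinarith [mul_pos h1 h2]

/-- Put `η = Im z`, `w = v²`, `u = η Im f_α`, `u' = η Im f_{-α}`, all products nonnegative.
Multiplying the two imaginary-part relations gives `w² A A' = (wu)(wu') / ((η² + wu)(η² + wu'))`,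
and the positive `η²` makes this less than one. -/
lemma sqMean_mul_lt_one {f : ℤˣ → ℂ → ℂ} {z : ℂ} (hz : z.im ≠ 0) (hf : SolvesAt nu0 s v f z)
    (α : ℤˣ) : v ^ 4 * (sqMean nu0 s v f α z * sqMean nu0 s v f (-α) z) < 1 := by
  have key : ∀ y y' η A A' w : ℝ, η ≠ 0 → 0 ≤ w → 0 ≤ y * η → 0 ≤ y' * η → y = (η + w * y') * A →
      y' = (η + w * y) * A' → w * w * (A * A') < 1 := by
    intro y y' η A A' w hη hw hy hy' h h'
    have hη2 := mul_self_pos.2 hη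
    set u := y * η
    set u' := y' * η
    have e1 : u = (η * η + w * u') * A := by
      have := congrArg (· * η) h
      linear_combination this
    have e2 : u' = (η * η + w * u) * A' := by
      have := congrArg (· * η) h'
      linear_combination this
    have p1 : 0 < η * η + w * u := by nlinarith [mul_nonneg hw hy]
    have p2 : 0 < η * η + w * u' := by nlinarith [mul_nonneg hw hy']
    have e3 : w * w * (A * A') * ((η * η + w * u) * (η * η + w * u')) = (w * u) * (w * u') := by
      calc _ = w * w * (((η * η + w * u') * A) * ((η * η + w * u) * A')) := by ring
        _ = _ := by rw [← e1, ← e2]; ring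
    have p3 := mul_pos p1 p2
    have p4 : (w * u) * (w * u') < (η * η + w * u) * (η * η + w * u') := by
      nlinarith [mul_nonneg hw hy, mul_nonneg hw hy', mul_pos hη2 hη2,
        mul_nonneg hη2.le (mul_nonneg hw hy), mul_nonneg hη2.le (mul_nonneg hw hy')]
    by_contra hcon
    push Not at hcon
    nlinarith
  have h1 := im_eq_of_solvesAt hz hf α
  have h2 := im_eq_of_solvesAt hz hf (-α)
  rw [neg_neg] at h2
  have := key _ _ z.im _ _ (v ^ 2) hz (sq_nonneg v) (hf α).1 (hf (-α)).1 h1 h2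
  calc _ = v ^ 2 * v ^ 2 * (sqMean nu0 s v f α z * sqMean nu0 s v f (-α) z) := by ring
    _ < 1 := this

lemma norm_integral_mul_sq_le {X : Type*} [MeasurableSpace X] {μ : Measure X} {f g : X → ℂ}
    (hf : MemLp f 2 μ) (hg : MemLp g 2 μ) :
    ‖∫ x, f x * g x ∂μ‖ ^ 2 ≤ (∫ x, ‖f x‖ ^ 2 ∂μ) * ∫ x, ‖g x‖ ^ 2 ∂μ := by
  have h1 : ‖∫ x, f x * g x ∂μ‖ ≤ ∫ x, ‖f x‖ * ‖g x‖ ∂μ := by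
    refine (norm_integral_le_integral_norm _).trans (le_of_eq ?_)
    simp_rw [norm_mul]
  have h2 := integral_mul_le_Lp_mul_Lq_of_nonneg (μ := μ) (f := fun x => ‖f x‖) (g := fun x => ‖g x‖)
    Real.HolderConjugate.two_two (.of_forall fun x => norm_nonneg _)
    (.of_forall fun x => norm_nonneg _) (by simpa using hf.norm) (by simpa using hg.norm)
  simp only [Real.rpow_two, ← Real.sqrt_eq_rpow] at h2
  have hA : 0 ≤ ∫ x, ‖f x‖ ^ 2 ∂μ := integral_nonneg fun _ => by positivity
  have hB : 0 ≤ ∫ x, ‖g x‖ ^ 2 ∂μ := integral_nonneg fun _ => by positivity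
  calc _ ≤ (Real.sqrt (∫ x, ‖f x‖ ^ 2 ∂μ) * Real.sqrt (∫ x, ‖g x‖ ^ 2 ∂μ)) ^ 2 := by
        gcongr
        exact h1.trans h2
    _ = _ := by rw [mul_pow, Real.sq_sqrt hA, Real.sq_sqrt hB]

/-- Stability of the two-point equation. -/
lemma cross_lt_one {f g : ℤˣ → ℂ → ℂ} {z w : ℂ} (hz : z.im ≠ 0) (hw : w.im ≠ 0)
    (hf : SolvesAt nu0 s v f z) (hg : SolvesAt nu0 s v g w) (α δ : ℤˣ) :
    ‖(v : ℂ) ^ 4 * (∫ E : ℝ, fE s v f α E z * fE s v g δ E w ∂nu0) *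
      ∫ E : ℝ, fE s v f (-α) E z * fE s v g (-δ) E w ∂nu0‖ < 1 := by
  have h1 := norm_integral_mul_sq_le (memLp_fE (s := s) (v := v) (nu0 := nu0) f α hz (hf (-α)).1)
    (memLp_fE (s := s) (v := v) (nu0 := nu0) g δ hw (hg (-δ)).1)
  have h2 := norm_integral_mul_sq_le
    (memLp_fE (s := s) (v := v) (nu0 := nu0) f (-α) hz (hf (- -α)).1)
    (memLp_fE (s := s) (v := v) (nu0 := nu0) g (-δ) hw (hg (- -δ)).1)
  have h3 := sqMean_mul_lt_one hz hf α
  have h4 := sqMean_mul_lt_one hw hg δ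
  have p1 := sqMean_nonneg (nu0 := nu0) (s := s) (v := v) f α z
  have p2 := sqMean_nonneg (nu0 := nu0) (s := s) (v := v) f (-α) z
  have p3 := sqMean_nonneg (nu0 := nu0) (s := s) (v := v) g δ w
  have p4 := sqMean_nonneg (nu0 := nu0) (s := s) (v := v) g (-δ) w
  set T := ∫ E : ℝ, fE s v f α E z * fE s v g δ E w ∂nu0
  set T' := ∫ E : ℝ, fE s v f (-α) E z * fE s v g (-δ) E w ∂nu0
  change _ ≤ sqMean nu0 s v f α z * sqMean nu0 s v g δ w at h1
  change _ ≤ sqMean nu0 s v f (-α) z * sqMean nu0 s v g (-δ) w at h2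
  rw [← sq_lt_one_iff₀ (norm_nonneg _)]
  have hv4 : 0 ≤ v ^ 4 := by positivity
  calc ‖(v : ℂ) ^ 4 * T * T'‖ ^ 2 = v ^ 4 * v ^ 4 * (‖T‖ ^ 2 * ‖T'‖ ^ 2) := by
        rw [norm_mul, norm_mul, norm_pow, Complex.norm_real, Real.norm_eq_abs,
          show |v| ^ 4 = v ^ 4 from (by decide : Even 4).pow_abs v]
        ring
    -- Cauchy–Schwarz for both cross integrals; the four mean squares are then regrouped by
    -- solution, so that each group is less than one.
    _ ≤ v ^ 4 * v ^ 4 * ((sqMean nu0 s v f α z * sqMean nu0 s v g δ w) *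
          (sqMean nu0 s v f (-α) z * sqMean nu0 s v g (-δ) w)) := by gcongr
    _ = (v ^ 4 * (sqMean nu0 s v f α z * sqMean nu0 s v f (-α) z)) *
          (v ^ 4 * (sqMean nu0 s v g δ w * sqMean nu0 s v g (-δ) w)) := by ring
    _ < 1 := mul_lt_one_of_nonneg_of_lt_one_left (by positivity) h3 h4.le

/-- The subtracted term has modulus less than one, at any two nonreal points; they need not lie in
opposite half-planes. -/
lemma denom_ne_zero_of_solvesAt {f : ℤˣ → ℂ → ℂ} {z w : ℂ} (hz : z.im ≠ 0) (hw : w.im ≠ 0)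
    (hf : SolvesAt nu0 s v f z) (hg : SolvesAt nu0 s v f w) (α δ : ℤˣ) :
    denom nu0 s v f α δ z w ≠ 0 := by
  intro h
  have h1 := cross_lt_one hz hw hf hg α δ
  unfold denom twoPoint at h
  rw [sub_eq_zero] at h
  rw [← h, norm_one] at h1
  exact lt_irrefl _ h1

lemma fE_sub_fE {f g : ℤˣ → ℂ → ℂ} {z : ℂ} (hz : z.im ≠ 0) (α : ℤˣ)
    (hf : 0 ≤ (f (-α) z).im * z.im) (hg : 0 ≤ (g (-α) z).im * z.im) (E : ℝ) :
    fE s v f α E z - fE s v g α E z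
      = (v : ℂ) ^ 2 * (f (-α) z - g (-α) z) * (fE s v f α E z * fE s v g α E z) := by
  have h1 := fE_denominator_ne_zero s v E α hz hf
  have h2 := fE_denominator_ne_zero s v E α hz hg
  unfold fE
  field_simp
  ring

/-- Uniqueness of the solution of the self-consistent equation. -/
lemma solvesAt_unique {f g : ℤˣ → ℂ → ℂ} {z : ℂ} (hz : z.im ≠ 0)
    (hf : SolvesAt nu0 s v f z) (hg : SolvesAt nu0 s v g z) (α : ℤˣ) : f α z = g α z := by
  have h1 : ∀ α, f α z - g α z = (v : ℂ) ^ 2 * (f (-α) z - g (-α) z) *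
      ∫ E : ℝ, fE s v f α E z * fE s v g α E z ∂nu0 := by
    intro α
    rw [(hf α).2, (hg α).2, ← integral_sub (integrable_fE f α hz (hf (-α)).1)
      (integrable_fE g α hz (hg (-α)).1), ← integral_const_mul]
    refine integral_congr_ae (.of_forall fun E => ?_)
    simp only
    rw [fE_sub_fE hz α (hf (-α)).1 (hg (-α)).1]
  have h2 := h1 (-α)
  rw [neg_neg] at h2
  have h3 := cross_lt_one hz hz hf hg α α
  set T := ∫ E : ℝ, fE s v f α E z * fE s v g α E z ∂nu0
  set T' := ∫ E : ℝ, fE s v f (-α) E z * fE s v g (-α) E z ∂nu0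
  -- Going from level `α` to `-α` and back multiplies the difference by a number of modulus less
  -- than one, so it must vanish.
  have h4 : f α z - g α z = (v : ℂ) ^ 4 * T * T' * (f α z - g α z) := by
    conv_lhs => rw [h1 α, h2]
    ring
  by_contra hne
  have hne' : f α z - g α z ≠ 0 := sub_ne_zero.2 hne
  have h5 : (v : ℂ) ^ 4 * T * T' = 1 := by
    have : ((v : ℂ) ^ 4 * T * T' - 1) * (f α z - g α z) = 0 := by linear_combination -h4
    rcases mul_eq_zero.1 this with h | h
    · exact sub_eq_zero.1 h
    · exact absurd h hne'
  rw [h5, norm_one] at h3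
  exact lt_irrefl _ h3

omit [IsProbabilityMeasure nu0] in
lemma IsSolution.solvesAt {f : ℤˣ → ℂ → ℂ} (hf : IsSolution nu0 s v f) {z : ℂ} (hz : z.im ≠ 0) :
    SolvesAt nu0 s v f z := fun α => ⟨(hf.im_pos α z hz).le, hf.eqn α z hz⟩

end FixedPoint

/-! ### Regularity of Stieltjes transforms -/

section Stieltjes

lemma norm_inv_sub_inv_le {z w : ℂ} (hz : z.im ≠ 0) (hw : w.im ≠ 0) (x : ℝ) :
    ‖((x : ℂ) - z)⁻¹ - ((x : ℂ) - w)⁻¹‖ ≤ |z.im|⁻¹ * |w.im|⁻¹ * ‖z - w‖ := by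
  have h1 := ofReal_sub_ne_zero hz x
  have h2 := ofReal_sub_ne_zero hw x
  have : ((x : ℂ) - z)⁻¹ - ((x : ℂ) - w)⁻¹ = ((x : ℂ) - z)⁻¹ * ((x : ℂ) - w)⁻¹ * (z - w) := by
    field_simp; ring
  rw [this, norm_mul, norm_mul]
  gcongr
  · exact norm_inv_ofReal_sub_le hz x
  · exact norm_inv_ofReal_sub_le hw x

/-- The bound does not depend on the measure; it therefore passes to random and mean partial traces
and to their limits. -/
lemma norm_stieltjes_sub_le (m : Measure ℝ) [IsProbabilityMeasure m] {z w : ℂ} (hz : z.im ≠ 0)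
    (hw : w.im ≠ 0) :
    ‖stieltjes m z - stieltjes m w‖ ≤ |z.im|⁻¹ * |w.im|⁻¹ * ‖z - w‖ := by
  unfold stieltjes
  rw [← integral_sub (integrable_inv_ofReal_sub m hz) (integrable_inv_ofReal_sub m hw)]
  refine (norm_integral_le_of_norm_le_const (.of_forall (norm_inv_sub_inv_le hz hw))).trans ?_
  simp

/-- Differentiation under the integral on the disc of radius `|Im z| / 2`, where the derivative of
the kernel is bounded because `|Im w| ≥ |Im z| / 2`. -/
lemma differentiableOn_stieltjes (m : Measure ℝ) [IsProbabilityMeasure m] :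
    DifferentiableOn ℂ (stieltjes m) {z : ℂ | z.im ≠ 0} := by
  intro z hz
  have hz : z.im ≠ 0 := hz
  have hr : 0 < |z.im| / 2 := by positivity
  have hball : ∀ w ∈ Metric.ball z (|z.im| / 2), |z.im| / 2 ≤ |w.im| := by
    intro w hw
    have h1 : |(w - z).im| < |z.im| / 2 :=
      (Complex.abs_im_le_norm _).trans_lt (mem_ball_iff_norm.1 hw)
    rw [Complex.sub_im] at h1
    have h2 := abs_sub_abs_le_abs_sub z.im w.im
    rw [abs_sub_comm] at h2
    linarith
  have hne : ∀ w ∈ Metric.ball z (|z.im| / 2), w.im ≠ 0 := fun w hw h0 => by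
    have := hball w hw
    rw [h0, abs_zero] at this
    linarith
  refine DifferentiableAt.differentiableWithinAt ?_
  refine (hasDerivAt_integral_of_dominated_loc_of_deriv_le (μ := m)
    (F := fun w (x : ℝ) => ((x : ℂ) - w)⁻¹) (F' := fun w (x : ℝ) => (((x : ℂ) - w) ^ 2)⁻¹)
    (bound := fun _ => ((|z.im| / 2) ^ 2)⁻¹) (Metric.ball_mem_nhds z hr) ?_ ?_ ?_ ?_ ?_ ?_).2.differentiableAt
  · filter_upwards [Metric.ball_mem_nhds z hr] with w hw
    exact (continuous_inv_ofReal_sub (hne w hw)).aestronglyMeasurable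
  · exact integrable_inv_ofReal_sub m hz
  · refine Continuous.aestronglyMeasurable ?_
    exact ((Complex.continuous_ofReal.sub continuous_const).pow 2).inv₀
      fun x => pow_ne_zero 2 (ofReal_sub_ne_zero hz x)
  · refine .of_forall fun x w hw => ?_
    rw [norm_inv, norm_pow]
    refine inv_anti₀ (by positivity) ?_
    gcongr
    refine (hball w hw).trans ?_
    have := Complex.abs_im_le_norm ((x : ℂ) - w)
    simpa using this
  · exact integrable_const _
  · refine .of_forall fun x w hw => ?_
    have h1 : HasDerivAt (fun w : ℂ => (x : ℂ) - w) (-1) w := by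
      simpa using (hasDerivAt_id w).const_sub (x : ℂ)
    have := h1.inv (ofReal_sub_ne_zero (hne w hw) x)
    simp only [neg_neg, one_div] at this
    exact this

end Stieltjes

/-! ### Averages over the reservoir spectrum under weak convergence -/

section WeakConvergence

lemma tendsto_integral_complex {ι : Type*} {l : Filter ι} {μs : ι → Measure ℝ} {μ : Measure ℝ}
    [∀ i, IsFiniteMeasure (μs i)] [IsFiniteMeasure μ]
    (h : ∀ φ : ℝ →ᵇ ℝ, Tendsto (fun i => ∫ x, φ x ∂(μs i)) l (𝓝 (∫ x, φ x ∂μ)))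
    {φ : ℝ → ℂ} (hφ : Continuous φ) (C : ℝ) (hC : ∀ x, ‖φ x‖ ≤ C) :
    Tendsto (fun i => ∫ x, φ x ∂(μs i)) l (𝓝 (∫ x, φ x ∂μ)) := by
  set φ₁ : ℝ →ᵇ ℝ := BoundedContinuousFunction.ofNormedAddCommGroup (fun x => (φ x).re)
    (Complex.continuous_re.comp hφ) C (fun x => (Complex.abs_re_le_norm _).trans (hC x))
  set φ₂ : ℝ →ᵇ ℝ := BoundedContinuousFunction.ofNormedAddCommGroup (fun x => (φ x).im)
    (Complex.continuous_im.comp hφ) C (fun x => (Complex.abs_im_le_norm _).trans (hC x))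
  have key : ∀ m : Measure ℝ, IsFiniteMeasure m →
      ∫ x, φ x ∂m = ((∫ x, φ₁ x ∂m : ℝ) : ℂ) + ((∫ x, φ₂ x ∂m : ℝ) : ℂ) * Complex.I := by
    intro m hm
    have hi : Integrable φ m := integrable_of_bound hφ.aestronglyMeasurable C hC
    have h2 := integral_re_add_im (𝕜 := ℂ) hi
    exact h2.symm
  simp_rw [fun i => key (μs i) inferInstance, key μ inferInstance]
  exact ((Complex.continuous_ofReal.tendsto _).comp (h φ₁)).add
    (((Complex.continuous_ofReal.tendsto _).comp (h φ₂)).mul_const _)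

lemma integral_countingMeasure {n : ℕ} (e : Fin n → ℝ) {V : Type*} [NormedAddCommGroup V]
    [NormedSpace ℝ V] [CompleteSpace V] (φ : ℝ → V) :
    ∫ x, φ x ∂(countingMeasure e) = (n : ℝ)⁻¹ • ∑ a, φ (e a) := by
  unfold countingMeasure
  rw [integral_smul_measure, integral_finsetSum_measure fun a _ => integrable_dirac (by simp)]
  simp

lemma isFiniteMeasure_countingMeasure {n : ℕ} (hn : 0 < n) (e : Fin n → ℝ) :
    IsFiniteMeasure (countingMeasure e) := by
  refine ⟨?_⟩
  unfold countingMeasure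
  rw [Measure.smul_apply, smul_eq_mul]
  refine ENNReal.mul_lt_top ?_ (measure_lt_top _ _)
  rw [ENNReal.inv_lt_top]
  exact_mod_cast hn

variable {ev : ∀ n : ℕ+, Fin n → ℝ} {nu0 : Measure ℝ} [IsProbabilityMeasure nu0]

/-- The integrand may vary with `n` as long as its error is uniform in the energy. A filter below
`atTop` is allowed so that ultrafilter limits can be treated. -/
lemma tendsto_average
    (hconv : ∀ φ : ℝ →ᵇ ℝ, Tendsto (fun n : ℕ+ => ∫ x, φ x ∂(countingMeasure (ev n)))
      atTop (𝓝 (∫ x, φ x ∂nu0))) {l : Filter ℕ+} (hl : l ≤ atTop) {ψ : ℕ+ → ℝ → ℂ} {φ : ℝ → ℂ}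
    (hφ : Continuous φ) (C : ℝ) (hC : ∀ x, ‖φ x‖ ≤ C) {ε : ℕ+ → ℝ} (hε : Tendsto ε l (𝓝 0))
    (hψ : ∀ n x, ‖ψ n x - φ x‖ ≤ ε n) :
    Tendsto (fun n : ℕ+ => ((n : ℕ) : ℂ)⁻¹ * ∑ a, ψ n (ev n a)) l (𝓝 (∫ x, φ x ∂nu0)) := by
  have : ∀ n : ℕ+, IsFiniteMeasure (countingMeasure (ev n)) := fun n =>
    isFiniteMeasure_countingMeasure n.pos _
  have h1 := (tendsto_integral_complex hconv hφ C hC).mono_left hl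
  have h2 : Tendsto (fun n : ℕ+ => ((n : ℕ) : ℂ)⁻¹ * ∑ a, (ψ n (ev n a) - φ (ev n a))) l (𝓝 0) := by
    refine squeeze_zero_norm (fun n => ?_) hε
    have hn : ((n : ℕ) : ℝ) ≠ 0 := by exact_mod_cast n.pos.ne'
    rw [norm_mul, norm_inv, Complex.norm_natCast]
    calc _ ≤ ((n : ℕ) : ℝ)⁻¹ * ∑ _a : Fin n, ε n := by
          gcongr
          exact (norm_sum_le _ _).trans (Finset.sum_le_sum fun a _ => hψ n _)
      _ = ε n := by
          rw [Finset.sum_const, Finset.card_univ, Fintype.card_fin, nsmul_eq_mul]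
          field_simp
  have h3 := h1.add h2
  rw [add_zero] at h3
  refine h3.congr fun n => ?_
  rw [integral_countingMeasure, Finset.sum_sub_distrib, Complex.real_smul]
  push_cast
  ring

end WeakConvergence

/-! ### Convergence of the mean partial traces -/

section Limit

variable {ev : ∀ n : ℕ+, Fin n → ℝ} {nu0 : Measure ℝ} [IsProbabilityMeasure nu0]
  {U : ∀ n : ℕ+, Matrix (Fin n) (Fin n) ℂ} {s v : ℝ}

lemma norm_fE_sub_fE_le {f g : ℤˣ → ℂ → ℂ} {z : ℂ} (hz : z.im ≠ 0) (α : ℤˣ)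
    (hf : 0 ≤ (f (-α) z).im * z.im) (hg : 0 ≤ (g (-α) z).im * z.im) (E : ℝ) :
    ‖fE s v f α E z - fE s v g α E z‖
      ≤ v ^ 2 * ‖f (-α) z - g (-α) z‖ * (|z.im|⁻¹ * |z.im|⁻¹) := by
  rw [fE_sub_fE hz α hf hg, norm_mul, norm_mul, norm_pow, Complex.norm_real, Real.norm_eq_abs,
    sq_abs, norm_mul]
  gcongr
  · exact norm_fE_le s v f α E hz hf
  · exact norm_fE_le s v g α E hz hg

lemma tendsto_norm_sub {ι : Type*} {l : Filter ι} {u : ι → ℂ} {a : ℂ} (h : Tendsto u l (𝓝 a))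
    (b c : ℝ) : Tendsto (fun i => b * ‖u i - a‖ * c) l (𝓝 0) := by
  have := ((tendsto_iff_norm_sub_tendsto_zero.1 h).const_mul b).mul_const c
  simpa using this

/-- Passing to the limit in `gbar_equation` along any filter below `atTop`: the map from `f` to the
one-particle function is Lipschitz uniformly in the energy, and the error term vanishes. -/
lemma solvesAt_of_tendsto (hU : ∀ n, (U n)ᴴ * U n = 1)
    (hconv : ∀ φ : ℝ →ᵇ ℝ, Tendsto (fun n : ℕ+ => ∫ x, φ x ∂(countingMeasure (ev n)))
      atTop (𝓝 (∫ x, φ x ∂nu0))) {l : Filter ℕ+} [l.NeBot] (hl : l ≤ atTop) {f : ℤˣ → ℂ → ℂ} {z : ℂ}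
    (hz : z.im ≠ 0)
    (hf : ∀ α, Tendsto (fun n : ℕ+ => gbar s v (ev n) (U n) α z) l (𝓝 (f α z))) :
    SolvesAt nu0 s v f z := by
  have him : ∀ α, 0 ≤ (f α z).im * z.im := fun α =>
    ge_of_tendsto' (((Complex.continuous_im.tendsto _).comp (hf α)).mul_const z.im)
      fun n => gbar_im_mul_nonneg s v (ev n) (U n) n.pos α hz
  intro α
  refine ⟨him α, ?_⟩
  have h1 := tendsto_average hconv hl (continuous_fE s v f α hz (him (-α))) _
    (fun E => norm_fE_le s v f α E hz (him (-α)))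
    (ψ := fun n E => fE s v (gbar s v (ev n) (U n)) α E z)
    (tendsto_norm_sub (hf (-α)) (v ^ 2) (|z.im|⁻¹ * |z.im|⁻¹))
    (fun n E => norm_fE_sub_fE_le hz α (gbar_im_mul_nonneg s v (ev n) (U n) n.pos (-α) hz)
      (him (-α)) E)
  have h2 : Tendsto (fun n : ℕ+ => gbar s v (ev n) (U n) α z -
      ((n : ℕ) : ℂ)⁻¹ * ∑ a, fE s v (gbar s v (ev n) (U n)) α (ev n a) z) l (𝓝 0) :=
    squeeze_zero_norm (fun n => gbar_equation s v (ev n) (U n) n.pos (hU n) hz α)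
      ((tendsto_onePointError v z).mono_left hl)
  have h3 := h2.add h1
  simp only [sub_add_cancel, zero_add] at h3
  exact tendsto_nhds_unique (hf α) h3

/-- The mean normalized traces converge to the solution of the self-consistent equation. -/
lemma exists_limit (hU : ∀ n, (U n)ᴴ * U n = 1)
    (hconv : ∀ φ : ℝ →ᵇ ℝ, Tendsto (fun n : ℕ+ => ∫ x, φ x ∂(countingMeasure (ev n)))
      atTop (𝓝 (∫ x, φ x ∂nu0))) :
    ∃ f : ℤˣ → ℂ → ℂ, ∀ z : ℂ, z.im ≠ 0 → SolvesAt nu0 s v f z ∧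
      ∀ α, Tendsto (fun n : ℕ+ => gbar s v (ev n) (U n) α z) atTop (𝓝 (f α z)) := by
  -- The bound `|Im z|⁻¹` gives compactness at each point separately; ultrafilters replace the
  -- extraction of subsequences.
  have hcpt : ∀ (l : Ultrafilter ℕ+) (z : ℂ), z.im ≠ 0 → ∃ ζ : ℤˣ → ℂ, ∀ α,
      Tendsto (fun n : ℕ+ => gbar s v (ev n) (U n) α z) l (𝓝 (ζ α)) := by
    intro l z hz
    have : ∀ α, ∃ ζ : ℂ, Tendsto (fun n : ℕ+ => gbar s v (ev n) (U n) α z) l (𝓝 ζ) := by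
      intro α
      obtain ⟨ζ, -, hζ⟩ := (isCompact_closedBall (0 : ℂ) |z.im|⁻¹).ultrafilter_le_nhds
        (l.map fun n : ℕ+ => gbar s v (ev n) (U n) α z) (by
          rw [le_principal_iff]
          refine Ultrafilter.mem_map.2 (Filter.univ_mem' fun n => ?_)
          simpa using norm_gbar_le s v (ev n) (U n) n.pos α hz)
      exact ⟨ζ, hζ⟩
    choose ζ hζ using this
    exact ⟨ζ, hζ⟩
  have hex : ∀ z : ℂ, ∃ ζ : ℤˣ → ℂ, z.im ≠ 0 → SolvesAt nu0 s v (fun α _ => ζ α) z := by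
    intro z
    by_cases hz : z.im = 0
    · exact ⟨0, fun h => absurd hz h⟩
    · obtain ⟨ζ, hζ⟩ := hcpt (Ultrafilter.of atTop) z hz
      exact ⟨ζ, fun _ => solvesAt_of_tendsto hU hconv (Ultrafilter.of_le _) hz hζ⟩
  choose ζ hζ using hex
  refine ⟨fun α z => ζ z α, fun z hz => ⟨hζ z hz, fun α => ?_⟩⟩
  -- Every ultrafilter limit solves the equation, and the solution is unique, so all of them agree.
  rw [tendsto_iff_ultrafilter]
  intro l hl
  obtain ⟨ξ, hξ⟩ := hcpt l z hz
  have h1 : SolvesAt nu0 s v (fun α _ => ξ α) z := solvesAt_of_tendsto hU hconv hl hz hξ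
  have h2 : ξ α = ζ z α := solvesAt_unique hz h1 (hζ z hz) α
  change Tendsto _ _ (𝓝 (ζ z α))
  rw [← h2]
  exact hξ α

end Limit

/-! ### The limits are Stieltjes transforms of probability measures -/

section Reconstruction

/-- The tail of a measure is controlled by its Stieltjes transform on the imaginary axis. -/
lemma tail_le_stieltjes (m : Measure ℝ) [IsProbabilityMeasure m] {y : ℝ} (hy : 0 < y) :
    m {x | y < ‖x‖} ≤ ENNReal.ofReal (2 * (1 - y * (stieltjes m (y * Complex.I)).im)) := by
  have hz : ((y : ℂ) * Complex.I).im ≠ 0 := by simpa using hy.ne'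
  have hns : ∀ x : ℝ, Complex.normSq ((x : ℂ) - y * Complex.I) = x ^ 2 + y ^ 2 := by
    intro x
    simp [Complex.normSq_apply]; ring
  have hpos : ∀ x : ℝ, 0 < x ^ 2 + y ^ 2 := fun x => by positivity
  have hc : Continuous fun x : ℝ => y * (y * (x ^ 2 + y ^ 2)⁻¹) :=
    continuous_const.mul (continuous_const.mul
      (Continuous.inv₀ (by fun_prop) fun x => (hpos x).ne'))
  have hi : Integrable (fun x : ℝ => y * (y * (x ^ 2 + y ^ 2)⁻¹)) m := by
    refine Integrable.of_bound hc.aestronglyMeasurable 1 (.of_forall fun x => ?_)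
    have := hpos x
    rw [Real.norm_eq_abs, abs_of_nonneg (by positivity), ← mul_assoc, ← div_eq_mul_inv,
      div_le_one this]
    nlinarith [sq_nonneg x]
  have h1 : y * (stieltjes m (y * Complex.I)).im = ∫ x, y * (y * (x ^ 2 + y ^ 2)⁻¹) ∂m := by
    rw [stieltjes_im m hz, integral_const_mul, integral_const_mul]
    simp_rw [hns]
    simp
  have h2 : 1 - y * (stieltjes m (y * Complex.I)).im
      = ∫ x, (1 - y * (y * (x ^ 2 + y ^ 2)⁻¹)) ∂m := by
    rw [h1, integral_sub (integrable_const _) hi]; simp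
  have hms : MeasurableSet {x : ℝ | y < ‖x‖} := measurableSet_lt measurable_const measurable_norm
  rw [← ofReal_measureReal (μ := m)]
  refine ENNReal.ofReal_le_ofReal ?_
  rw [h2, ← integral_const_mul, ← integral_indicator_one hms]
  refine integral_mono ((integrable_const (1 : ℝ)).indicator hms)
    (((integrable_const _).sub hi).const_mul _) fun x => ?_
  have hp := hpos x
  -- This is at least `1/2` where `|x| > y`, hence the factor `2` in the bound.
  have e1 : 1 - y * (y * (x ^ 2 + y ^ 2)⁻¹) = x ^ 2 / (x ^ 2 + y ^ 2) := by
    field_simp; ring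
  simp only [e1]
  by_cases hx : x ∈ {x : ℝ | y < ‖x‖}
  · rw [Set.indicator_of_mem hx]
    simp only [Pi.one_apply]
    rw [← mul_div_assoc, le_div_iff₀ hp]
    have : y < |x| := hx
    have : y ^ 2 ≤ x ^ 2 := sq_le_sq.2 (by rw [abs_of_pos hy]; exact this.le)
    linarith
  · rw [Set.indicator_of_notMem hx]
    positivity

/-- A function which is a locally uniform limit of Stieltjes transforms of probability measures
and has the right behaviour at infinity is the Stieltjes transform of a probability measure. -/
lemma exists_measure_of_approx (f : ℂ → ℂ)
    (happ : ∀ (S : Finset ℂ) (ε : ℝ), 0 < ε → (∀ z ∈ S, z.im ≠ 0) →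
      ∃ m : Measure ℝ, IsProbabilityMeasure m ∧ ∀ z ∈ S, ‖stieltjes m z - f z‖ ≤ ε)
    (hlip : ∀ z w : ℂ, z.im ≠ 0 → w.im ≠ 0 →
      ‖f z - f w‖ ≤ |z.im|⁻¹ * |w.im|⁻¹ * ‖z - w‖)
    (hinf : Tendsto (fun y : ℝ => y * (f (y * Complex.I)).im) atTop (𝓝 1)) :
    ∃ m : Measure ℝ, IsProbabilityMeasure m ∧ ∀ z : ℂ, z.im ≠ 0 → stieltjes m z = f z := by
  classical
  have h1 : ∀ M : ℕ, ∃ m : Measure ℝ, IsProbabilityMeasure m ∧ ∀ i < M,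
      (TopologicalSpace.denseSeq ℂ i).im ≠ 0 →
      ‖stieltjes m (TopologicalSpace.denseSeq ℂ i) - f (TopologicalSpace.denseSeq ℂ i)‖
        ≤ 1 / ((M : ℝ) + 1) := by
    intro M
    obtain ⟨m, hm, h⟩ := happ (((Finset.range M).image (TopologicalSpace.denseSeq ℂ)).filter
      fun z => z.im ≠ 0) (1 / ((M : ℝ) + 1)) (by positivity)
      (fun z hz => (Finset.mem_filter.1 hz).2)
    refine ⟨m, hm, fun i hi hz => h _ (Finset.mem_filter.2 ⟨?_, hz⟩)⟩
    exact Finset.mem_image_of_mem _ (Finset.mem_range.2 hi)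
  -- The `M`-th measure matches `f` to within `1 / (M + 1)` on the nonreal points among the first
  -- `M` of a dense sequence; the common Lipschitz bound extends the convergence to every nonreal
  -- point.
  choose μ hμ hμz using h1
  have hconv : ∀ z : ℂ, z.im ≠ 0 → Tendsto (fun M => stieltjes (μ M) z) atTop (𝓝 (f z)) := by
    intro z hz
    rw [Metric.tendsto_atTop]
    intro ε hε
    have hcont : Tendsto (fun w : ℂ => 2 * (|z.im|⁻¹ * |w.im|⁻¹ * ‖z - w‖)) (𝓝 z) (𝓝 0) := by
      have : ContinuousAt (fun w : ℂ => 2 * (|z.im|⁻¹ * |w.im|⁻¹ * ‖z - w‖)) z := by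
        have h2 : ContinuousAt (fun w : ℂ => |w.im|⁻¹) z :=
          (Complex.continuous_im.abs.continuousAt).inv₀ (abs_ne_zero.2 hz)
        have h3 : ContinuousAt (fun w : ℂ => ‖z - w‖) z := by fun_prop
        exact continuousAt_const.mul ((continuousAt_const.mul h2).mul h3)
      have h4 := this.tendsto
      simpa using h4
    have hev : ∀ᶠ w in 𝓝 z, 2 * (|z.im|⁻¹ * |w.im|⁻¹ * ‖z - w‖) < ε / 2 ∧ w.im ≠ 0 :=
      (hcont.eventually (gt_mem_nhds (half_pos hε))).and
        (Complex.continuous_im.continuousAt.eventually_ne hz)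
    obtain ⟨O, hO, hOo, hzO⟩ := eventually_nhds_iff.1 hev
    obtain ⟨i, hi⟩ := (TopologicalSpace.denseRange_denseSeq ℂ).exists_mem_open hOo ⟨z, hzO⟩
    obtain ⟨hi1, hi2⟩ := hO _ hi
    set w := TopologicalSpace.denseSeq ℂ i
    obtain ⟨K, hK⟩ := exists_nat_one_div_lt (half_pos hε)
    refine ⟨max K (i + 1), fun M hM => ?_⟩
    have hM1 : K ≤ M := (le_max_left _ _).trans hM
    have hM2 : i < M := (le_max_right _ _).trans hM
    have e1 := norm_stieltjes_sub_le (μ M) hz hi2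
    have e2 := hμz M i hM2 hi2
    have e3 := hlip z w hz hi2
    rw [norm_sub_rev] at e3
    have e4 : 1 / ((M : ℝ) + 1) ≤ 1 / ((K : ℝ) + 1) := by gcongr
    rw [dist_eq_norm]
    calc ‖stieltjes (μ M) z - f z‖
        = ‖(stieltjes (μ M) z - stieltjes (μ M) w) + (stieltjes (μ M) w - f w) + (f w - f z)‖ := by
          congr 1; ring
      _ ≤ _ := norm_add₃_le
      _ < ε := by linarith
  -- The tails of the `M`-th measure are controlled by its transform at `ir`, which converges to
  -- `f(ir)`; the hypothesis at infinity makes the resulting bound vanish as `r` grows. No mass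
  -- escapes.
  have htight : IsTightMeasureSet (Set.range μ) := by
    refine isTightMeasureSet_range_of_tendsto_limsup_measure_norm_gt ?_
    have hb : ∀ᶠ r : ℝ in atTop, limsup (fun M => μ M {x | r < ‖x‖}) atTop
        ≤ ENNReal.ofReal (2 * (1 - r * (f (r * Complex.I)).im)) := by
      filter_upwards [eventually_gt_atTop 0] with r hr
      have hz : ((r : ℂ) * Complex.I).im ≠ 0 := by simpa using hr.ne'
      have h2 : Tendsto (fun M => ENNReal.ofReal
          (2 * (1 - r * (stieltjes (μ M) (r * Complex.I)).im))) atTop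
          (𝓝 (ENNReal.ofReal (2 * (1 - r * (f (r * Complex.I)).im)))) := by
        refine ENNReal.tendsto_ofReal ?_
        exact (((((Complex.continuous_im.tendsto _).comp (hconv _ hz)).const_mul r).const_sub
          1).const_mul 2)
      rw [← h2.limsup_eq]
      exact limsup_le_limsup (.of_forall fun M => tail_le_stieltjes (μ M) hr)
    have h3 : Tendsto (fun r : ℝ => ENNReal.ofReal (2 * (1 - r * (f (r * Complex.I)).im))) atTop
        (𝓝 0) := by
      have h4 : Tendsto (fun r : ℝ => 2 * (1 - r * (f (r * Complex.I)).im)) atTop (𝓝 0) := by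
        have := (hinf.const_sub 1).const_mul 2
        simpa using this
      have := ENNReal.tendsto_ofReal h4
      simpa using this
    exact tendsto_of_tendsto_of_tendsto_of_le_of_le' tendsto_const_nhds h3
      (.of_forall fun _ => zero_le) hb
  set P : ℕ → ProbabilityMeasure ℝ := fun M => ⟨μ M, hμ M⟩ with hP
  have hcpt : IsCompact (closure (Set.range P)) := by
    refine isCompact_closure_of_isTightMeasureSet ?_
    have : {((μ : ProbabilityMeasure ℝ) : Measure ℝ) | μ ∈ Set.range P} = Set.range μ := by
      ext m
      constructor
      · rintro ⟨_, ⟨M, rfl⟩, rfl⟩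
        exact ⟨M, rfl⟩
      · rintro ⟨M, rfl⟩
        exact ⟨P M, ⟨M, rfl⟩, rfl⟩
    rwa [this]
  set l : Ultrafilter ℕ := Ultrafilter.of atTop
  obtain ⟨m, -, hm⟩ := hcpt.ultrafilter_le_nhds (l.map P) (by
    rw [le_principal_iff]
    exact Ultrafilter.mem_map.2 (Filter.univ_mem' fun M => subset_closure ⟨M, rfl⟩))
  have hm' : Tendsto P l (𝓝 m) := hm
  rw [ProbabilityMeasure.tendsto_iff_forall_integral_tendsto] at hm'
  refine ⟨m, inferInstance, fun z hz => ?_⟩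
  have h5 : Tendsto (fun M => stieltjes (μ M) z) l (𝓝 (stieltjes m z)) :=
    tendsto_integral_complex hm' (continuous_inv_ofReal_sub hz) _ (norm_inv_ofReal_sub_le hz)
  exact tendsto_nhds_unique h5 ((hconv z hz).mono_left (Ultrafilter.of_le _))

variable {ev : ∀ n : ℕ+, Fin n → ℝ} {nu0 : Measure ℝ} [IsProbabilityMeasure nu0]
  {U : ∀ n : ℕ+, Matrix (Fin n) (Fin n) ℂ} {s v : ℝ}

lemma gbar_lipschitz {n : ℕ} (hn : 0 < n) (e : Fin n → ℝ) (V : Matrix (Fin n) (Fin n) ℂ) (α : ℤˣ)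
    {z w : ℂ} (hz : z.im ≠ 0) (hw : w.im ≠ 0) :
    ‖gbar s v e V α z - gbar s v e V α w‖ ≤ |z.im|⁻¹ * |w.im|⁻¹ * ‖z - w‖ := by
  unfold gbar
  rw [← integral_sub (integrable_ptr s v e V hn hz α α _ 1 (by simp))
    (integrable_ptr s v e V hn hw α α _ 1 (by simp))]
  refine (norm_integral_le_of_norm_le_const (C := |z.im|⁻¹ * |w.im|⁻¹ * ‖z - w‖)
    (.of_forall fun x => ?_)).trans (by simp)
  obtain ⟨m, hm, h⟩ := ptr_spectral s v e V hn α x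
  rw [← h z hz, ← h w hw]
  exact norm_stieltjes_sub_le m hz hw

/-- `gbar` is an average of transforms of random measures. Rather than averaging measures, one
realization is selected whose partial traces are simultaneously close to their means on the finite
set `S`. -/
lemma spectral_approx (hU : ∀ n, (U n)ᴴ * U n = 1) {f : ℤˣ → ℂ → ℂ} (α : ℤˣ)
    (hf : ∀ z : ℂ, z.im ≠ 0 →
      Tendsto (fun n : ℕ+ => gbar s v (ev n) (U n) α z) atTop (𝓝 (f α z)))
    (S : Finset ℂ) (ε : ℝ) (hε : 0 < ε) (hS : ∀ z ∈ S, z.im ≠ 0) :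
    ∃ m : Measure ℝ, IsProbabilityMeasure m ∧ ∀ z ∈ S, ‖stieltjes m z - f α z‖ ≤ ε := by
  have h1 : Tendsto (fun n : ℕ+ => ∑ z ∈ S, (fluct v z 1 n + ‖gbar s v (ev n) (U n) α z - f α z‖))
      atTop (𝓝 0) := by
    rw [← Finset.sum_const_zero (s := S)]
    refine tendsto_finsetSum _ fun z hz => ?_
    have := (tendsto_fluct v z 1).add (tendsto_iff_norm_sub_tendsto_zero.1 (hf z (hS z hz)))
    simpa using this
  obtain ⟨n, hn⟩ := (h1.eventually (gt_mem_nhds hε)).exists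
  have hint : ∀ z ∈ S, Integrable (fun x => ‖ptr s v (ev n) (U n) z α α (fun _ => 1) x
      - gbar s v (ev n) (U n) α z‖ + ‖gbar s v (ev n) (U n) α z - f α z‖) (gaussians n) :=
    fun z hz => (((integrable_ptr s v (ev n) (U n) n.pos (hS z hz) α α _ 1 (by simp)).sub
      (integrable_const _)).norm).add (integrable_const _)
  -- Some realization does no worse than the mean of the total deviation, which is at most `ε`.
  obtain ⟨x, hx⟩ := exists_le_integral (integrable_finsetSum S hint)
  obtain ⟨m, hm, h⟩ := ptr_spectral s v (ev n) (U n) n.pos α x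
  have h2 : ∫ x, ∑ z ∈ S, (‖ptr s v (ev n) (U n) z α α (fun _ => 1) x
      - gbar s v (ev n) (U n) α z‖ + ‖gbar s v (ev n) (U n) α z - f α z‖) ∂(gaussians n) ≤ ε := by
    rw [integral_finsetSum S hint]
    refine le_trans (Finset.sum_le_sum fun z hz => ?_) hn.le
    rw [integral_add]
    · refine add_le_add ?_ (by simp)
      exact ptr_concentration s v (ev n) (U n) n.pos (hU n) (hS z hz) α α _ 1 zero_le_one (by simp)
    · exact ((integrable_ptr s v (ev n) (U n) n.pos (hS z hz) α α _ 1 (by simp)).sub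
        (integrable_const _)).norm
    · exact integrable_const _
  refine ⟨m, hm, fun z hz => ?_⟩
  rw [h z (hS z hz)]
  have h3 := Finset.single_le_sum (f := fun z => ‖ptr s v (ev n) (U n) z α α (fun _ => 1) x
      - gbar s v (ev n) (U n) α z‖ + ‖gbar s v (ev n) (U n) α z - f α z‖)
      (fun _ _ => by positivity) hz
  calc _ = ‖(ptr s v (ev n) (U n) z α α (fun _ => 1) x - gbar s v (ev n) (U n) α z)
        + (gbar s v (ev n) (U n) α z - f α z)‖ := by congr 1; ring
    _ ≤ _ := norm_add_le _ _
    _ ≤ _ := h3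
    _ ≤ _ := hx
    _ ≤ ε := h2

lemma norm_le_of_solvesAt {f : ℤˣ → ℂ → ℂ} {z : ℂ} (hz : z.im ≠ 0) (hf : SolvesAt nu0 s v f z)
    (α : ℤˣ) : ‖f α z‖ ≤ |z.im|⁻¹ := by
  rw [(hf α).2]
  exact (norm_integral_le_of_norm_le_const (.of_forall fun E =>
    norm_fE_le s v f α E hz (hf (-α)).1)).trans (by simp)

/-- By dominated convergence `-iy` times the one-particle function at `iy` tends to `1`, since the
self-energy tends to `0` and the product is bounded by `1`. The real part of the integrated
statement is the claim. -/
lemma solvesAt_at_infinity {f : ℤˣ → ℂ → ℂ} (hf : ∀ z : ℂ, z.im ≠ 0 → SolvesAt nu0 s v f z)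
    (α : ℤˣ) : Tendsto (fun y : ℝ => y * (f α (y * Complex.I)).im) atTop (𝓝 1) := by
  have hz : ∀ y : ℝ, 0 < y → ((y : ℂ) * Complex.I).im ≠ 0 := fun y hy => by simpa using hy.ne'
  have h1 : Tendsto (fun y : ℝ => ∫ E : ℝ, -(y * Complex.I) * fE s v f α E (y * Complex.I) ∂nu0)
      atTop (𝓝 (∫ _E : ℝ, (1 : ℂ) ∂nu0)) := by
    refine tendsto_integral_filter_of_dominated_convergence (fun _ => 1) ?_ ?_
      (integrable_const _) ?_
    · filter_upwards [eventually_gt_atTop 0] with y hy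
      exact (continuous_const.mul (continuous_fE s v f α (hz y hy)
        (hf _ (hz y hy) (-α)).1)).aestronglyMeasurable
    · filter_upwards [eventually_gt_atTop 0] with y hy
      refine .of_forall fun E => ?_
      have := norm_fE_le s v f α E (hz y hy) (hf _ (hz y hy) (-α)).1
      simp only [Complex.mul_im, Complex.ofReal_re, Complex.I_im, mul_one, Complex.ofReal_im,
        Complex.I_re, mul_zero, add_zero, abs_of_pos hy] at this
      rw [norm_mul, norm_neg, norm_mul, Complex.norm_I, mul_one, Complex.norm_real,
        Real.norm_eq_abs, abs_of_pos hy]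
      calc y * _ ≤ y * y⁻¹ := by gcongr
        _ = 1 := mul_inv_cancel₀ hy.ne'
    · refine .of_forall fun E => ?_
      have h2 : Tendsto (fun y : ℝ => ((y⁻¹ : ℝ) : ℂ)) atTop (𝓝 0) := by
        have := (Complex.continuous_ofReal.tendsto 0).comp tendsto_inv_atTop_zero
        simpa only [Function.comp_def, Complex.ofReal_zero] using this
      have h3 : Tendsto (fun y : ℝ => f (-α) (y * Complex.I)) atTop (𝓝 0) := by
        refine squeeze_zero_norm' ?_ tendsto_inv_atTop_zero
        filter_upwards [eventually_gt_atTop 0] with y hy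
        have := norm_le_of_solvesAt (hz y hy) (hf _ (hz y hy)) (-α)
        simpa [abs_of_pos hy] using this
      have h4 : Tendsto (fun y : ℝ => 1 + Complex.I * ((y⁻¹ : ℝ) : ℂ) *
          ((E : ℂ) + sgn α * s - (v : ℂ) ^ 2 * f (-α) (y * Complex.I))) atTop
          (𝓝 (1 + Complex.I * 0 * ((E : ℂ) + sgn α * s - (v : ℂ) ^ 2 * 0))) :=
        ((h2.const_mul _).mul ((h3.const_mul _).const_sub _)).const_add _
      have h5 := h4.inv₀ (by simp)
      simp only [mul_zero, zero_mul, add_zero, inv_one] at h5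
      refine h5.congr' ?_
      filter_upwards [eventually_gt_atTop 0] with y hy
      have hD := fE_denominator_ne_zero s v E α (hz y hy) (hf _ (hz y hy) (-α)).1
      have hy' : (y : ℂ) ≠ 0 := by exact_mod_cast hy.ne'
      unfold fE
      have hI := Complex.I_mul_I
      have : 1 + Complex.I * ((y⁻¹ : ℝ) : ℂ) *
          ((E : ℂ) + sgn α * s - (v : ℂ) ^ 2 * f (-α) (y * Complex.I))
          = Complex.I * (y : ℂ)⁻¹ * ((E : ℂ) + sgn α * s - y * Complex.I
            - (v : ℂ) ^ 2 * f (-α) (y * Complex.I)) := by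
        push_cast
        have : Complex.I * (y : ℂ)⁻¹ * (y * Complex.I) = -1 := by
          field_simp; rw [← hI]; ring
        linear_combination this
      rw [this, mul_inv, mul_inv, inv_inv, Complex.inv_I]
      ring
  have h6 := (Complex.continuous_re.tendsto _).comp h1
  simp only [integral_const, probReal_univ, one_smul, Complex.one_re] at h6
  refine h6.congr' ?_
  filter_upwards [eventually_gt_atTop 0] with y hy
  simp only [Function.comp_apply]
  rw [integral_const_mul, ← (hf _ (hz y hy) α).2]
  simp

/-- Existence of the limiting measures. -/
lemma exists_measures (hU : ∀ n, (U n)ᴴ * U n = 1) {f : ℤˣ → ℂ → ℂ}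
    (hf : ∀ z : ℂ, z.im ≠ 0 → SolvesAt nu0 s v f z ∧
      ∀ α, Tendsto (fun n : ℕ+ => gbar s v (ev n) (U n) α z) atTop (𝓝 (f α z))) :
    ∃ nu : ℤˣ → Measure ℝ, (∀ α, IsProbabilityMeasure (nu α)) ∧
      ∀ α (z : ℂ), z.im ≠ 0 → stieltjes (nu α) z = f α z := by
  have : ∀ α, ∃ m : Measure ℝ, IsProbabilityMeasure m ∧ ∀ z : ℂ, z.im ≠ 0 →
      stieltjes m z = f α z := by
    intro α
    refine exists_measure_of_approx (f α)
      (spectral_approx hU α fun z hz => (hf z hz).2 α) (fun z w hz hw => ?_)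
      (solvesAt_at_infinity (fun z hz => (hf z hz).1) α)
    exact le_of_tendsto' (((hf z hz).2 α).sub ((hf w hw).2 α)).norm
      fun n => gbar_lipschitz n.pos (ev n) (U n) α hz hw
  choose nu hnu h using this
  exact ⟨nu, hnu, h⟩

lemma fE_congr {f g : ℤˣ → ℂ → ℂ} {z : ℂ} (h : ∀ α, f α z = g α z) (α : ℤˣ) (E : ℝ) :
    fE s v f α E z = fE s v g α E z := by
  unfold fE; rw [h]

omit [IsProbabilityMeasure nu0] in
lemma SolvesAt.congr {f g : ℤˣ → ℂ → ℂ} {z : ℂ} (hf : SolvesAt nu0 s v f z)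
    (h : ∀ α, f α z = g α z) : SolvesAt nu0 s v g z := by
  intro α
  simp only [← fE_congr h, ← h]
  exact hf α

lemma isSolution_stieltjes {nu : ℤˣ → Measure ℝ} [∀ α, IsProbabilityMeasure (nu α)]
    (h : ∀ z : ℂ, z.im ≠ 0 → SolvesAt nu0 s v (fun α => stieltjes (nu α)) z) :
    IsSolution nu0 s v (fun α => stieltjes (nu α)) where
  analytic α := differentiableOn_stieltjes (nu α)
  im_pos α z hz := im_mul_pos_of_solvesAt hz (h z hz) α
  eqn α z hz := (h z hz α).2

end Reconstruction

/-! ### The limit of the mean product of two resolvents -/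

section TwoPointLimit

variable {ev : ∀ n : ℕ+, Fin n → ℝ} {nu0 : Measure ℝ} [IsProbabilityMeasure nu0]
  {U : ∀ n : ℕ+, Matrix (Fin n) (Fin n) ℂ} {s v : ℝ}

omit [IsProbabilityMeasure nu0] in
lemma tendsto_fE {f : ℤˣ → ℂ → ℂ} {z : ℂ} (hz : z.im ≠ 0) (hf : SolvesAt nu0 s v f z)
    (hg : ∀ α, Tendsto (fun n : ℕ+ => gbar s v (ev n) (U n) α z) atTop (𝓝 (f α z)))
    {e : ℕ+ → ℝ} {E : ℝ} (he : Tendsto e atTop (𝓝 E)) (α : ℤˣ) :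
    Tendsto (fun n => fE s v (gbar s v (ev n) (U n)) α (e n) z) atTop (𝓝 (fE s v f α E z)) := by
  unfold fE
  refine Tendsto.inv₀ ?_ (fE_denominator_ne_zero s v E α hz (hf (-α)).1)
  exact (((((Complex.continuous_ofReal.tendsto E).comp he).add_const _).sub_const _).sub
    ((hg (-α)).const_mul _))

lemma tendsto_average_mul (hconv : ∀ φ : ℝ →ᵇ ℝ,
      Tendsto (fun n : ℕ+ => ∫ x, φ x ∂(countingMeasure (ev n))) atTop (𝓝 (∫ x, φ x ∂nu0)))
    {f : ℤˣ → ℂ → ℂ} {z w : ℂ} (hz : z.im ≠ 0) (hw : w.im ≠ 0)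
    (hfz : SolvesAt nu0 s v f z) (hfw : SolvesAt nu0 s v f w)
    (hgz : ∀ α, Tendsto (fun n : ℕ+ => gbar s v (ev n) (U n) α z) atTop (𝓝 (f α z)))
    (hgw : ∀ α, Tendsto (fun n : ℕ+ => gbar s v (ev n) (U n) α w) atTop (𝓝 (f α w))) (α δ : ℤˣ) :
    Tendsto (fun n : ℕ+ => ((n : ℕ) : ℂ)⁻¹ * ∑ a, fE s v (gbar s v (ev n) (U n)) α (ev n a) z *
      fE s v (gbar s v (ev n) (U n)) δ (ev n a) w) atTop (𝓝 (twoPoint nu0 s v f α δ z w)) := by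
  have hb : ∀ E : ℝ, ‖fE s v f α E z * fE s v f δ E w‖ ≤ |z.im|⁻¹ * |w.im|⁻¹ := fun E => by
    rw [norm_mul]
    exact mul_le_mul (norm_fE_le s v f α E hz (hfz (-α)).1) (norm_fE_le s v f δ E hw (hfw (-δ)).1)
      (norm_nonneg _) (by positivity)
  have h0 := ((tendsto_norm_sub (hgz (-α)) (v ^ 2) (|z.im|⁻¹ * |z.im|⁻¹)).mul_const |w.im|⁻¹).add
    ((tendsto_norm_sub (hgw (-δ)) (v ^ 2) (|w.im|⁻¹ * |w.im|⁻¹)).const_mul |z.im|⁻¹)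
  simp only [zero_mul, mul_zero, add_zero] at h0
  refine tendsto_average hconv le_rfl (φ := fun E => fE s v f α E z * fE s v f δ E w)
    (ψ := fun n E => fE s v (gbar s v (ev n) (U n)) α E z * fE s v (gbar s v (ev n) (U n)) δ E w)
    ((continuous_fE s v f α hz (hfz (-α)).1).mul (continuous_fE s v f δ hw (hfw (-δ)).1)) _ hb h0
    fun n E => ?_
  have g1 := gbar_im_mul_nonneg s v (ev n) (U n) n.pos (-α) hz
  have g2 := gbar_im_mul_nonneg s v (ev n) (U n) n.pos (-δ) hw
  calc _ = ‖(fE s v (gbar s v (ev n) (U n)) α E z - fE s v f α E z)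
          * fE s v (gbar s v (ev n) (U n)) δ E w
        + fE s v f α E z * (fE s v (gbar s v (ev n) (U n)) δ E w - fE s v f δ E w)‖ := by
        congr 1; ring
    _ ≤ _ := by
        refine (norm_add_le _ _).trans ?_
        rw [norm_mul, norm_mul]
        refine add_le_add ?_ ?_
        · exact mul_le_mul (norm_fE_sub_fE_le hz α g1 (hfz (-α)).1 E) (norm_fE_le s v _ δ E hw g2)
            (norm_nonneg _) (by positivity)
        · exact mul_le_mul (norm_fE_le s v f α E hz (hfz (-α)).1)
            (norm_fE_sub_fE_le hw δ g2 (hfw (-δ)).1 E) (norm_nonneg _) (by positivity)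

/-- The limit of the mean two-resolvent function. -/
noncomputable def twoGreenLimit (nu0 : Measure ℝ) (s v : ℝ) (f : ℤˣ → ℂ → ℂ) (E : ℝ)
    (α δ β γ : ℤˣ) (z w : ℂ) : ℂ :=
  ((if α = β ∧ δ = γ then fE s v f α E z * fE s v f δ E w else 0)
    + (v : ℂ) ^ 2 * twoPoint nu0 s v f α δ z w *
      (if -α = β ∧ -δ = γ then fE s v f (-α) E z * fE s v f (-δ) E w else 0))
    / denom nu0 s v f α δ z w

/-- The approximate equations for `(α, δ)` and `(-α, -δ)` form a two-by-two linear system.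
Eliminating the flipped unknown divides by a quantity tending to `denom`, which is nonzero; no a
priori convergence of the unknowns is needed. -/
lemma tendsto_twoGreen (hU : ∀ n, (U n)ᴴ * U n = 1) (hconv : ∀ φ : ℝ →ᵇ ℝ,
      Tendsto (fun n : ℕ+ => ∫ x, φ x ∂(countingMeasure (ev n))) atTop (𝓝 (∫ x, φ x ∂nu0)))
    {f : ℤˣ → ℂ → ℂ} {z w : ℂ} (hz : z.im ≠ 0) (hw : w.im ≠ 0)
    (hfz : SolvesAt nu0 s v f z) (hfw : SolvesAt nu0 s v f w)
    (hgz : ∀ α, Tendsto (fun n : ℕ+ => gbar s v (ev n) (U n) α z) atTop (𝓝 (f α z)))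
    (hgw : ∀ α, Tendsto (fun n : ℕ+ => gbar s v (ev n) (U n) α w) atTop (𝓝 (f α w)))
    {k : ∀ n : ℕ+, Fin n} {E : ℝ} (hE : Tendsto (fun n : ℕ+ => ev n (k n)) atTop (𝓝 E))
    (α δ β γ : ℤˣ) :
    Tendsto (fun n : ℕ+ => ∫ x, twoGreen s v (ev n) (U n) z w α δ (fun _ => 1) (γ, k n) (β, k n) x
      ∂(gaussians n)) atTop (𝓝 (twoGreenLimit nu0 s v f E α δ β γ z w)) := by
  set X : ℤˣ → ℤˣ → ℕ+ → ℂ := fun α δ n =>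
    ∫ x, twoGreen s v (ev n) (U n) z w α δ (fun _ => 1) (γ, k n) (β, k n) x ∂(gaussians n)
  set R : ℤˣ → ℤˣ → ℕ+ → ℂ := fun α δ n => ((n : ℕ) : ℂ)⁻¹ *
    ∑ a, fE s v (gbar s v (ev n) (U n)) α (ev n a) z * fE s v (gbar s v (ev n) (U n)) δ (ev n a) w
  set A : ℤˣ → ℤˣ → ℕ+ → ℂ := fun α δ n => if α = β ∧ δ = γ then
    fE s v (gbar s v (ev n) (U n)) α (ev n (k n)) z * fE s v (gbar s v (ev n) (U n)) δ (ev n (k n)) w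
    else 0
  set A' : ℤˣ → ℤˣ → ℂ := fun α δ => if α = β ∧ δ = γ then
    fE s v f α E z * fE s v f δ E w else 0
  have hR : ∀ α δ, Tendsto (R α δ) atTop (𝓝 (twoPoint nu0 s v f α δ z w)) := fun α δ =>
    tendsto_average_mul hconv hz hw hfz hfw hgz hgw α δ
  have hA : ∀ α δ, Tendsto (A α δ) atTop (𝓝 (A' α δ)) := by
    intro α δ
    by_cases h : α = β ∧ δ = γ
    · simp only [A, A', if_pos h]
      exact (tendsto_fE hz hfz hgz hE α).mul (tendsto_fE hw hfw hgw hE δ)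
    · simp only [A, A', if_neg h]
      exact tendsto_const_nhds
  set err : ℤˣ → ℤˣ → ℕ+ → ℂ := fun α δ n =>
    X α δ n - (A α δ n + (v : ℂ) ^ 2 * R α δ n * X (-α) (-δ) n)
  have herr : ∀ α δ, Tendsto (err α δ) atTop (𝓝 0) := fun α δ =>
    squeeze_zero_norm (fun n => two_point_equation s v (ev n) (U n) n.pos (hU n) hz hw α δ β γ (k n))
      (tendsto_twoPointError v z w)
  have hden := denom_ne_zero_of_solvesAt hz hw hfz hfw α δ
  have hd : Tendsto (fun n => 1 - (v : ℂ) ^ 4 * R α δ n * R (-α) (-δ) n) atTop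
      (𝓝 (denom nu0 s v f α δ z w)) :=
    (((hR α δ).const_mul _).mul (hR (-α) (-δ))).const_sub 1
  have hnum : Tendsto (fun n => (A α δ n + err α δ n) +
      (v : ℂ) ^ 2 * R α δ n * (A (-α) (-δ) n + err (-α) (-δ) n)) atTop
      (𝓝 ((A' α δ + 0) + (v : ℂ) ^ 2 * twoPoint nu0 s v f α δ z w * (A' (-α) (-δ) + 0))) :=
    ((hA α δ).add (herr α δ)).add (((hR α δ).const_mul _).mul ((hA (-α) (-δ)).add (herr (-α) (-δ))))
  rw [add_zero, add_zero] at hnum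
  refine (hnum.div hd hden).congr' ?_
  -- For large `n` the elimination is an exact algebraic identity, the errors being included in the
  -- numerator.
  filter_upwards [hd.eventually_ne hden] with n hn
  rw [Pi.div_apply, div_eq_iff hn]
  simp only [err, X, neg_neg]
  ring

omit [IsProbabilityMeasure nu0] in
-- Of the four pairs `(β, γ)` only `(α, δ)` and `(-α, -δ)` contribute, giving the two terms of the
-- numerator.
lemma sum_twoGreenLimit (f : ℤˣ → ℂ → ℂ) (rho0 : Matrix ℤˣ ℤˣ ℂ) (E t : ℝ) (α δ : ℤˣ) (z w : ℂ) :
    integrand nu0 s v f rho0 E t α δ z w = ∑ β, ∑ γ, rho0 β γ *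
      (Complex.exp (Complex.I * (t : ℂ) * (w - z)) * twoGreenLimit nu0 s v f E α δ β γ z w) := by
  unfold integrand twoGreenLimit
  rw [sum_units α, sum_units δ, sum_units δ]
  have h1 := neg_unit_ne α
  have h2 := neg_unit_ne δ
  simp only [h1, h2, h1.symm, h2.symm, and_self, and_false, and_true, if_true,
    if_false, mul_zero, add_zero, zero_add, zero_div]
  ring

end TwoPointLimit
-- Interchange of the Laplace transform with the expectation
lemma laplace_integral {X : Type*} [MeasurableSpace X] {μ : Measure X} [IsFiniteMeasure μ]
    {k : X → ℝ → ℂ} (hk : AEStronglyMeasurable (Function.uncurry k) (μ.prod volume)) (C : ℝ)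
    (hC : ∀ x t, ‖k x t‖ ≤ C) {z : ℂ} (hz : 0 < z.im) :
    laplace (fun τ => ∫ x, k x τ ∂μ) z = ∫ x, laplace (k x) z ∂μ := by
  unfold laplace
  rw [integral_integral_swap]
  · refine integral_congr_ae (.of_forall fun τ => ?_)
    simp only
    rw [integral_const_mul]
  · have h1 : Integrable (fun p : X × ℝ => Real.exp (-z.im * p.2) * C)
        (μ.prod (volume.restrict (Set.Ioi 0))) := by
      have h2 : Integrable (fun τ : ℝ => Real.exp (-z.im * τ) * C) (volume.restrict (Set.Ioi 0)) :=
        (integrableOn_exp_mul_Ioi (by linarith) 0).mul_const C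
      have := (integrable_const (1 : ℝ) (μ := μ)).mul_prod h2
      simpa using this
    refine h1.mono' ?_ (.of_forall fun p => ?_)
    · refine AEStronglyMeasurable.mul ?_ ?_
      · have hc : Continuous fun τ : ℝ => Complex.exp (Complex.I * z * τ) := by fun_prop
        exact (hc.measurable.comp measurable_snd).aestronglyMeasurable
      · refine hk.mono_measure ?_
        exact Measure.prod_mono le_rfl Measure.restrict_le_self
    · simp only [Function.uncurry]
      rw [norm_mul, norm_exp_I_mul_complex, neg_mul]
      gcongr
      exact hC _ _

/-! ### Mean evolutions at two times: uniform Lipschitz bounds and Laplace transforms -/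

section Dynamics

open scoped Matrix.Norms.L2Operator

variable {n : ℕ} (s v : ℝ) (e : Fin n → ℝ) (U : Matrix (Fin n) (Fin n) ℂ)

lemma continuous_evolution :
    Continuous fun p : (Fin n → Fin n → ℝ) × ℝ => evolution (ham s v e U p.1) p.2 := by
  unfold evolution
  let _ : NormedAlgebra ℚ (Matrix (ℤˣ × Fin n) (ℤˣ × Fin n) ℂ) := NormedAlgebra.restrictScalars ℚ ℂ _
  refine NormedSpace.exp_continuous.comp ?_
  have h1 : Continuous fun p : (Fin n → Fin n → ℝ) × ℝ => Complex.I * (p.2 : ℂ) := by fun_prop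
  exact h1.smul ((continuous_ham s v e U).comp continuous_fst)

/-- A column of the Hamiltonian has one deterministic entry and `n` random entries of variance `v² /
n`, so the bound depends on `n` only through the energy `e p.2`. -/
lemma integral_sum_norm_ham_le (hn : 0 < n) (hU : Uᴴ * U = 1) (p : ℤˣ × Fin n) :
    Integrable (fun x => ∑ a, ‖ham s v e U x a p‖ ^ 2) (gaussians n) ∧
    ∫ x, ∑ a, ‖ham s v e U x a p‖ ^ 2 ∂(gaussians n) ≤ 2 * (|e p.2| + |s|) ^ 2 + 2 * v ^ 2 := by
  have hcpl : ‖cpl v n‖ ^ 2 * n = v ^ 2 := by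
    have := congrArg norm (cpl_sq v hn)
    rw [norm_mul, norm_mul, norm_pow, Complex.norm_real, Real.norm_eq_abs, sq_abs,
      Complex.norm_natCast] at this
    rw [sq]; exact this
  have hb : ∀ x, ∑ a, ‖ham s v e U x a p‖ ^ 2
      ≤ 2 * (|e p.2| + |s|) ^ 2 + 2 * ‖cpl v n‖ ^ 2 * ∑ b, ‖rotGue U x b p.2‖ ^ 2 := by
    intro x
    have h1 : ∀ a, ‖ham s v e U x a p‖ ^ 2 ≤ 2 * (if a = p then (|e p.2| + |s|) ^ 2 else 0)
        + 2 * ‖coup v (rotGue U x) a p‖ ^ 2 := by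
      intro a
      rw [ham_eq, Matrix.add_apply, diagonal_apply]
      have h2 : ∀ u w : ℂ, ‖u + w‖ ^ 2 ≤ 2 * ‖u‖ ^ 2 + 2 * ‖w‖ ^ 2 := fun u w => by
        have := norm_add_le u w
        have h3 : ‖u + w‖ ^ 2 ≤ (‖u‖ + ‖w‖) ^ 2 := by gcongr
        nlinarith [sq_nonneg (‖u‖ - ‖w‖)]
      refine (h2 _ _).trans ?_
      gcongr
      split_ifs with h
      · subst h
        gcongr
        refine (norm_add_le _ _).trans ?_
        have : ‖sgn a.1‖ = 1 := by
          rcases Int.units_eq_one_or a.1 with h | h <;> simp [sgn, h]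
        rw [norm_mul, this, one_mul, Complex.norm_real, Complex.norm_real]
        rfl
      · simp
    refine (Finset.sum_le_sum fun a _ => h1 a).trans ?_
    rw [Finset.sum_add_distrib, ← Finset.mul_sum, ← Finset.mul_sum, Finset.sum_ite_eq',
      if_pos (Finset.mem_univ _), mul_assoc]
    gcongr
    rw [Fintype.sum_prod_type, Finset.sum_eq_single (-p.1), Finset.mul_sum]
    · refine Finset.sum_le_sum fun b _ => ?_
      rw [coup_apply, if_pos (by simp), norm_mul, mul_pow]
    · intro β _ hβ
      refine Finset.sum_eq_zero fun b _ => ?_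
      rw [coup_apply, if_neg (fun h => hβ (by simp [h])), norm_zero]
      simp
    · exact fun h => absurd (Finset.mem_univ _) h
  have hW := fun b => integral_norm_sq_rotGue U hU b p.2
  have hi : Integrable (fun x => 2 * (|e p.2| + |s|) ^ 2 +
      2 * ‖cpl v n‖ ^ 2 * ∑ b, ‖rotGue U x b p.2‖ ^ 2) (gaussians n) :=
    (integrable_const _).add ((integrable_finsetSum _ fun b _ => (hW b).1).const_mul _)
  have hc : Continuous fun x => ∑ a, ‖ham s v e U x a p‖ ^ 2 :=
    continuous_finsetSum _ fun a _ => (((continuous_ham s v e U).matrix_elem a p).norm.pow 2)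
  refine ⟨hi.mono' hc.aestronglyMeasurable (.of_forall fun x => ?_), ?_⟩
  · rw [Real.norm_eq_abs, abs_of_nonneg (by positivity)]
    exact hb x
  · refine (integral_mono_of_nonneg (.of_forall fun x => by positivity) hi
      (.of_forall hb)).trans (le_of_eq ?_)
    rw [integral_add (integrable_const _)
      ((integrable_finsetSum _ fun b _ => (hW b).1).const_mul _),
      integral_const_mul (2 * ‖cpl v n‖ ^ 2), integral_finsetSum _ fun b _ => (hW b).1]
    simp only [(hW _).2, Finset.sum_const, Finset.card_univ, Fintype.card_fin, nsmul_eq_mul,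
      mul_one, integral_const, probReal_univ, smul_eq_mul, one_mul]
    linear_combination 2 * hcpl

/-- A Lipschitz constant in time for mean evolutions. -/
noncomputable def speed (s v e : ℝ) : ℝ := (1 + (2 * (|e| + |s|) ^ 2 + 2 * v ^ 2)) / 2

/-- The Lipschitz estimates need the first moment of the column norm; `√S ≤ (1 + S) / 2` reduces it
to the second, which explains the form of `speed`. -/
lemma integral_sqrt_ham_le (hn : 0 < n) (hU : Uᴴ * U = 1) (p : ℤˣ × Fin n) :
    Integrable (fun x => Real.sqrt (∑ a, ‖ham s v e U x a p‖ ^ 2)) (gaussians n) ∧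
    ∫ x, Real.sqrt (∑ a, ‖ham s v e U x a p‖ ^ 2) ∂(gaussians n) ≤ speed s v (e p.2) := by
  obtain ⟨h1, h2⟩ := integral_sum_norm_ham_le s v e U hn hU p
  have hb : ∀ x, Real.sqrt (∑ a, ‖ham s v e U x a p‖ ^ 2)
      ≤ (1 + ∑ a, ‖ham s v e U x a p‖ ^ 2) / 2 := by
    intro x
    have h3 : 0 ≤ ∑ a, ‖ham s v e U x a p‖ ^ 2 := by positivity
    nlinarith [Real.sq_sqrt h3, sq_nonneg (Real.sqrt (∑ a, ‖ham s v e U x a p‖ ^ 2) - 1)]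
  have hi : Integrable (fun x => (1 + ∑ a, ‖ham s v e U x a p‖ ^ 2) / 2) (gaussians n) :=
    ((integrable_const _).add h1).div_const _
  have hc : Continuous fun x => ∑ a, ‖ham s v e U x a p‖ ^ 2 :=
    continuous_finsetSum _ fun a _ => (((continuous_ham s v e U).matrix_elem a p).norm.pow 2)
  refine ⟨hi.mono' (Real.continuous_sqrt.comp hc).aestronglyMeasurable (.of_forall fun x => ?_), ?_⟩
  · rw [Real.norm_eq_abs, abs_of_nonneg (Real.sqrt_nonneg _)]
    exact hb x
  · refine (integral_mono_of_nonneg (.of_forall fun x => Real.sqrt_nonneg _) hi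
      (.of_forall hb)).trans ?_
    rw [integral_div, integral_add (integrable_const _) h1]
    unfold speed
    simp only [integral_const, probReal_univ, smul_eq_mul, mul_one]
    linarith

/-- The matrix `G(z) J e^{itH}`. -/
noncomputable def halfMatrix (α δ : ℤˣ) (z : ℂ) (x : Fin n → Fin n → ℝ) (t : ℝ) :
    Matrix (ℤˣ × Fin n) (ℤˣ × Fin n) ℂ :=
  GX s v e U z x * pairing α δ (fun _ => 1) * evolution (ham s v e U x) t

/-- The matrix `e^{it₂H} J e^{it₁H}`. -/
noncomputable def evolvedMatrix (α δ : ℤˣ) (x : Fin n → Fin n → ℝ) (t₁ t₂ : ℝ) :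
    Matrix (ℤˣ × Fin n) (ℤˣ × Fin n) ℂ :=
  evolution (ham s v e U x) t₂ * (pairing α δ (fun _ => 1) * evolution (ham s v e U x) t₁)

/-- The mean of `(G(z) J e^{-itH})` at the entry `((γ, m), (β, m))`. -/
noncomputable def halfEvolved (α δ β γ : ℤˣ) (m : Fin n) (z : ℂ) (t : ℝ) : ℂ :=
  ∫ x, halfMatrix s v e U α δ z x (-t) (γ, m) (β, m)
    ∂(gaussians n)

/-- The mean of `(e^{it₂H} J e^{-it₁H})` at the entry `((γ, m), (β, m))`. -/
noncomputable def evolved (α δ β γ : ℤˣ) (m : Fin n) (t₁ t₂ : ℝ) : ℂ :=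
  ∫ x, evolvedMatrix s v e U α δ x (-t₁) t₂ (γ, m) (β, m) ∂(gaussians n)

lemma norm_pairing_one_le (α δ : ℤˣ) : ‖pairing α δ (fun _ : Fin n => (1 : ℂ))‖ ≤ 1 :=
  norm_pairing_le α δ _ 1 zero_le_one (by simp)

lemma norm_half_le {z : ℂ} (hz : z.im ≠ 0) (α δ : ℤˣ) (x : Fin n → Fin n → ℝ) :
    ‖GX s v e U z x * pairing α δ (fun _ => 1)‖ ≤ |z.im|⁻¹ := by
  refine (l2_opNorm_mul _ _).trans ?_
  calc _ ≤ |z.im|⁻¹ * 1 := by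
        gcongr
        · exact norm_GX_le s v e U hz x
        · exact norm_pairing_one_le α δ
    _ = _ := mul_one _

lemma norm_half_entry_le {z : ℂ} (hz : z.im ≠ 0) (α δ : ℤˣ) (q p : ℤˣ × Fin n)
    (x : Fin n → Fin n → ℝ) (t : ℝ) :
    ‖halfMatrix s v e U α δ z x t q p‖
      ≤ |z.im|⁻¹ := by
  refine (norm_entry_le _ q p).trans ((l2_opNorm_mul _ _).trans ?_)
  calc _ ≤ |z.im|⁻¹ * 1 := by
        gcongr
        · exact norm_half_le s v e U hz α δ x
        · exact norm_evolution_le (ham_isHermitian s v e U x) t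
    _ = _ := mul_one _

lemma norm_pairing_evolution_le (α δ : ℤˣ) (x : Fin n → Fin n → ℝ) (t : ℝ) :
    ‖pairing α δ (fun _ => 1) * evolution (ham s v e U x) t‖ ≤ 1 := by
  refine (l2_opNorm_mul _ _).trans ?_
  exact mul_le_one₀ (norm_pairing_one_le α δ) (norm_nonneg _)
    (norm_evolution_le (ham_isHermitian s v e U x) t)

lemma norm_evolved_entry_le (α δ : ℤˣ) (q p : ℤˣ × Fin n) (x : Fin n → Fin n → ℝ) (t₁ t₂ : ℝ) :
    ‖evolvedMatrix s v e U α δ x t₁ t₂ q p‖ ≤ 1 := by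
  refine (norm_entry_le _ q p).trans ((l2_opNorm_mul _ _).trans ?_)
  exact mul_le_one₀ (norm_evolution_le (ham_isHermitian s v e U x) t₂) (norm_nonneg _)
    (norm_pairing_evolution_le s v e U α δ x t₁)

lemma continuous_half_entry {z : ℂ} (hz : z.im ≠ 0) (α δ : ℤˣ) (q p : ℤˣ × Fin n) :
    Continuous fun y : (Fin n → Fin n → ℝ) × ℝ =>
      halfMatrix s v e U α δ z y.1 (-y.2) q p := by
  have h1 : Continuous fun y : (Fin n → Fin n → ℝ) × ℝ => evolution (ham s v e U y.1) (-y.2) :=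
    (continuous_evolution s v e U).comp (continuous_fst.prodMk continuous_snd.neg)
  exact ((((continuous_GX s v e U hz).comp continuous_fst).matrix_mul
    continuous_const).matrix_mul h1).matrix_elem q p

lemma continuous_evolved_entry (α δ : ℤˣ) (q p : ℤˣ × Fin n) :
    Continuous fun y : (Fin n → Fin n → ℝ) × ℝ × ℝ =>
      evolvedMatrix s v e U α δ y.1 (-y.2.1) y.2.2 q p := by
  have h1 : Continuous fun y : (Fin n → Fin n → ℝ) × ℝ × ℝ =>
      evolution (ham s v e U y.1) (-y.2.1) :=
    (continuous_evolution s v e U).comp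
      (continuous_fst.prodMk (continuous_fst.comp continuous_snd).neg)
  have h2 : Continuous fun y : (Fin n → Fin n → ℝ) × ℝ × ℝ =>
      evolution (ham s v e U y.1) y.2.2 :=
    (continuous_evolution s v e U).comp
      (continuous_fst.prodMk (continuous_snd.comp continuous_snd))
  exact (h2.matrix_mul (continuous_const.matrix_mul h1)).matrix_elem q p

lemma integrable_half {z : ℂ} (hz : z.im ≠ 0) (α δ : ℤˣ) (q p : ℤˣ × Fin n) (t : ℝ) :
    Integrable (fun x => halfMatrix s v e U α δ z x (-t) q p) (gaussians n) := by
  have := (continuous_half_entry s v e U hz α δ q p).comp (continuous_id.prodMk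
    (continuous_const (y := t)))
  exact integrable_of_bound this.aestronglyMeasurable _
    fun x => norm_half_entry_le s v e U hz α δ q p x _

lemma integrable_evolved (α δ : ℤˣ) (q p : ℤˣ × Fin n) (t₁ t₂ : ℝ) :
    Integrable (fun x => evolvedMatrix s v e U α δ x (-t₁) t₂ q p) (gaussians n) := by
  have := (continuous_evolved_entry s v e U α δ q p).comp (continuous_id.prodMk
    (continuous_const (y := (t₁, t₂))))
  exact integrable_of_bound this.aestronglyMeasurable _
    fun x => norm_evolved_entry_le s v e U α δ q p x _ _

variable (α δ β γ : ℤˣ) (m : Fin n)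

lemma norm_halfEvolved_le {z : ℂ} (hz : z.im ≠ 0) (t : ℝ) :
    ‖halfEvolved s v e U α δ β γ m z t‖ ≤ |z.im|⁻¹ :=
  (norm_integral_le_of_norm_le_const (.of_forall fun x =>
    norm_half_entry_le s v e U hz α δ (γ, m) (β, m) x (-t))).trans (by simp)

lemma norm_evolved_le (t₁ t₂ : ℝ) : ‖evolved s v e U α δ β γ m t₁ t₂‖ ≤ 1 :=
  (norm_integral_le_of_norm_le_const (.of_forall fun x =>
    norm_evolved_entry_le s v e U α δ (γ, m) (β, m) x (-t₁) t₂)).trans (by simp)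

lemma halfEvolved_lipschitz (hn : 0 < n) (hU : Uᴴ * U = 1) {z : ℂ} (hz : z.im ≠ 0) (t t' : ℝ) :
    ‖halfEvolved s v e U α δ β γ m z t - halfEvolved s v e U α δ β γ m z t'‖
      ≤ |z.im|⁻¹ * speed s v (e m) * |t - t'| := by
  unfold halfEvolved
  rw [← integral_sub (integrable_half s v e U hz α δ _ _ t)
    (integrable_half s v e U hz α δ _ _ t')]
  obtain ⟨h1, h2⟩ := integral_sqrt_ham_le s v e U hn hU (β, m)
  calc _ ≤ ∫ x, |z.im|⁻¹ * Real.sqrt (∑ a, ‖ham s v e U x a (β, m)‖ ^ 2) * |t - t'|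
        ∂(gaussians n) := by
        refine norm_integral_le_of_norm_le ((h1.const_mul _).mul_const _) (.of_forall fun x => ?_)
        refine (norm_mul_evolution_sub_le (ham_isHermitian s v e U x) _ _ _ _ _).trans ?_
        rw [show -t - -t' = -(t - t') by ring, abs_neg]
        gcongr
        exact norm_half_le s v e U hz α δ x
    _ ≤ _ := by
        rw [integral_mul_const, integral_const_mul]
        gcongr

lemma evolved_lipschitz_left (hn : 0 < n) (hU : Uᴴ * U = 1) (t₁ t₁' t₂ : ℝ) :
    ‖evolved s v e U α δ β γ m t₁ t₂ - evolved s v e U α δ β γ m t₁' t₂‖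
      ≤ speed s v (e m) * |t₁ - t₁'| := by
  unfold evolved
  rw [← integral_sub (integrable_evolved s v e U α δ _ _ t₁ t₂)
    (integrable_evolved s v e U α δ _ _ t₁' t₂)]
  obtain ⟨h1, h2⟩ := integral_sqrt_ham_le s v e U hn hU (β, m)
  calc _ ≤ ∫ x, Real.sqrt (∑ a, ‖ham s v e U x a (β, m)‖ ^ 2) * |t₁ - t₁'| ∂(gaussians n) := by
        refine norm_integral_le_of_norm_le (h1.mul_const _) (.of_forall fun x => ?_)
        unfold evolvedMatrix
        rw [← Matrix.mul_assoc, ← Matrix.mul_assoc]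
        refine (norm_mul_evolution_sub_le (ham_isHermitian s v e U x) _ _ _ _ _).trans ?_
        rw [show -t₁ - -t₁' = -(t₁ - t₁') by ring, abs_neg]
        have : ‖evolution (ham s v e U x) t₂ * pairing α δ (fun _ => 1)‖ ≤ 1 := by
          refine (l2_opNorm_mul _ _).trans ?_
          exact mul_le_one₀ (norm_evolution_le (ham_isHermitian s v e U x) t₂) (norm_nonneg _)
            (norm_pairing_one_le α δ)
        have h0 := Real.sqrt_nonneg (∑ a, ‖ham s v e U x a (β, m)‖ ^ 2)
        nlinarith [mul_nonneg h0 (abs_nonneg (t₁ - t₁')),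
          mul_le_mul_of_nonneg_right this (mul_nonneg h0 (abs_nonneg (t₁ - t₁')))]
    _ ≤ _ := by
        rw [integral_mul_const]
        gcongr

lemma evolved_lipschitz_right (hn : 0 < n) (hU : Uᴴ * U = 1) (t₁ t₂ t₂' : ℝ) :
    ‖evolved s v e U α δ β γ m t₁ t₂ - evolved s v e U α δ β γ m t₁ t₂'‖
      ≤ speed s v (e m) * |t₂ - t₂'| := by
  unfold evolved
  rw [← integral_sub (integrable_evolved s v e U α δ _ _ t₁ t₂)
    (integrable_evolved s v e U α δ _ _ t₁ t₂')]
  obtain ⟨h1, h2⟩ := integral_sqrt_ham_le s v e U hn hU (γ, m)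
  calc _ ≤ ∫ x, Real.sqrt (∑ a, ‖ham s v e U x a (γ, m)‖ ^ 2) * |t₂ - t₂'| ∂(gaussians n) := by
        refine norm_integral_le_of_norm_le (h1.mul_const _) (.of_forall fun x => ?_)
        refine (norm_evolution_mul_sub_le (ham_isHermitian s v e U x) _ _ _ _ _).trans ?_
        have := norm_pairing_evolution_le s v e U α δ x (-t₁)
        have h0 := Real.sqrt_nonneg (∑ a, ‖ham s v e U x a (γ, m)‖ ^ 2)
        nlinarith [mul_le_mul_of_nonneg_right this (mul_nonneg h0 (abs_nonneg (t₂ - t₂')))]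
    _ ≤ _ := by
        rw [integral_mul_const]
        gcongr

/-- Transforming the remaining evolution turns the half-evolved mean into the two-resolvent mean,
whose limit is known. -/
lemma laplace_halfEvolved {z w : ℂ} (hz : 0 < z.im) (hw : w.im ≠ 0) :
    laplace (halfEvolved s v e U α δ β γ m w) z
      = -Complex.I * ∫ x, twoGreen s v e U z w α δ (fun _ => 1) (γ, m) (β, m) x ∂(gaussians n) := by
  unfold halfEvolved
  rw [laplace_integral (k := fun x t => halfMatrix s v e U α δ w x (-t) (γ, m) (β, m))
    (continuous_half_entry s v e U hw α δ (γ, m) (β, m)).aestronglyMeasurable _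
    (fun x t => norm_half_entry_le s v e U hw α δ _ _ x _) hz, ← integral_const_mul]
  refine integral_congr_ae (.of_forall fun x => ?_)
  exact laplace_mul_evolution (ham_isHermitian s v e U x) (GX s v e U w x * pairing α δ fun _ => 1)
    hz (γ, m) (β, m)

/-- Transforming only the second time turns one evolution into a resolvent in the lower half-plane
and keeps the first time free, so the two inversions can be done one after the other. -/
lemma laplace_evolved {w : ℂ} (hw : w.im < 0) (t₁ : ℝ) :
    laplace (evolved s v e U α δ β γ m t₁) (-w)
      = Complex.I * halfEvolved s v e U α δ β γ m w t₁ := by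
  unfold evolved
  have hc : Continuous fun y : (Fin n → Fin n → ℝ) × ℝ =>
      evolvedMatrix s v e U α δ y.1 (-t₁) y.2 (γ, m) (β, m) := by
    have h2 : Continuous fun y : (Fin n → Fin n → ℝ) × ℝ => (y.1, (t₁, y.2)) :=
      continuous_fst.prodMk (continuous_const.prodMk continuous_snd)
    have h3 := (continuous_evolved_entry s v e U α δ (γ, m) (β, m)).comp h2
    simpa only [Function.comp_def] using h3
  have hw' : 0 < (-w).im := by simpa using hw
  rw [laplace_integral (k := fun x t => evolvedMatrix s v e U α δ x (-t₁) t (γ, m) (β, m))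
    hc.aestronglyMeasurable 1
    (fun x t => norm_evolved_entry_le s v e U α δ (γ, m) (β, m) x (-t₁) t) hw',
    halfEvolved, ← integral_const_mul]
  refine integral_congr_ae (.of_forall fun x => ?_)
  have := laplace_evolution_mul (ham_isHermitian s v e U x)
    (pairing α δ (fun _ => 1) * evolution (ham s v e U x) (-t₁)) hw (γ, m) (β, m)
  rw [← Matrix.mul_assoc] at this
  exact this

end Dynamics

/-! ### Limits of uniformly Lipschitz families -/

section EquiLipschitz

variable {k : ℕ+ → ℝ → ℂ} {C L : ℝ}

/-- The limit is defined along an ultrafilter, which also provides a value at `t = 0`, where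
convergence is not known in advance; the bounds pass to the limit on the closed half-line. -/
lemma exists_lipschitz_limit (hC : ∀ n t, 0 ≤ t → ‖k n t‖ ≤ C)
    (hL : ∀ n s t, 0 ≤ s → 0 ≤ t → ‖k n s - k n t‖ ≤ L * |s - t|)
    (hlim : ∀ t, 0 < t → ∃ l, Tendsto (fun n => k n t) atTop (𝓝 l)) :
    ∃ K : ℝ → ℂ, (∀ t, 0 ≤ t → ‖K t‖ ≤ C) ∧
      (∀ s t, 0 ≤ s → 0 ≤ t → ‖K s - K t‖ ≤ L * |s - t|) ∧
      ∀ t, 0 < t → Tendsto (fun n => k n t) atTop (𝓝 (K t)) := by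
  set l : Ultrafilter ℕ+ := Ultrafilter.of atTop
  have h1 : ∀ t : ℝ, ∃ a : ℂ, 0 ≤ t → Tendsto (fun n => k n t) l (𝓝 a) := by
    intro t
    by_cases ht : 0 ≤ t
    · obtain ⟨a, -, ha⟩ := (isCompact_closedBall (0 : ℂ) C).ultrafilter_le_nhds
        (l.map fun n => k n t) (by
          rw [le_principal_iff]
          refine Ultrafilter.mem_map.2 (Filter.univ_mem' fun n => ?_)
          simpa using hC n t ht)
      exact ⟨a, fun _ => ha⟩
    · exact ⟨0, fun h => absurd h ht⟩
  choose K hK using h1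
  refine ⟨K, fun t ht => le_of_tendsto' (hK t ht).norm fun n => hC n t ht,
    fun s t hs ht => le_of_tendsto' ((hK s hs).sub (hK t ht)).norm fun n => hL n s t hs ht,
    fun t ht => ?_⟩
  obtain ⟨a, ha⟩ := hlim t ht
  rwa [tendsto_nhds_unique (hK t ht.le) (ha.mono_left (Ultrafilter.of_le _))]

lemma tendstoUniformlyOn_of_lipschitz {K : ℝ → ℂ}
    (hL : ∀ n s t, 0 ≤ s → 0 ≤ t → ‖k n s - k n t‖ ≤ L * |s - t|)
    (hK : ∀ s t, 0 ≤ s → 0 ≤ t → ‖K s - K t‖ ≤ L * |s - t|)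
    (hlim : ∀ t, 0 < t → Tendsto (fun n => k n t) atTop (𝓝 (K t))) (T : ℝ) :
    TendstoUniformlyOn k K atTop (Set.Icc 0 T) := by
  rw [Metric.tendstoUniformlyOn_iff]
  intro ε hε
  have hL0 : 0 < |L| + 1 := by positivity
  -- The mesh of a grid fine enough that moving to a grid point costs less than `ε / 3`. The grid
  -- points `d * (i + 1)` are strictly positive, because pointwise convergence is assumed only
  -- there.
  set d : ℝ := ε / (3 * (|L| + 1)) with hd
  have hd0 : 0 < d := by positivity
  have hLd : L * d < ε / 3 := by
    have h1 : (|L| + 1) * d = ε / 3 := by rw [hd]; field_simp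
    nlinarith [le_abs_self L]
  obtain ⟨N, hN⟩ := exists_nat_gt (T / d)
  have hev : ∀ᶠ n in atTop, ∀ i ∈ Finset.range (N + 1),
      dist (k n (d * (i + 1))) (K (d * (i + 1))) < ε / 3 := by
    rw [Filter.eventually_all_finset]
    intro i _
    exact (Metric.tendsto_nhds.1 (hlim _ (by positivity))) _ (by positivity)
  filter_upwards [hev] with n hn t ht
  set i := ⌊t / d⌋₊
  have hi1 : (i : ℝ) ≤ t / d := Nat.floor_le (div_nonneg ht.1 hd0.le)
  have hi2 : t / d < i + 1 := Nat.lt_floor_add_one _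
  have hiN : i ∈ Finset.range (N + 1) := by
    rw [Finset.mem_range, Nat.lt_succ_iff]
    have : (i : ℝ) < N := hi1.trans_lt (lt_of_le_of_lt (by gcongr; exact ht.2) hN)
    exact_mod_cast this.le
  have hdist : |t - d * (i + 1)| ≤ d := by
    rw [le_div_iff₀ hd0] at hi1
    rw [div_lt_iff₀ hd0] at hi2
    rw [abs_le]
    constructor <;> nlinarith
  have hg : 0 ≤ d * ((i : ℝ) + 1) := by positivity
  have e1 := hL n t _ ht.1 hg
  have e2 := hK t _ ht.1 hg
  have e3 := hn i hiN
  have hLe : L * |t - d * (i + 1)| ≤ ε / 3 := by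
    rcases le_or_gt 0 L with h | h
    · exact (mul_le_mul_of_nonneg_left hdist h).trans hLd.le
    · exact (mul_nonpos_of_nonpos_of_nonneg h.le (abs_nonneg _)).trans (by positivity)
  rw [dist_comm] at e3
  rw [dist_eq_norm] at e3 ⊢
  calc ‖K t - k n t‖ = ‖(K t - K (d * (i + 1))) + (K (d * (i + 1)) - k n (d * (i + 1)))
        + -(k n t - k n (d * (i + 1)))‖ := by congr 1; ring
    _ ≤ _ := norm_add₃_le
    _ < ε := by rw [norm_neg]; linarith

lemma tendsto_laplace (hC : ∀ n t, 0 ≤ t → ‖k n t‖ ≤ C)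
    (hL : ∀ n s t, 0 ≤ s → 0 ≤ t → ‖k n s - k n t‖ ≤ L * |s - t|) {K : ℝ → ℂ}
    (hlim : ∀ t, 0 < t → Tendsto (fun n => k n t) atTop (𝓝 (K t))) {z : ℂ} (hz : 0 < z.im) :
    Tendsto (fun n => laplace (k n) z) atTop (𝓝 (laplace K z)) := by
  unfold laplace
  have hc : Continuous fun τ : ℝ => Complex.exp (Complex.I * z * τ) := by fun_prop
  refine tendsto_integral_filter_of_dominated_convergence (fun τ => Real.exp (-z.im * τ) * C)
    (.of_forall fun n => ?_) (.of_forall fun n => ?_)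
    ((integrableOn_exp_mul_Ioi (by linarith) 0).mul_const C) ?_
  · exact (hc.continuousOn.mul (continuousOn_of_lipschitz_half (hL n))).aestronglyMeasurable
      measurableSet_Ioi
  · refine (ae_restrict_iff' measurableSet_Ioi).2 (.of_forall fun τ hτ => ?_)
    rw [norm_mul, norm_exp_I_mul_complex, neg_mul]
    gcongr
    exact hC n τ (le_of_lt hτ)
  · exact (ae_restrict_iff' measurableSet_Ioi).2
      (.of_forall fun τ hτ => (hlim τ hτ).const_mul _)

end EquiLipschitz

/-! ### Calculus of line integrals and Laplace inversion along lines -/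

section LineIntegral

lemma HasLineIntegral.const_mul {g : ℂ → ℂ} {η : ℝ} {a : ℂ} (c : ℂ) (h : HasLineIntegral g η a) :
    HasLineIntegral (fun z => c * g z) η (c * a) := by
  refine ⟨fun N => (h.1 N).const_mul c, ?_⟩
  simp_rw [intervalIntegral.integral_const_mul]
  exact h.2.const_mul c

lemma HasLineIntegral.sum {ι : Type*} {S : Finset ι} {g : ι → ℂ → ℂ} {η : ℝ} {a : ι → ℂ}
    (h : ∀ i ∈ S, HasLineIntegral (g i) η (a i)) :
    HasLineIntegral (fun z => ∑ i ∈ S, g i z) η (∑ i ∈ S, a i) := by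
  have h1 : ∀ N : ℝ, ∀ i ∈ S, IntervalIntegrable
      (fun x : ℝ => g i ((x : ℂ) + (η : ℂ) * Complex.I)) volume (-N) N := fun N i hi => (h i hi).1 N
  refine ⟨fun N => ?_, ?_⟩
  · have := IntervalIntegrable.sum S (h1 N)
    simpa only [Finset.sum_fn] using this
  · simp_rw [fun N => intervalIntegral.integral_finsetSum (h1 N)]
    exact tendsto_finsetSum _ fun i hi => (h i hi).2

lemma HasIteratedLineIntegral.sum {ι : Type*} {S : Finset ι} {F : ι → ℂ → ℂ → ℂ} {η₁ η₂ : ℝ}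
    {c a : ι → ℂ} (h : ∀ i, HasIteratedLineIntegral (F i) η₁ η₂ (a i)) :
    HasIteratedLineIntegral (fun z w => ∑ i ∈ S, c i * F i z w) η₁ η₂ (∑ i ∈ S, c i * a i) := by
  choose G hG hG' using h
  refine ⟨fun w => ∑ i ∈ S, c i * G i w, fun w hw => ?_, ?_⟩
  · exact HasLineIntegral.sum fun i _ => (hG i w hw).const_mul (c i)
  · exact HasLineIntegral.sum fun i _ => (hG' i).const_mul (c i)

lemma hasLineIntegral_congr {g g' : ℂ → ℂ} {η : ℝ} {a : ℂ} (h : HasLineIntegral g η a)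
    (hg : ∀ z : ℂ, z.im = η → g z = g' z) : HasLineIntegral g' η a := by
  have : ∀ x : ℝ, g' ((x : ℂ) + (η : ℂ) * Complex.I) = g ((x : ℂ) + (η : ℂ) * Complex.I) :=
    fun x => (hg _ (by simp)).symm
  unfold HasLineIntegral
  simp only [this]
  exact h

/-- Inversion of the Laplace transform along a line in the upper half-plane. -/
lemma hasLineIntegral_laplace_upper {k : ℝ → ℂ} {C L : ℝ} (hC : ∀ t, 0 ≤ t → ‖k t‖ ≤ C)
    (hL : ∀ s t, 0 ≤ s → 0 ≤ t → ‖k s - k t‖ ≤ L * |s - t|) {η : ℝ} (hη : 0 < η)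
    {t : ℝ} (ht : 0 < t) :
    HasLineIntegral (fun z => Complex.exp (-(Complex.I * t * z)) * laplace k z) η
      (2 * Real.pi * k t) := by
  refine ⟨fun N => Continuous.intervalIntegrable ?_ _ _,
    laplace_inversion_upper k C L hC hL η hη t ht⟩
  exact (by fun_prop : Continuous fun x : ℝ =>
    Complex.exp (-(Complex.I * t * (x + η * Complex.I)))).mul (laplace_continuous k C L hC hL η hη)

/-- Inversion of the Laplace transform along a line in the lower half-plane. -/
lemma hasLineIntegral_laplace_lower {k : ℝ → ℂ} {C L : ℝ} (hC : ∀ t, 0 ≤ t → ‖k t‖ ≤ C)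
    (hL : ∀ s t, 0 ≤ s → 0 ≤ t → ‖k s - k t‖ ≤ L * |s - t|) {η : ℝ} (hη : 0 < η)
    {t : ℝ} (ht : 0 < t) :
    HasLineIntegral (fun z => Complex.exp (Complex.I * t * z) * laplace k (-z)) (-η)
      (2 * Real.pi * k t) := by
  refine ⟨fun N => Continuous.intervalIntegrable ?_ _ _,
    laplace_inversion_lower k C L hC hL η hη t ht⟩
  refine (by fun_prop : Continuous fun x : ℝ =>
    Complex.exp (Complex.I * t * (x + (-η : ℝ) * Complex.I))).mul ?_
  have h1 := (laplace_continuous k C L hC hL η hη).comp (continuous_neg (G := ℝ))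
  refine h1.congr fun x => ?_
  simp only [Function.comp_apply]
  congr 1
  push_cast; ring

end LineIntegral

/-! ### Convergence of the two-time evolutions and the double integral -/

section EvolvedLimit

variable {ev : ∀ n : ℕ+, Fin n → ℝ} {nu0 : Measure ℝ} [IsProbabilityMeasure nu0]
  {U : ∀ n : ℕ+, Matrix (Fin n) (Fin n) ℂ} {s v : ℝ}

lemma bounded_of_tendsto_pnat {u : ℕ+ → ℝ} {a : ℝ} (h : Tendsto u atTop (𝓝 a)) :
    ∃ M : ℝ, ∀ n, |u n| ≤ M := by
  have h1 : Tendsto (fun n : ℕ => u n.succPNat) atTop (𝓝 a) := by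
    refine h.comp ?_
    refine tendsto_atTop.2 fun b => eventually_atTop.2 ⟨b, fun n hn => ?_⟩
    rw [← PNat.coe_le_coe, Nat.succPNat_coe]
    omega
  obtain ⟨M, hM⟩ := (Metric.isBounded_range_of_tendsto _ h1).exists_norm_le
  refine ⟨M, fun n => ?_⟩
  have := hM _ ⟨n.natPred, rfl⟩
  simpa using this

lemma speed_le {s v e M : ℝ} (h : |e| ≤ M) : speed s v e ≤ speed s v M := by
  unfold speed
  have : |e| ≤ |M| := h.trans (le_abs_self M)
  gcongr

/-- Convergence of mean evolutions, and the double integral representing the limit. -/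
lemma evolved_limit (hU : ∀ n, (U n)ᴴ * U n = 1) (hconv : ∀ φ : ℝ →ᵇ ℝ,
      Tendsto (fun n : ℕ+ => ∫ x, φ x ∂(countingMeasure (ev n))) atTop (𝓝 (∫ x, φ x ∂nu0)))
    {f : ℤˣ → ℂ → ℂ} (hf : ∀ z : ℂ, z.im ≠ 0 → SolvesAt nu0 s v f z ∧
      ∀ α, Tendsto (fun n : ℕ+ => gbar s v (ev n) (U n) α z) atTop (𝓝 (f α z)))
    {k : ∀ n : ℕ+, Fin n} {E : ℝ} (hE : Tendsto (fun n : ℕ+ => ev n (k n)) atTop (𝓝 E))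
    (α δ β γ : ℤˣ) :
    ∃ r : ℝ → ℂ, (∀ T : ℝ, TendstoUniformlyOn
        (fun (n : ℕ+) t => evolved s v (ev n) (U n) α δ β γ (k n) t t) r atTop (Set.Icc 0 T)) ∧
      ∀ t : ℝ, 0 < t → ∀ η₁ η₂ : ℝ, 0 < η₁ → 0 < η₂ →
        HasIteratedLineIntegral (fun z w => Complex.exp (Complex.I * (t : ℂ) * (w - z)) *
          twoGreenLimit nu0 s v f E α δ β γ z w) η₁ η₂ ((2 * (Real.pi : ℂ)) ^ 2 * r t) := by
  -- The chosen energies converge and are therefore bounded, which makes `speed` uniform in `n`.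
  obtain ⟨M, hM⟩ := bounded_of_tendsto_pnat hE
  set L := speed s v M
  have hsp : ∀ n, speed s v (ev n (k n)) ≤ L := fun n => speed_le (hM n)
  -- the half-evolved function
  have hA : ∀ w : ℂ, w.im < 0 → ∃ K : ℝ → ℂ, (∀ t, 0 ≤ t → ‖K t‖ ≤ |w.im|⁻¹) ∧
      (∀ t t', 0 ≤ t → 0 ≤ t' → ‖K t - K t'‖ ≤ (|w.im|⁻¹ * L) * |t - t'|) ∧
      (∀ t, 0 < t → Tendsto (fun n : ℕ+ => halfEvolved s v (ev n) (U n) α δ β γ (k n) w t) atTop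
        (𝓝 (K t))) ∧
      ∀ z : ℂ, 0 < z.im →
        laplace K z = -Complex.I * twoGreenLimit nu0 s v f E α δ β γ z w := by
    intro w hw
    have hC : ∀ (n : ℕ+) t, 0 ≤ t → ‖halfEvolved s v (ev n) (U n) α δ β γ (k n) w t‖ ≤ |w.im|⁻¹ :=
      fun n t _ => norm_halfEvolved_le s v (ev n) (U n) α δ β γ (k n) hw.ne t
    have hL : ∀ (n : ℕ+) t t', 0 ≤ t → 0 ≤ t' →
        ‖halfEvolved s v (ev n) (U n) α δ β γ (k n) w t -
          halfEvolved s v (ev n) (U n) α δ β γ (k n) w t'‖ ≤ (|w.im|⁻¹ * L) * |t - t'| :=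
      fun n t t' _ _ => (halfEvolved_lipschitz s v (ev n) (U n) α δ β γ (k n) n.pos (hU n)
        hw.ne t t').trans (by gcongr; exact hsp n)
    have hlap : ∀ z : ℂ, 0 < z.im → Tendsto (fun n : ℕ+ =>
        laplace (halfEvolved s v (ev n) (U n) α δ β γ (k n) w) z) atTop
        (𝓝 (-Complex.I * twoGreenLimit nu0 s v f E α δ β γ z w)) := by
      intro z hz
      simp_rw [laplace_halfEvolved s v _ _ α δ β γ _ hz hw.ne]
      exact (tendsto_twoGreen hU hconv hz.ne' hw.ne (hf z hz.ne').1 (hf w hw.ne).1 (hf z hz.ne').2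
        (hf w hw.ne).2 hE α δ β γ).const_mul _
    -- Convergence of transforms on the single line `Im z = 1` gives pointwise convergence in time.
    -- The transform of the limit is then identified in the whole half-plane by dominated
    -- convergence.
    obtain ⟨K, hK1, hK2, hK3⟩ := exists_lipschitz_limit hC hL fun t ht =>
      tendsto_of_laplace_tendsto _ _ _ hC hL 1 one_pos (fun x => ⟨_, hlap _ (by simp)⟩) t ht
    exact ⟨K, hK1, hK2, hK3, fun z hz =>
      tendsto_nhds_unique (tendsto_laplace hC hL hK3 hz) (hlap z hz)⟩
  choose! K hK1 hK2 hK3 hK4 using hA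
  -- the fully evolved function
  have hC : ∀ (t₁ : ℝ) (n : ℕ+) t, 0 ≤ t → ‖evolved s v (ev n) (U n) α δ β γ (k n) t₁ t‖ ≤ 1 :=
    fun t₁ n t _ => norm_evolved_le s v (ev n) (U n) α δ β γ (k n) t₁ t
  have hLr : ∀ (t₁ : ℝ) (n : ℕ+) t t', 0 ≤ t → 0 ≤ t' →
      ‖evolved s v (ev n) (U n) α δ β γ (k n) t₁ t -
        evolved s v (ev n) (U n) α δ β γ (k n) t₁ t'‖ ≤ L * |t - t'| :=
    fun t₁ n t t' _ _ => (evolved_lipschitz_right s v (ev n) (U n) α δ β γ (k n) n.pos (hU n)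
      t₁ t t').trans (by gcongr; exact hsp n)
  have hB : ∀ t₁ : ℝ, 0 < t₁ → ∃ Y : ℝ → ℂ, (∀ t, 0 ≤ t → ‖Y t‖ ≤ 1) ∧
      (∀ t t', 0 ≤ t → 0 ≤ t' → ‖Y t - Y t'‖ ≤ L * |t - t'|) ∧
      (∀ t, 0 < t → Tendsto (fun n : ℕ+ => evolved s v (ev n) (U n) α δ β γ (k n) t₁ t) atTop
        (𝓝 (Y t))) ∧
      ∀ w : ℂ, w.im < 0 → laplace Y (-w) = Complex.I * K w t₁ := by
    intro t₁ ht₁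
    have hlap : ∀ w : ℂ, w.im < 0 → Tendsto (fun n : ℕ+ =>
        laplace (evolved s v (ev n) (U n) α δ β γ (k n) t₁) (-w)) atTop
        (𝓝 (Complex.I * K w t₁)) := by
      intro w hw
      simp_rw [laplace_evolved s v _ _ α δ β γ _ hw]
      exact (hK3 w hw t₁ ht₁).const_mul _
    -- The same argument in the second time with `t₁` frozen; the point `-(x + i)` lies in the lower
    -- half-plane, where `K` is available.
    obtain ⟨Y, hY1, hY2, hY3⟩ := exists_lipschitz_limit (hC t₁) (hLr t₁) fun t ht =>
      tendsto_of_laplace_tendsto _ _ _ (hC t₁) (hLr t₁) 1 one_pos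
        (fun x => ⟨_, by
          have := hlap (-(x + (1 : ℝ) * Complex.I)) (by simp)
          simpa only [neg_neg] using this⟩) t ht
    exact ⟨Y, hY1, hY2, hY3, fun w hw =>
      tendsto_nhds_unique (tendsto_laplace (hC t₁) (hLr t₁) hY3 (by simpa using hw)) (hlap w hw)⟩
  choose! Y hY1 hY2 hY3 hY4 using hB
  -- the diagonal
  have hLd : ∀ (n : ℕ+) t t', 0 ≤ t → 0 ≤ t' →
      ‖evolved s v (ev n) (U n) α δ β γ (k n) t t -
        evolved s v (ev n) (U n) α δ β γ (k n) t' t'‖ ≤ (2 * L) * |t - t'| := by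
    intro n t t' ht ht'
    have e1 := evolved_lipschitz_left s v (ev n) (U n) α δ β γ (k n) n.pos (hU n) t t' t
    have e2 := hLr t' n t t' ht ht'
    have e3 : speed s v (ev n (k n)) * |t - t'| ≤ L * |t - t'| := by gcongr; exact hsp n
    have e4 := norm_sub_le_norm_sub_add_norm_sub (evolved s v (ev n) (U n) α δ β γ (k n) t t)
      (evolved s v (ev n) (U n) α δ β γ (k n) t' t) (evolved s v (ev n) (U n) α δ β γ (k n) t' t')
    linarith
  -- On the diagonal each of the two times contributes a Lipschitz constant `L`.
  obtain ⟨r, -, hr2, hr3⟩ := exists_lipschitz_limit (fun n t ht => hC t n t ht) hLd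
    fun t ht => ⟨_, hY3 t ht t ht⟩
  refine ⟨r, fun T => tendstoUniformlyOn_of_lipschitz hLd hr2 hr3 T, fun t ht η₁ η₂ h₁ h₂ => ?_⟩
  have hrt : r t = Y t t := tendsto_nhds_unique (hr3 t ht) (hY3 t ht t ht)
  -- The inner integral recovers `2π K w t`, the factor `i` cancelling the `-i` of its transform.
  -- What is left is the transform of `Y t` at `-w`, and the outer inversion supplies the second
  -- `2π`.
  refine ⟨fun w => Complex.exp (Complex.I * t * w) * Complex.I * (2 * Real.pi * K w t),
    fun w hw => ?_, ?_⟩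
  · have hw' : w.im < 0 := by rw [hw]; linarith
    refine hasLineIntegral_congr ((hasLineIntegral_laplace_upper (hK1 w hw') (hK2 w hw') h₁
      ht).const_mul (Complex.exp (Complex.I * t * w) * Complex.I)) fun z hz => ?_
    have hx : Complex.I * (t : ℂ) * (w - z) = Complex.I * t * w + -(Complex.I * t * z) := by ring
    simp only [hx, Complex.exp_add, hK4 w hw' z (by rw [hz]; exact h₁)]
    linear_combination (-(Complex.exp (Complex.I * t * w) * Complex.exp (-(Complex.I * t * z)) *
      twoGreenLimit nu0 s v f E α δ β γ z w)) * Complex.I_mul_I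
  · have h3 := (hasLineIntegral_laplace_lower (hY1 t ht) (hY2 t ht) h₂ ht).const_mul (2 * Real.pi)
    rw [hrt]
    have h4 : (2 * (Real.pi : ℂ)) * (2 * Real.pi * Y t t) = (2 * (Real.pi : ℂ)) ^ 2 * Y t t := by
      ring
    rw [h4] at h3
    refine hasLineIntegral_congr h3 fun w hw => ?_
    have hw' : w.im < 0 := by rw [hw]; linarith
    rw [hY4 t ht w hw']
    ring

end EvolvedLimit

/-! ### Reduction to the eigenbasis of the reservoir -/

section Basis

variable {n : ℕ}

/-- The matrix whose columns are the vectors of an orthonormal basis. -/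
noncomputable def basisMatrix (ψ : OrthonormalBasis (Fin n) ℂ (EuclideanSpace ℂ (Fin n))) :
    Matrix (Fin n) (Fin n) ℂ := Matrix.of fun a b => (ψ b).ofLp a

variable (ψ : OrthonormalBasis (Fin n) ℂ (EuclideanSpace ℂ (Fin n)))

lemma basisMatrix_conjTranspose_mul : (basisMatrix ψ)ᴴ * basisMatrix ψ = 1 := by
  ext a b
  rw [Matrix.mul_apply, Matrix.one_apply]
  have h1 := orthonormal_iff_ite.1 ψ.orthonormal a b
  rw [← h1, PiLp.inner_apply]
  refine Finset.sum_congr rfl fun j _ => ?_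
  simp [basisMatrix, Matrix.conjTranspose_apply, mul_comm]

lemma basisMatrix_mul_conjTranspose : basisMatrix ψ * (basisMatrix ψ)ᴴ = 1 :=
  mul_eq_one_comm.1 (basisMatrix_conjTranspose_mul ψ)

lemma eq_basisMatrix_mul_diagonal (h : Matrix (Fin n) (Fin n) ℂ) (e : Fin n → ℝ)
    (hψ : ∀ j, h *ᵥ (ψ j).ofLp = (e j : ℂ) • (ψ j).ofLp) :
    h = basisMatrix ψ * diagonal (fun a => (e a : ℂ)) * (basisMatrix ψ)ᴴ := by
  have h1 : h * basisMatrix ψ = basisMatrix ψ * diagonal (fun a => (e a : ℂ)) := by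
    ext a b
    rw [mul_diagonal]
    have := congrFun (hψ b) a
    rw [Pi.smul_apply, smul_eq_mul, mul_comm] at this
    exact this
  rw [← h1, Matrix.mul_assoc, basisMatrix_mul_conjTranspose, Matrix.mul_one]

lemma proj_eq (k : Fin n) :
    proj (ψ k) = basisMatrix ψ * Matrix.single k k 1 * (basisMatrix ψ)ᴴ := by
  ext a b
  rw [Matrix.mul_apply, Finset.sum_eq_single k, Matrix.mul_single_apply_same]
  · simp [proj, basisMatrix]
  · intro j _ hj
    rw [Matrix.mul_single_apply_of_ne _ _ _ _ _ hj, zero_mul]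
  · exact fun h => absurd (Finset.mem_univ _) h

lemma kronecker_conj (A : Matrix ℤˣ ℤˣ ℂ) (V B : Matrix (Fin n) (Fin n) ℂ) :
    A ⊗ₖ (V * B * Vᴴ) = lift1 V * (A ⊗ₖ B) * (lift1 V)ᴴ := by
  unfold lift1
  rw [Matrix.conjTranspose_kronecker, Matrix.conjTranspose_one, ← Matrix.mul_kronecker_mul,
    ← Matrix.mul_kronecker_mul, Matrix.one_mul, Matrix.mul_one]

/-- Only the reservoir factor is rotated, so the level structure is untouched and the random matrix
becomes `rotGue`. -/
lemma hamiltonian_eq (s v : ℝ) (h : Matrix (Fin n) (Fin n) ℂ) (e : Fin n → ℝ)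
    (hψ : ∀ j, h *ᵥ (ψ j).ofLp = (e j : ℂ) • (ψ j).ofLp) (x : Fin n → Fin n → ℝ) :
    hamiltonian s v h (gueMatrix x) = lift1 (basisMatrix ψ) * ham s v e (basisMatrix ψ) x *
      (lift1 (basisMatrix ψ))ᴴ := by
  have hV := basisMatrix_mul_conjTranspose ψ
  have h1 : gueMatrix x = basisMatrix ψ * rotGue (basisMatrix ψ) x * (basisMatrix ψ)ᴴ := by
    unfold rotGue
    calc gueMatrix x = (basisMatrix ψ * (basisMatrix ψ)ᴴ) * gueMatrix x *
          (basisMatrix ψ * (basisMatrix ψ)ᴴ) := by rw [hV, Matrix.one_mul, Matrix.mul_one]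
      _ = _ := by simp only [Matrix.mul_assoc]
  have h2 : (1 : Matrix (Fin n) (Fin n) ℂ) = basisMatrix ψ * 1 * (basisMatrix ψ)ᴴ := by
    rw [Matrix.mul_one, hV]
  unfold ham hamiltonian
  conv_lhs => rw [h2, eq_basisMatrix_mul_diagonal ψ h e hψ, h1]
  rw [← Matrix.smul_mul, ← Matrix.mul_smul, kronecker_conj, kronecker_conj, kronecker_conj]
  simp only [Matrix.mul_add, Matrix.add_mul, Matrix.mul_smul, Matrix.smul_mul]

lemma evolution_conj {ι : Type*} [Fintype ι] [DecidableEq ι] (V H : Matrix ι ι ℂ)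
    (h1 : Vᴴ * V = 1) (t : ℝ) : evolution (V * H * Vᴴ) t = V * evolution H t * Vᴴ := by
  have h2 : V⁻¹ = Vᴴ := Matrix.inv_eq_left_inv h1
  have h3 : IsUnit V := by
    rw [Matrix.isUnit_iff_isUnit_det]
    exact Matrix.isUnit_det_of_left_inverse h1
  unfold evolution
  rw [← h2, ← Matrix.exp_conj _ _ h3, Matrix.mul_smul, Matrix.smul_mul]

lemma pairing_one_eq (α δ : ℤˣ) : pairing α δ (fun _ : Fin n => (1 : ℂ))
    = (Matrix.single δ α (1 : ℂ)) ⊗ₖ (1 : Matrix (Fin n) (Fin n) ℂ) := by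
  ext p q
  simp only [pairing, Matrix.of_apply, Matrix.kroneckerMap_apply, Matrix.single_apply,
    Matrix.one_apply]
  by_cases h1 : p.1 = δ <;> by_cases h2 : q.1 = α <;> by_cases h3 : p.2 = q.2 <;>
    simp [h1, h2, h3, Ne.symm]

/-- The partial trace over the reservoir is insensitive to rotations of the reservoir: `J` acts
trivially there and commutes with `1 ⊗ V`. -/
lemma sum_conj_apply (V : Matrix (Fin n) (Fin n) ℂ) (hV : Vᴴ * V = 1) (α δ : ℤˣ)
    (M : Matrix (ℤˣ × Fin n) (ℤˣ × Fin n) ℂ) :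
    ∑ j, (lift1 V * M * (lift1 V)ᴴ) (α, j) (δ, j) = trace (pairing α δ (fun _ => 1) * M) := by
  have h0 := trace_pairing_mul (lift1 V * M * (lift1 V)ᴴ) α δ (fun _ => 1)
  simp only [one_mul] at h0
  rw [← h0]
  have h1 : pairing α δ (fun _ : Fin n => (1 : ℂ)) * lift1 V
      = lift1 V * pairing α δ (fun _ => 1) := by
    rw [pairing_one_eq, lift1, ← Matrix.mul_kronecker_mul, ← Matrix.mul_kronecker_mul,
      Matrix.one_mul, Matrix.mul_one, Matrix.one_mul, Matrix.mul_one]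
  rw [← Matrix.mul_assoc, ← Matrix.mul_assoc, h1, Matrix.trace_mul_comm, ← Matrix.mul_assoc,
    ← Matrix.mul_assoc, lift1_conjTranspose_mul V hV, Matrix.one_mul]

lemma trace_mul_kronecker_single (A : Matrix (ℤˣ × Fin n) (ℤˣ × Fin n) ℂ)
    (rho0 : Matrix ℤˣ ℤˣ ℂ) (k : Fin n) :
    trace (A * (rho0 ⊗ₖ Matrix.single k k (1 : ℂ))) = ∑ β, ∑ γ, rho0 β γ * A (γ, k) (β, k) := by
  have h1 : ∀ p : ℤˣ × Fin n, (A * (rho0 ⊗ₖ Matrix.single k k (1 : ℂ))) p p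
      = if p.2 = k then ∑ β, rho0 β p.1 * A p (β, k) else 0 := by
    intro p
    rw [Matrix.mul_apply, Fintype.sum_prod_type]
    simp only [Matrix.kroneckerMap_apply, Matrix.single_apply]
    by_cases h : p.2 = k
    · rw [if_pos h]
      refine Finset.sum_congr rfl fun β _ => ?_
      rw [Finset.sum_eq_single k]
      · simp [h, mul_comm]
      · intro j _ hj
        simp [Ne.symm hj]
      · exact fun h => absurd (Finset.mem_univ _) h
    · rw [if_neg h]
      refine Finset.sum_eq_zero fun β _ => Finset.sum_eq_zero fun j _ => ?_
      simp [Ne.symm h]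
  rw [Matrix.trace, Fintype.sum_prod_type, Finset.sum_comm]
  simp only [Matrix.diag_apply, h1]
  rw [Finset.sum_eq_single k]
  · simp only [if_true]
    exact Finset.sum_comm
  · intro j _ hj
    simp [hj]
  · exact fun h => absurd (Finset.mem_univ _) h

/-- After rotation the projection becomes a matrix unit at `(k, k)`. Cyclicity of the trace moves
the initial state to the end and leaves entries of `e^{itH} J e^{-itH}` with reservoir index `k`. -/
lemma meanReducedDensity_eq (s v : ℝ) (h : Matrix (Fin n) (Fin n) ℂ) (e : Fin n → ℝ)
    (hψ : ∀ j, h *ᵥ (ψ j).ofLp = (e j : ℂ) • (ψ j).ofLp) (rho0 : Matrix ℤˣ ℤˣ ℂ) (k : Fin n)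
    (t : ℝ) (α δ : ℤˣ) : meanReducedDensity s v h rho0 (ψ k) t α δ
      = ∑ β, ∑ γ, rho0 β γ * evolved s v e (basisMatrix ψ) α δ β γ k t t := by
  have hV := basisMatrix_conjTranspose_mul ψ
  have hW := lift1_conjTranspose_mul _ hV
  have h1 : ∀ x, reducedDensity s v h (gueMatrix x) rho0 (ψ k) t α δ
      = ∑ β, ∑ γ, rho0 β γ * evolvedMatrix s v e (basisMatrix ψ) α δ x (-t) t (γ, k) (β, k) := by
    intro x
    unfold reducedDensity density
    rw [Matrix.of_apply, hamiltonian_eq ψ s v h e hψ, evolution_conj _ _ hW, evolution_conj _ _ hW,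
      proj_eq, kronecker_conj]
    set W := lift1 (basisMatrix ψ)
    set A := evolution (ham s v e (basisMatrix ψ) x) (-t) with hA
    set B := evolution (ham s v e (basisMatrix ψ) x) t with hB
    set P := rho0 ⊗ₖ Matrix.single k k (1 : ℂ)
    have h2 : W * A * Wᴴ * (W * P * Wᴴ) * (W * B * Wᴴ) = W * (A * P * B) * Wᴴ := by
      calc _ = W * A * (Wᴴ * W) * P * (Wᴴ * W) * B * Wᴴ := by simp only [Matrix.mul_assoc]
        _ = _ := by rw [hW]; simp only [Matrix.mul_assoc, Matrix.one_mul]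
    rw [h2, sum_conj_apply _ hV, ← trace_mul_kronecker_single]
    unfold evolvedMatrix
    rw [← hA, ← hB]
    calc _ = trace ((pairing α δ (fun _ => 1) * A * P) * B) := by simp only [Matrix.mul_assoc]
      _ = trace (B * (pairing α δ (fun _ => 1) * A * P)) := Matrix.trace_mul_comm _ _
      _ = _ := by simp only [Matrix.mul_assoc]; rfl
  unfold meanReducedDensity evolved
  rw [Matrix.of_apply]
  simp_rw [h1]
  have hi : ∀ β γ, Integrable (fun x => rho0 β γ *
      evolvedMatrix s v e (basisMatrix ψ) α δ x (-t) t (γ, k) (β, k)) (gaussians n) := fun β γ =>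
    (integrable_evolved s v e (basisMatrix ψ) α δ (γ, k) (β, k) t t).const_mul _
  rw [integral_finsetSum _ fun β _ => integrable_finsetSum _ fun γ _ => hi β γ]
  refine Finset.sum_congr rfl fun β _ => ?_
  rw [integral_finsetSum _ fun γ _ => hi β γ]
  exact Finset.sum_congr rfl fun γ _ => integral_const_mul _ _

end Basis

/-! ### Assembly over the entries of the initial state -/

lemma tendstoUniformlyOn_sum {ι : Type*} (S : Finset ι) {F : ι → ℕ+ → ℝ → ℂ} {r : ι → ℝ → ℂ}
    (c : ι → ℂ) {A : Set ℝ} (h : ∀ i, TendstoUniformlyOn (F i) (r i) atTop A) :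
    TendstoUniformlyOn (fun n t => ∑ i ∈ S, c i * F i n t) (fun t => ∑ i ∈ S, c i * r i t)
      atTop A := by
  classical
  have hc : ∀ i, TendstoUniformlyOn (fun n t => c i * F i n t) (fun t => c i * r i t) atTop A :=
    fun i => ((lipschitzWith_smul (c i)).uniformContinuous).comp_tendstoUniformlyOn (h i)
  induction S using Finset.induction_on with
  | empty =>
    simp only [Finset.sum_empty]
    exact fun u hu => .of_forall fun _ _ _ => refl_mem_uniformity hu
  | insert i S hi ih =>
    simp only [Finset.sum_insert hi]
    exact (hc i).add ih

end QRelax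

theorem theoremt
    (s v : ℝ) (hs : 0 < s) (hv : 0 < v)
    -- the reservoir: Hermitian matrices with an orthonormal basis of eigenvectors
    (h : ∀ n : ℕ+, Matrix (Fin n) (Fin n) ℂ) (hh : ∀ n, (h n).IsHermitian)
    (ev : ∀ n : ℕ+, Fin n → ℝ)
    (ψ : ∀ n : ℕ+, OrthonormalBasis (Fin n) ℂ (EuclideanSpace ℂ (Fin n)))
    (hψ : ∀ n j, h n *ᵥ (ψ n j).ofLp = (ev n j : ℂ) • (ψ n j).ofLp)
    -- weak convergence of the normalized counting measures of eigenvalues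
    (nu0 : Measure ℝ) (hnu0 : IsProbabilityMeasure nu0)
    (hconv : ∀ φ : ℝ →ᵇ ℝ, Tendsto (fun n : ℕ+ => ∫ x, φ x ∂(QRelax.countingMeasure (ev n)))
      atTop (𝓝 (∫ x, φ x ∂nu0)))
    -- the initial state of the small system
    (rho0 : Matrix ℤˣ ℤˣ ℂ) (hrho0 : rho0.PosSemidef) (htr : rho0.trace = 1)
    -- the chosen eigenvalues and their limit
    (k : ∀ n : ℕ+, Fin n) (E : ℝ) (hE : Tendsto (fun n : ℕ+ => ev n (k n)) atTop (𝓝 E)) :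
    ∃ nu : ℤˣ → Measure ℝ, (∀ α, IsProbabilityMeasure (nu α)) ∧
      QRelax.IsSolution nu0 s v (fun α => QRelax.stieltjes (nu α)) ∧
      (∀ g : ℤˣ → ℂ → ℂ, QRelax.IsSolution nu0 s v g →
        ∀ α (z : ℂ), z.im ≠ 0 → g α z = QRelax.stieltjes (nu α) z) ∧
      (∀ α δ (z₁ z₂ : ℂ), 0 < z₁.im → z₂.im < 0 →
        QRelax.denom nu0 s v (fun α => QRelax.stieltjes (nu α)) α δ z₁ z₂ ≠ 0) ∧
      ∃ rho : ℝ → Matrix ℤˣ ℤˣ ℂ,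
        (∀ α δ (T : ℝ), 0 < T → TendstoUniformlyOn
          (fun (n : ℕ+) (t : ℝ) =>
            QRelax.meanReducedDensity s v (h n) rho0 (ψ n (k n)) t α δ)
          (fun t => rho t α δ) atTop (Set.Icc 0 T)) ∧
        (∀ α δ (t : ℝ), 0 < t → ∀ η₁ η₂ : ℝ, 0 < η₁ → 0 < η₂ →
          QRelax.HasIteratedLineIntegral
            (QRelax.integrand nu0 s v (fun α => QRelax.stieltjes (nu α)) rho0 E t α δ) η₁ η₂
            ((2 * (Real.pi : ℂ)) ^ 2 * rho t α δ)) := by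
  have hU : ∀ n, (QRelax.basisMatrix (ψ n))ᴴ * QRelax.basisMatrix (ψ n) = 1 := fun n =>
    QRelax.basisMatrix_conjTranspose_mul (ψ n)
  obtain ⟨f, hf⟩ := QRelax.exists_limit (s := s) (v := v) hU hconv
  obtain ⟨nu, hnu, hst⟩ := QRelax.exists_measures hU hf
  -- The pointwise limits are replaced by Stieltjes transforms, with which they agree off the real
  -- axis.
  have hf' : ∀ z : ℂ, z.im ≠ 0 → QRelax.SolvesAt nu0 s v (fun α => QRelax.stieltjes (nu α)) z ∧
      ∀ α, Tendsto (fun n : ℕ+ => QRelax.gbar s v (ev n) (QRelax.basisMatrix (ψ n)) α z) atTop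
        (𝓝 (QRelax.stieltjes (nu α) z)) := fun z hz =>
    ⟨(hf z hz).1.congr fun α => (hst α z hz).symm, fun α => by
      rw [hst α z hz]; exact (hf z hz).2 α⟩
  refine ⟨nu, hnu, QRelax.isSolution_stieltjes fun z hz => (hf' z hz).1, fun g hg α z hz =>
    QRelax.solvesAt_unique hz (hg.solvesAt hz) (hf' z hz).1 α, fun α δ z₁ z₂ h₁ h₂ =>
    QRelax.denom_ne_zero_of_solvesAt h₁.ne' h₂.ne (hf' z₁ h₁.ne').1 (hf' z₂ h₂.ne).1 α δ, ?_⟩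
  have hlim := fun α δ (p : ℤˣ × ℤˣ) =>
    QRelax.evolved_limit (f := fun α => QRelax.stieltjes (nu α)) hU hconv hf' hE α δ p.1 p.2
  choose r hr1 hr2 using hlim
  have hsum : ∀ (F : ℤˣ → ℤˣ → ℂ), ∑ β, ∑ γ, F β γ = ∑ p : ℤˣ × ℤˣ, F p.1 p.2 := fun F =>
    (Fintype.sum_prod_type fun p : ℤˣ × ℤˣ => F p.1 p.2).symm
  refine ⟨fun t => Matrix.of fun α δ => ∑ p : ℤˣ × ℤˣ, rho0 p.1 p.2 * r α δ p t,
    fun α δ T _ => ?_, fun α δ t ht η₁ η₂ h₁ h₂ => ?_⟩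
  · simp only [Matrix.of_apply]
    have h3 := QRelax.tendstoUniformlyOn_sum Finset.univ (fun p : ℤˣ × ℤˣ => rho0 p.1 p.2)
      fun p => hr1 α δ p T
    refine h3.congr (.of_forall fun n t _ => ?_)
    simp only
    rw [QRelax.meanReducedDensity_eq (ψ n) s v (h n) (ev n) (hψ n), hsum]
  · have h3 := QRelax.HasIteratedLineIntegral.sum (S := Finset.univ)
      (c := fun p : ℤˣ × ℤˣ => rho0 p.1 p.2) fun p => hr2 α δ p t ht η₁ η₂ h₁ h₂
    have h4 : ∑ p : ℤˣ × ℤˣ, rho0 p.1 p.2 * ((2 * (Real.pi : ℂ)) ^ 2 * r α δ p t)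
        = (2 * (Real.pi : ℂ)) ^ 2 * ∑ p : ℤˣ × ℤˣ, rho0 p.1 p.2 * r α δ p t := by
      rw [Finset.mul_sum]
      exact Finset.sum_congr rfl fun p _ => by ring
    rw [h4] at h3
    convert! h3 using 1
    ext z w
    rw [QRelax.sum_twoGreenLimit, hsum]
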